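/- Let $\sigma^2>0$, $\vartheta_2>0$, $\vartheta_1,\vartheta_0\in\mathbb R$, put $\kappa=\vartheta_1/\vartheta_2$, $\Gamma=\frac{\vartheta_1^2}{4\vartheta_2^2}-\frac{\vartheta_0}{\vartheta_2}$ and assume $\Gamma+\pi^2>0$. Let $X_t(x)=\sum_{\ell\ge1}u_\ell(t)e_\ell(x)$, $t\ge0$, $x\in[0,1]$, be the stationary solution of $$dX_t=(\vartheta_2\partial_x^2X_t+\vartheta_1\partial_xX_t+\vartheta_0X_t)\,dt+\sigma\,dW_t,\qquad X_t(0)=X_t(1)=0,$$ that is, $e_\ell(y)=\sqrt2\sin(\pi\ell y)e^{-\kappa y/2}$, $\lambda_\ell=\vartheta_2(\pi^2\ell^2+\Gamma)$, $du_\ell(t)=-\lambda_\ell u_\ell(t)\,dt+\sigma\,d\beta_\ell(t)$, where the $\beta_\ell$ are standard Brownian motions, $u_\ell(0)\sim\mathcal N(0,\sigma^2/(2\lambda_\ell))$, and $\{\beta_\ell,u_\ell(0):\ell\ge1\}$ is an independent family. Fix $T>0$ and $b\in(0,1/2)$. For $M,N\in\mathbb N$ the field is observed at $(t_i,y_k)$,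 $0\le i\le N$, $0\le k\le M$, where $t_i=i\Delta$, $y_k=b+k\delta$, $\Delta=T/N$, $\delta=(1-2b)/M$. For $v,w\in\mathbb N$ put $r=w\delta/\sqrt{v\Delta}$, $$D_{v,w}(i,k)=X_{t_{i+v}}(y_{k+w})-X_{t_i}(y_{k+w})-X_{t_{i+v}}(y_k)+X_{t_i}(y_k),$$ and for $\nu=1,2$ and $\tilde\eta=(\tilde\sigma^2,\tilde\vartheta_2,\tilde\kappa)\in(0,\infty)^2\times\mathbb R$ $$\mathcal K^\nu_{N,M}(\tilde\eta)=\frac1{M-w+1}\sum_{k=0}^{M-w}\Big(\frac1{(N-\nu v+1)\sqrt{\nu v\Delta}}\sum_{i=0}^{N-\nu v}D_{\nu v,w}^2(i,k)-f^\nu_{\tilde\eta}\Big(\frac{y_k+y_{k+w}}2\Big)\Big)^2,$$ $$f^\nu_{\tilde\eta}(z)=\tilde\sigma^2\,\psi_{\tilde\vartheta_2}(r/\sqrt\nu)\,e^{-\tilde\kappa z},\qquad \psi_{\vartheta}(r)=\frac2{\sqrt{\pi\vartheta}}\Big(1-e^{-\frac{r^2}{4\vartheta}}+\frac r{\sqrt\vartheta}\int_{\frac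 r{2\sqrt\vartheta}}^\infty e^{-z^2}dz\Big).$$ Let $H\subset(0,\infty)^2\times\mathbb R$ be compact and let $\eta=(\sigma^2,\vartheta_2,\kappa)$ lie in the interior of $H$. Let $M,N\to\infty$ (that is, $\min(M,N)\to\infty$) along a sequence (or a countably generated filter) along which there are $v,w\in\mathbb N$ with $v\asymp\max(1,N/M^2)$ and $w\asymp\max(1,M/\sqrt N)$ such that $w\delta/\sqrt{v\Delta}$ is constant. Then every estimator $\hat\eta_{v,w}\in\operatorname{arg\,min}_{\tilde\eta\in H}\big(\mathcal K^1_{N,M}(\tilde\eta)+\mathcal K^2_{N,M}(\tilde\eta)\big)$ satisfies $$\|\hat\eta_{v,w}-\eta\|=O_P\Big(\frac1{\sqrt{M^3\wedge N^{3/2}}}\Big),$$ i.e. for every $\varepsilon>0$ there is $C>0$ with $\limsup P\big(\sqrt{M^3\wedge N^{3/2}}\,\|\hat\eta_{v,w}-\eta\|\ge C\big)\le\varepsilon$. -/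

import Mathlib

open MeasureTheory ProbabilityTheory Filter Topology Asymptotics
open scoped NNReal ENNReal

noncomputable section

namespace SPDE

/-- The coefficients `(σ², ϑ₂, ϑ₁, ϑ₀)` of the equation
`dX_t = (ϑ₂ ∂²X_t + ϑ₁ ∂X_t + ϑ₀ X_t) dt + σ dW_t` on `[0,1]`, Dirichlet boundary conditions. -/
structure Coeffs where
  sigmaSq : ℝ
  th2 : ℝ
  th1 : ℝ
  th0 : ℝ

namespace Coeffs

variable (p : Coeffs)

/-- `κ = ϑ₁ / ϑ₂`. -/
def kappa : ℝ := p.th1 / p.th2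

/-- `Γ = ϑ₁² / (4 ϑ₂²) - ϑ₀ / ϑ₂`. -/
def Gam : ℝ := p.th1 ^ 2 / (4 * p.th2 ^ 2) - p.th0 / p.th2

/-- The parameter set `Θ`. -/
def Admissible : Prop := 0 < p.sigmaSq ∧ 0 < p.th2 ∧ 0 < p.Gam + Real.pi ^ 2

/-- The eigenvalue parameter `λ_ℓ = ϑ₂ (π² ℓ² + Γ)`; the eigenvalue of the operator is `-λ_ℓ`. -/
def lam (l : ℕ) : ℝ := p.th2 * (Real.pi ^ 2 * (l : ℝ) ^ 2 + p.Gam)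

/-- The eigenfunction `e_ℓ(y) = √2 sin(π ℓ y) e^{-κ y / 2}`. -/
def eig (l : ℕ) (y : ℝ) : ℝ :=
  Real.sqrt 2 * Real.sin (Real.pi * l * y) * Real.exp (-p.kappa * y / 2)

/-- The identifiable parameter `η = (σ², ϑ₂, κ)`. -/
def eta : EuclideanSpace ℝ (Fin 3) := !₂[p.sigmaSq, p.th2, p.kappa]

end Coeffs

/-- `X` is the stationary solution field
`X_t(x) = ∑_{ℓ ≥ 1} u_ℓ(t) e_ℓ(x)`, where `du_ℓ(t) = -λ_ℓ u_ℓ(t) dt + σ dβ_ℓ(t)`,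
the `β_ℓ` are standard Brownian motions, `u_ℓ(0) ∼ N(0, σ² / (2 λ_ℓ))`, and all the
`β_ℓ` and `u_ℓ(0)`, `ℓ ≥ 1`, are independent. The coordinate processes are indexed by `ℕ`,
with `j : ℕ` standing for `ℓ = j + 1`. Time is a real number, restricted to `t ≥ 0`. -/
structure IsStationarySolution {Ω : Type*} [MeasurableSpace Ω] (P : Measure Ω) (p : Coeffs)
    (β : ℕ → ℝ≥0 → Ω → ℝ) (u : ℕ → ℝ → Ω → ℝ) (X : ℝ → ℝ → Ω → ℝ) : Prop where
  measurable_noise : ∀ j t, Measurable (β j t)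
  measurable_init : ∀ j, Measurable (u j 0)
  brownian : ∀ j, IsBrownianReal (β j) P
  init_law : ∀ j, HasLaw (u j 0)
    (gaussianReal 0 (p.sigmaSq / (2 * p.lam (j + 1))).toNNReal) P
  /-- The pairs `(u_ℓ(0), β_ℓ)` are independent ... -/
  indep_modes : iIndepFun (fun j ω => (u j 0 ω, fun t => β j t ω)) P
  /-- ... and so are the two components of each pair. -/
  indep_init : ∀ j, IndepFun (u j 0) (fun ω t => β j t ω) P
  continuous_paths : ∀ j, ∀ᵐ ω ∂P, ContinuousOn (fun t => u j t ω) (Set.Ici 0)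
  /-- The stochastic differential equation of `u_ℓ`, in integral form. -/
  dynamics : ∀ j, ∀ᵐ ω ∂P, ∀ t : ℝ, 0 ≤ t →
    u j t ω = u j 0 ω - p.lam (j + 1) * (∫ s in (0 : ℝ)..t, u j s ω)
      + Real.sqrt p.sigmaSq * β j t.toNNReal ω
  series : ∀ t : ℝ, 0 ≤ t → ∀ x ∈ Set.Icc (0 : ℝ) 1, ∀ᵐ ω ∂P,
    Tendsto (fun n => ∑ j ∈ Finset.range n, u j t ω * p.eig (j + 1) x) atTop (𝓝 (X t x ω))

/-- Spatial mesh `δ = (1 - 2b) / M`. -/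
def meshX (b : ℝ) (M : ℕ) : ℝ := (1 - 2 * b) / M

/-- Temporal mesh `Δ = T / N`. -/
def meshT (T : ℝ) (N : ℕ) : ℝ := T / N

/-- Spatial grid point `y_k = b + k δ`. -/
def gridX (b : ℝ) (M k : ℕ) : ℝ := b + k * meshX b M

/-- Temporal grid point `t_i = i Δ`. -/
def gridT (T : ℝ) (N i : ℕ) : ℝ := i * meshT T N

/-- The ratio `r = w δ / √(v Δ)` of the coarse grid. -/
def ratio (b T : ℝ) (M N v w : ℕ) : ℝ := w * meshX b M / Real.sqrt (v * meshT T N)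

/-- Double increment `D_{v,w}(i,k)` on the coarse grid of a function `x` of time and space. -/
def doubleInc (b T : ℝ) (M N : ℕ) (x : ℝ → ℝ → ℝ) (v w i k : ℕ) : ℝ :=
  x (gridT T N (i + v)) (gridX b M (k + w)) - x (gridT T N i) (gridX b M (k + w))
    - x (gridT T N (i + v)) (gridX b M k) + x (gridT T N i) (gridX b M k)

/-- `ψ_ϑ(r) = 2/√(πϑ) (1 - e^{-r²/(4ϑ)} + r/√ϑ ∫_{r/(2√ϑ)}^∞ e^{-z²} dz)`. -/
def psi (th r : ℝ) : ℝ :=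
  2 / Real.sqrt (Real.pi * th) *
    (1 - Real.exp (-r ^ 2 / (4 * th))
      + r / Real.sqrt th * ∫ z in Set.Ioi (r / (2 * Real.sqrt th)), Real.exp (-z ^ 2))

/-- `f^ν_η(z) = σ² ψ_{ϑ₂}(r/√ν) e^{-κ z}` for `η = (σ², ϑ₂, κ)`. -/
def regr (r : ℝ) (ν : ℕ) (h : EuclideanSpace ℝ (Fin 3)) (z : ℝ) : ℝ :=
  h 0 * psi (h 1) (r / Real.sqrt ν) * Real.exp (-(h 2) * z)

/-- The contrast `𝒦^ν_{N,M}(h)` computed from the observed path `x`. The index sets are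
`0 ≤ k ≤ M - w` and `0 ≤ i ≤ N - ν v`. -/
def contrastPart (b T : ℝ) (M N v w : ℕ) (x : ℝ → ℝ → ℝ) (ν : ℕ)
    (h : EuclideanSpace ℝ (Fin 3)) : ℝ :=
  1 / ((M : ℝ) - w + 1) * ∑ k ∈ Finset.range (M + 1 - w),
    (1 / (((N : ℝ) - ν * v + 1) * Real.sqrt (ν * v * meshT T N)) *
        (∑ i ∈ Finset.range (N + 1 - ν * v), doubleInc b T M N x (ν * v) w i k ^ 2)
      - regr (ratio b T M N v w) ν h ((gridX b M k + gridX b M (k + w)) / 2)) ^ 2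

/-- The contrast `𝒦¹_{N,M} + 𝒦²_{N,M}`. -/
def contrast (b T : ℝ) (M N v w : ℕ) (x : ℝ → ℝ → ℝ) (h : EuclideanSpace ℝ (Fin 3)) : ℝ :=
  contrastPart b T M N v w x 1 h + contrastPart b T M N v w x 2 h

/-- `h` is a minimizer over `H` of the contrast, that is, a value of the estimator. -/
def IsLeastSquares (b T : ℝ) (M N v w : ℕ) (H : Set (EuclideanSpace ℝ (Fin 3)))
    (x : ℝ → ℝ → ℝ) (h : EuclideanSpace ℝ (Fin 3)) : Prop :=
  h ∈ H ∧ IsMinOn (contrast b T M N v w x) H h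

/-- `Z = O_P(a)` along the filter `l`. For non-measurable `Z`, `P` is the outer measure. -/
def IsBigOP {Ω ι : Type*} [MeasurableSpace Ω] (P : Measure Ω) (l : Filter ι)
    (Z : ι → Ω → ℝ) (a : ι → ℝ) : Prop :=
  ∀ ε : ℝ, 0 < ε → ∃ C : ℝ, 0 < C ∧
    limsup (fun n => P {ω | C * a n ≤ |Z n ω|}) l ≤ ENNReal.ofReal ε

end SPDE

end

noncomputable section

namespace SPDE

/-- `Z` is a centered Gaussian random variable with variance `q`. -/
def GaussLaw {Ω : Type*} [MeasurableSpace Ω] (P : Measure Ω) (Z : Ω → ℝ) (q : ℝ) : Prop :=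
  0 ≤ q ∧ HasLaw Z (gaussianReal 0 q.toNNReal) P

section Gauss

variable {Ω : Type*} [MeasurableSpace Ω] {P : Measure Ω}

lemma integral_pow_four_gaussianReal (v : ℝ≥0) :
    ∫ x, x ^ 4 ∂(gaussianReal 0 v) = 3 * (v : ℝ) ^ 2 := by
  have h := iteratedDeriv_mgf_zero (X := id) (μ := gaussianReal 0 v)
    (by rw [integrableExpSet_id_gaussianReal]; simp) 4
  have e0 : ∀ t : ℝ, HasDerivAt (fun t : ℝ => Real.exp ((v : ℝ) * t ^ 2 / 2))
      ((v : ℝ) * t * Real.exp ((v : ℝ) * t ^ 2 / 2)) t := by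
    intro t
    have h1 : HasDerivAt (fun t : ℝ => (v : ℝ) * t ^ 2 / 2) ((v : ℝ) * t) t := by
      have := ((hasDerivAt_pow 2 t).const_mul (v : ℝ)).div_const 2
      refine this.congr_deriv ?_
      norm_num
      ring
    exact h1.exp.congr_deriv (by ring)
  have key : ∀ (p p' : ℝ → ℝ), (∀ t, HasDerivAt p (p' t) t) →
      deriv (fun t => p t * Real.exp ((v : ℝ) * t ^ 2 / 2))
        = fun t => (p' t + p t * (v * t)) * Real.exp ((v : ℝ) * t ^ 2 / 2) := by
    intro p p' hp
    funext t
    rw [((hp t).fun_mul (e0 t)).deriv]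
    ring
  have hm : mgf id (gaussianReal 0 v)
      = fun t => (fun _ : ℝ => (1 : ℝ)) t * Real.exp ((v : ℝ) * t ^ 2 / 2) := by
    rw [mgf_id_gaussianReal]; funext t; simp
  rw [hm, iteratedDeriv_eq_iterate] at h
  simp only [Function.iterate_succ, Function.iterate_zero, Function.comp_apply, id] at h
  rw [key (fun _ => 1) (fun _ => 0) (fun t => hasDerivAt_const t 1)] at h
  rw [key (fun t => 0 + 1 * (v * t)) (fun _ => v) (fun t => by
    have := ((hasDerivAt_id t).const_mul (v : ℝ))
    simpa using this)] at h
  rw [key (fun t => v + (0 + 1 * (v * t)) * (v * t)) (fun t => 2 * v ^ 2 * t) (fun t => by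
    have := ((hasDerivAt_pow 2 t).const_mul ((v : ℝ) ^ 2)).const_add (v : ℝ)
    refine (this.congr_deriv ?_).congr_of_eventuallyEq (Eventually.of_forall fun s => ?_)
    · simp; ring
    · simp; ring)] at h
  rw [key (fun t => 2 * v ^ 2 * t + (v + (0 + 1 * (v * t)) * (v * t)) * (v * t))
    (fun t => 3 * v ^ 2 + 3 * v ^ 3 * t ^ 2) (fun t => by
    have := ((hasDerivAt_id t).const_mul (3 * (v : ℝ) ^ 2)).add
      ((hasDerivAt_pow 3 t).const_mul ((v : ℝ) ^ 3))
    refine (this.congr_deriv ?_).congr_of_eventuallyEq (Eventually.of_forall fun s => ?_)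
    · simp; ring
    · simp; ring)] at h
  simp only [Pi.pow_apply, id] at h
  rw [← h]
  simp

namespace GaussLaw

lemma nonneg {Z : Ω → ℝ} {q : ℝ} (h : GaussLaw P Z q) : 0 ≤ q := h.1

lemma aemeasurable {Z : Ω → ℝ} {q : ℝ} (h : GaussLaw P Z q) : AEMeasurable Z P := h.2.aemeasurable

lemma memLp {Z : Ω → ℝ} {q : ℝ} (h : GaussLaw P Z q) (p : ℝ≥0) : MemLp Z p P := by
  have := (memLp_id_gaussianReal (μ := 0) (v := q.toNNReal) p)
  rw [← h.2.map_eq] at this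
  exact (memLp_map_measure_iff (by fun_prop) h.aemeasurable).1 this

lemma integral_sq {Z : Ω → ℝ} {q : ℝ} (h : GaussLaw P Z q) : ∫ ω, Z ω ^ 2 ∂P = q := by
  have h1 := h.2.integral_comp (f := fun x : ℝ => x ^ 2) (by fun_prop)
  simp only [Function.comp_def] at h1
  rw [h1]
  have h2 := variance_id_gaussianReal (μ := 0) (v := q.toNNReal)
  rw [variance_of_integral_eq_zero (by fun_prop) (by simp)] at h2
  simp only [id] at h2
  rw [h2, Real.coe_toNNReal _ h.1]

lemma integral_pow_four {Z : Ω → ℝ} {q : ℝ} (h : GaussLaw P Z q) :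
    ∫ ω, Z ω ^ 4 ∂P = 3 * q ^ 2 := by
  have h1 := h.2.integral_comp (f := fun x : ℝ => x ^ 4) (by fun_prop)
  simp only [Function.comp_def] at h1
  rw [h1, integral_pow_four_gaussianReal, Real.coe_toNNReal _ h.1]

lemma const_mul {Z : Ω → ℝ} {q : ℝ} (h : GaussLaw P Z q) (c : ℝ) :
    GaussLaw P (fun ω => c * Z ω) (c ^ 2 * q) := by
  refine ⟨mul_nonneg (sq_nonneg c) h.1, ?_⟩
  have := gaussianReal_const_mul h.2 c
  convert this using 2
  · simp
  · ext
    rw [NNReal.coe_mul, Real.coe_toNNReal _ (mul_nonneg (sq_nonneg c) h.1),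
      Real.coe_toNNReal _ h.1]
    rfl

lemma zero [IsProbabilityMeasure P] : GaussLaw P (fun _ => 0) 0 := by
  refine ⟨le_rfl, ?_⟩
  rw [Real.toNNReal_zero, gaussianReal_zero_var]
  exact hasLaw_dirac_of_ae_eq (by rfl)

lemma add {Z W : Ω → ℝ} {q q' : ℝ} (h : GaussLaw P Z q) (h' : GaussLaw P W q')
    (hi : IndepFun Z W P) : GaussLaw P (fun ω => Z ω + W ω) (q + q') := by
  refine ⟨add_nonneg h.1 h'.1, h.aemeasurable.add h'.aemeasurable, ?_⟩
  have := gaussianReal_add_gaussianReal_of_indepFun hi h.2.map_eq h'.2.map_eq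
  rw [add_zero, ← Real.toNNReal_add h.1 h'.1] at this
  exact this

lemma sum [IsProbabilityMeasure P] {ι : Type*} {Z : ι → Ω → ℝ} {q : ι → ℝ}
    (hZ : ∀ i, GaussLaw P (Z i) (q i)) (hm : ∀ i, Measurable (Z i)) (hi : iIndepFun Z P)
    (s : Finset ι) :
    GaussLaw P (fun ω => ∑ i ∈ s, Z i ω) (∑ i ∈ s, q i) := by
  classical
  induction s using Finset.induction_on with
  | empty => simpa using zero
  | insert a s ha ih =>
    simp only [Finset.sum_insert ha]
    refine (hZ a).add ih ?_
    have := (hi.indepFun_finsetSum_of_notMem hm ha).symm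
    convert this using 1
    funext ω
    simp

lemma charFun_eq {Z : Ω → ℝ} {q : ℝ} (h : GaussLaw P Z q) (t : ℝ) :
    ∫ ω, Complex.exp (t * Z ω * Complex.I) ∂P = Complex.exp (-(q * t ^ 2 / 2 : ℝ)) := by
  have h1 := charFun_gaussianReal (μ := 0) (v := q.toNNReal) t
  rw [← h.2.map_eq, charFun_apply_real, integral_map h.aemeasurable (by fun_prop)] at h1
  rw [h1]
  congr 1
  simp [Real.coe_toNNReal _ h.1]

lemma of_tendsto [IsProbabilityMeasure P] {Z : ℕ → Ω → ℝ} {W : Ω → ℝ} {q : ℕ → ℝ} {q' : ℝ}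
    (hZ : ∀ n, GaussLaw P (Z n) (q n))
    (hlim : ∀ᵐ ω ∂P, Tendsto (fun n => Z n ω) atTop (𝓝 (W ω)))
    (hq : Tendsto q atTop (𝓝 q')) : GaussLaw P W q' := by
  have hq0 : 0 ≤ q' := ge_of_tendsto' hq fun n => (hZ n).1
  have hW : AEMeasurable W P :=
    aemeasurable_of_tendsto_metrizable_ae atTop (fun n => (hZ n).aemeasurable) hlim
  refine ⟨hq0, hW, ?_⟩
  have : IsProbabilityMeasure (P.map W) := Measure.isProbabilityMeasure_map hW
  refine Measure.ext_of_charFun ?_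
  funext t
  rw [charFun_gaussianReal, charFun_apply_real, integral_map hW (by fun_prop)]
  have l1 : Tendsto (fun n => ∫ ω, Complex.exp (t * Z n ω * Complex.I) ∂P) atTop
      (𝓝 (∫ ω, Complex.exp (t * W ω * Complex.I) ∂P)) := by
    refine tendsto_integral_of_dominated_convergence (fun _ => (1 : ℝ)) (fun n => ?_)
      (integrable_const _) (fun n => ?_) ?_
    · have := (hZ n).aemeasurable
      exact (by fun_prop : AEMeasurable _ P).aestronglyMeasurable
    · refine Eventually.of_forall fun ω => ?_
      rw [← Complex.ofReal_mul, Complex.norm_exp_ofReal_mul_I]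
    · filter_upwards [hlim] with ω hω
      have : Continuous fun x : ℝ => Complex.exp (t * x * Complex.I) := by fun_prop
      exact (this.tendsto _).comp hω
  have l2 : Tendsto (fun n => ∫ ω, Complex.exp (t * Z n ω * Complex.I) ∂P) atTop
      (𝓝 (Complex.exp (-(q' * t ^ 2 / 2 : ℝ)))) := by
    simp_rw [fun n => (hZ n).charFun_eq t]
    have : Continuous fun x : ℝ => Complex.exp (-(x * t ^ 2 / 2 : ℝ)) := by fun_prop
    exact (this.tendsto _).comp hq
  rw [tendsto_nhds_unique l1 l2]
  congr 1
  simp [Real.coe_toNNReal _ hq0]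

end GaussLaw

/-- The family `Z` restricted to `s` is centered Gaussian with covariance `K`. -/
def GaussFamily {ι : Type*} (P : Measure Ω) (s : Finset ι) (Z : ι → Ω → ℝ) (K : ι → ι → ℝ) : Prop :=
  ∀ c : ι → ℝ, GaussLaw P (fun ω => ∑ a ∈ s, c a * Z a ω) (∑ a ∈ s, ∑ b ∈ s, c a * c b * K a b)

namespace GaussFamily

variable {ι : Type*} {s : Finset ι} {Z : ι → Ω → ℝ} {K : ι → ι → ℝ}

lemma pair [DecidableEq ι] (h : GaussFamily P s Z K) {a b : ι} (ha : a ∈ s) (hb : b ∈ s)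
    (x y : ℝ) (hsymm : K a b = K b a) :
    GaussLaw P (fun ω => x * Z a ω + y * Z b ω)
      (x ^ 2 * K a a + 2 * x * y * K a b + y ^ 2 * K b b) := by
  have := h (fun i => (if i = a then x else 0) + (if i = b then y else 0))
  simp only [add_mul, Finset.sum_add_distrib, ite_mul, zero_mul, Finset.sum_ite_eq', ha, hb,
    if_true, mul_add, mul_ite, mul_zero] at this
  convert this using 1
  rw [← hsymm]
  ring

lemma single [DecidableEq ι] (h : GaussFamily P s Z K) {a : ι} (ha : a ∈ s) :
    GaussLaw P (Z a) (K a a) := by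
  have := h.pair ha ha 1 0 rfl
  simpa using this

lemma integral_sq_mul_sq [DecidableEq ι] (h : GaussFamily P s Z K) {a b : ι} (ha : a ∈ s)
    (hb : b ∈ s) (hsymm : K a b = K b a) :
    Integrable (fun ω => Z a ω ^ 2 * Z b ω ^ 2) P ∧
    ∫ ω, Z a ω ^ 2 * Z b ω ^ 2 ∂P = K a a * K b b + 2 * K a b ^ 2 := by
  have hp := h.pair ha hb 1 1 hsymm
  have hn := h.pair ha hb 1 (-1) hsymm
  have h1 := h.single ha
  have h2 := h.single hb
  have i4 : ∀ {W : Ω → ℝ} {q : ℝ}, GaussLaw P W q → Integrable (fun ω => W ω ^ 4) P := by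
    intro W q hW
    have := (hW.memLp 4).integrable_norm_pow (by norm_num)
    refine this.congr (Eventually.of_forall fun ω => ?_)
    simp only [Real.norm_eq_abs]
    exact Even.pow_abs (by decide) _
  have e : ∀ ω, Z a ω ^ 2 * Z b ω ^ 2 = (1 / 12) * (1 * Z a ω + 1 * Z b ω) ^ 4
      + (1 / 12) * (1 * Z a ω + (-1) * Z b ω) ^ 4 - (1 / 6) * Z a ω ^ 4 - (1 / 6) * Z b ω ^ 4 := by
    intro ω; ring
  have A := (i4 hp).const_mul (1 / 12)
  have B := (i4 hn).const_mul (1 / 12)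
  have C := (i4 h1).const_mul (1 / 6)
  have D := (i4 h2).const_mul (1 / 6)
  have AB := A.fun_add B
  have ABC : Integrable (fun ω => 1 / 12 * (1 * Z a ω + 1 * Z b ω) ^ 4
      + 1 / 12 * (1 * Z a ω + (-1) * Z b ω) ^ 4 - 1 / 6 * Z a ω ^ 4) P := AB.sub C
  simp_rw [e]
  refine ⟨ABC.sub D, ?_⟩
  rw [integral_sub ABC D, integral_sub AB C, integral_add A B,
    integral_const_mul, integral_const_mul, integral_const_mul, integral_const_mul,
    hp.integral_pow_four, hn.integral_pow_four, h1.integral_pow_four, h2.integral_pow_four]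
  ring

/-- Variance formula for the sum of squares of a Gaussian family. -/
lemma integral_sum_sq_sub [IsProbabilityMeasure P] [DecidableEq ι] (h : GaussFamily P s Z K)
    (hsymm : ∀ a b, K a b = K b a) (m : ℝ) :
    Integrable (fun ω => (∑ a ∈ s, Z a ω ^ 2 - m) ^ 2) P ∧
    ∫ ω, (∑ a ∈ s, Z a ω ^ 2 - m) ^ 2 ∂P
      = 2 * ∑ a ∈ s, ∑ b ∈ s, K a b ^ 2 + (∑ a ∈ s, K a a - m) ^ 2 := by
  have e : ∀ ω, (∑ a ∈ s, Z a ω ^ 2 - m) ^ 2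
      = ∑ a ∈ s, ∑ b ∈ s, Z a ω ^ 2 * Z b ω ^ 2 - 2 * m * ∑ a ∈ s, Z a ω ^ 2 + m ^ 2 := by
    intro ω
    rw [← Finset.sum_mul_sum]
    ring
  simp_rw [e]
  have A : ∀ a ∈ s, ∀ b ∈ s, Integrable (fun ω => Z a ω ^ 2 * Z b ω ^ 2) P := fun a ha b hb =>
    (h.integral_sq_mul_sq ha hb (hsymm a b)).1
  have A' : ∀ a ∈ s, Integrable (fun ω => ∑ b ∈ s, Z a ω ^ 2 * Z b ω ^ 2) P := fun a ha =>
    integrable_finsetSum _ (A a ha)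
  have A'' := integrable_finsetSum _ A'
  have B : ∀ a ∈ s, Integrable (fun ω => Z a ω ^ 2) P := fun a ha =>
    ((h.single ha).memLp 2).integrable_sq
  have B' := (integrable_finsetSum _ B).const_mul (2 * m)
  have AB : Integrable (fun ω => ∑ a ∈ s, ∑ b ∈ s, Z a ω ^ 2 * Z b ω ^ 2
      - 2 * m * ∑ a ∈ s, Z a ω ^ 2) P := A''.sub B'
  refine ⟨AB.fun_add (integrable_const _), ?_⟩
  rw [integral_add AB (integrable_const _), integral_sub A'' B', integral_const_mul,
    integral_finsetSum _ A', integral_finsetSum _ B]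
  rw [Finset.sum_congr rfl fun a ha => integral_finsetSum _ (A a ha)]
  rw [Finset.sum_congr rfl fun a ha => Finset.sum_congr rfl fun b hb =>
    (h.integral_sq_mul_sq ha hb (hsymm a b)).2]
  rw [Finset.sum_congr rfl fun a ha => (h.single ha).integral_sq]
  simp only [Finset.sum_add_distrib, ← Finset.mul_sum, ← Finset.sum_mul]
  simp
  ring

/-- A bound on the Hilbert–Schmidt norm of the covariance by its operator norm and its trace. -/
lemma sum_sq_le [DecidableEq ι] (h : GaussFamily P s Z K)
    (hsymm : ∀ a b, K a b = K b a) {Λ : ℝ} (hΛ : 0 < Λ)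
    (hop : ∀ c : ι → ℝ, ∑ a ∈ s, ∑ b ∈ s, c a * c b * K a b ≤ Λ * ∑ a ∈ s, c a ^ 2)
    {a : ι} (ha : a ∈ s) : ∑ b ∈ s, K a b ^ 2 ≤ Λ * K a a := by
  have h0 := (h (fun b => (if b = a then Λ else 0) - K a b)).nonneg
  have h1 := hop (fun b => K a b)
  have e : ∑ x ∈ s, ∑ b ∈ s, ((if x = a then Λ else 0) - K a x) *
      ((if b = a then Λ else 0) - K a b) * K x b
      = Λ ^ 2 * K a a - 2 * Λ * ∑ b ∈ s, K a b ^ 2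
        + ∑ x ∈ s, ∑ b ∈ s, K a x * K a b * K x b := by
    have e1 : ∀ x b, ((if x = a then Λ else 0) - K a x) *
        ((if b = a then Λ else 0) - K a b) * K x b
        = (if x = a then (if b = a then Λ ^ 2 * K a a else 0) else 0)
          - (if x = a then Λ * K a b ^ 2 else 0) - (if b = a then Λ * K a x ^ 2 else 0)
          + K a x * K a b * K x b := by
      intro x b
      split_ifs with hx hb hb
      · subst hx; subst hb; ring
      · subst hx; ring
      · subst hb; rw [hsymm x b]; ring
      · ring
    simp only [e1, Finset.sum_add_distrib, Finset.sum_sub_distrib, Finset.sum_ite_eq', ha, if_true]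
    have e2 : ∑ x ∈ s, ∑ b ∈ s, (if x = a then (if b = a then Λ ^ 2 * K a a else 0) else 0)
        = Λ ^ 2 * K a a := by
      rw [Finset.sum_eq_single_of_mem a ha]
      · simp [ha]
      · intro x _ hx; simp [hx]
    have e3 : ∑ x ∈ s, ∑ b ∈ s, (if x = a then Λ * K a b ^ 2 else 0)
        = Λ * ∑ b ∈ s, K a b ^ 2 := by
      rw [Finset.sum_eq_single_of_mem a ha]
      · simp [Finset.mul_sum]
      · intro x _ hx; simp [hx]
    rw [e2, e3, ← Finset.mul_sum]
    ring
  rw [e] at h0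
  have h2 : 0 ≤ Λ * (Λ * K a a - ∑ b ∈ s, K a b ^ 2) := by nlinarith
  have := nonneg_of_mul_nonneg_right h2 hΛ
  linarith

end GaussFamily

end Gauss

section OrnsteinUhlenbeck

/-- Euler-type approximation, on the grid of mesh `τ / (m + 1)`, of the solution at time `i τ` of
`df = -lam f dt + dB`. -/
def ouApprox (lam τ : ℝ) (f0 : ℝ) (B : ℝ → ℝ) (i m : ℕ) : ℝ :=
  Real.exp (-lam * τ * i) * f0 + ∑ q ∈ Finset.range (i * (m + 1)),
    Real.exp (-lam * τ * (i - q / ((m : ℝ) + 1))) *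
      (B ((q + 1 : ℕ) * τ / ((m : ℝ) + 1)) - B (q * τ / ((m : ℝ) + 1)))

lemma ouApprox_tendsto {lam τ : ℝ} (hlam : 0 < lam) (hτ : 0 < τ) {f B : ℝ → ℝ}
    (hf : ContinuousOn f (Set.Ici 0))
    (hB : ∀ t : ℝ, 0 ≤ t → f t = f 0 - lam * (∫ s in (0 : ℝ)..t, f s) + B t) (i : ℕ) :
    Tendsto (fun m : ℕ => ouApprox lam τ (f 0) B i m) atTop (𝓝 (f (i * τ))) := by
  set T : ℝ := i * τ with hT
  have hT0 : 0 ≤ T := by positivity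
  have hcK : ContinuousOn f (Set.Icc 0 T) := hf.mono Set.Icc_subset_Ici_self
  obtain ⟨C, hC⟩ := isCompact_Icc.exists_bound_of_continuousOn hcK
  have hC0 : 0 ≤ C := (norm_nonneg _).trans (hC 0 ⟨le_rfl, hT0⟩)
  have huc := isCompact_Icc.uniformContinuousOn_of_continuous hcK
  rw [Metric.uniformContinuousOn_iff] at huc
  rw [Metric.tendsto_atTop]
  intro ε hε
  set ε' : ℝ := ε / (4 * (T * lam + 1)) with hε'
  have hε'0 : 0 < ε' := by positivity
  obtain ⟨d, hd, hdc⟩ := huc ε' hε'0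
  have hlim : Tendsto (fun m : ℕ => τ / ((m : ℝ) + 1)) atTop (𝓝 0) :=
    tendsto_const_nhds.div_atTop
      (tendsto_atTop_add_const_right _ _ tendsto_natCast_atTop_atTop)
  have e1 := hlim.eventually (gt_mem_nhds hd)
  have e2 := hlim.eventually (gt_mem_nhds (show (0 : ℝ) < 1 / lam by positivity))
  have e3 := hlim.eventually (gt_mem_nhds (show (0 : ℝ) < ε / (4 * (T * lam ^ 2 * C + 1)) by
    positivity))
  obtain ⟨m0, hm0⟩ := (e1.and (e2.and e3)).exists_forall_of_atTop
  refine ⟨m0, fun m hm => ?_⟩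
  obtain ⟨h1, h2, h3⟩ := hm0 m hm
  set h : ℝ := τ / ((m : ℝ) + 1) with hh
  have hhpos : 0 < h := by positivity
  have hmp : (0 : ℝ) < (m : ℝ) + 1 := by positivity
  have hsq : ∀ q : ℕ, (q : ℝ) * τ / ((m : ℝ) + 1) = q * h := fun q => by rw [hh]; ring
  have hTn : ((i * (m + 1) : ℕ) : ℝ) * h = T := by
    rw [hh, hT]; push_cast; field_simp
  set n := i * (m + 1) with hn
  have tele : f T = Real.exp (-lam * T) * f 0 + ∑ q ∈ Finset.range n,
      (Real.exp (-lam * (T - (q + 1 : ℕ) * h)) * f ((q + 1 : ℕ) * h)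
        - Real.exp (-lam * (T - q * h)) * f (q * h)) := by
    rw [Finset.sum_range_sub (fun q : ℕ => Real.exp (-lam * (T - q * h)) * f (q * h))]
    rw [hTn]
    simp
  have hintegrable : ∀ a b : ℝ, 0 ≤ a → a ≤ b → IntervalIntegrable f volume a b := by
    intro a b ha hab
    refine (hf.mono ?_).intervalIntegrable
    rw [Set.uIcc_of_le hab]
    exact fun x hx => ha.trans hx.1
  have hterm : ∀ q ∈ Finset.range n,
      |Real.exp (-lam * τ * (i - q / ((m : ℝ) + 1))) *
        (B ((q + 1 : ℕ) * τ / ((m : ℝ) + 1)) - B (q * τ / ((m : ℝ) + 1)))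
      - (Real.exp (-lam * (T - (q + 1 : ℕ) * h)) * f ((q + 1 : ℕ) * h)
        - Real.exp (-lam * (T - q * h)) * f (q * h))| ≤ h * (lam ^ 2 * h * C + lam * ε') := by
    intro q hq
    rw [Finset.mem_range] at hq
    rw [hsq, hsq]
    have hq1 : ((q + 1 : ℕ) : ℝ) * h ≤ T := by
      rw [← hTn]
      exact mul_le_mul_of_nonneg_right (by exact_mod_cast hq) hhpos.le
    have hq0 : 0 ≤ (q : ℝ) * h := by positivity
    have hqq : ((q + 1 : ℕ) : ℝ) * h = q * h + h := by push_cast; ring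
    have hle : (q : ℝ) * h ≤ ((q + 1 : ℕ) : ℝ) * h := by rw [hqq]; linarith
    have ex1 : -lam * τ * (i - q / ((m : ℝ) + 1)) = -lam * (T - q * h) := by
      rw [hh, hT]; ring
    have ex2 : Real.exp (-lam * (T - (q + 1 : ℕ) * h))
        = Real.exp (-lam * (T - q * h)) * Real.exp (lam * h) := by
      rw [← Real.exp_add]; congr 1; rw [hqq]; ring
    have b1 := hB _ (hq0.trans hle)
    have b2 := hB _ hq0
    have b3 := intervalIntegral.integral_add_adjacent_intervals (hintegrable 0 _ le_rfl hq0)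
      (hintegrable _ _ hq0 hle)
    set I := ∫ s in (q * h)..(((q + 1 : ℕ) : ℝ) * h), f s with hI
    set F := f (((q + 1 : ℕ) : ℝ) * h) with hF
    set E := Real.exp (-lam * (T - q * h)) with hE
    have hE1 : E ≤ 1 := by
      rw [hE, Real.exp_le_one_iff]
      nlinarith
    have hE0 : 0 < E := Real.exp_pos _
    rw [ex1, ex2]
    have eq : E * (B (((q + 1 : ℕ) : ℝ) * h) - B (q * h)) - (E * Real.exp (lam * h) * F - E * f (q * h))
        = -E * ((Real.exp (lam * h) - 1 - lam * h) * F + lam * (h * F - I)) := by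
      have : B (((q + 1 : ℕ) : ℝ) * h) - B (q * h) = F - f (q * h) + lam * I := by
        rw [← b3] at b1
        linear_combination b2 - b1
      rw [this]; ring
    rw [eq, abs_mul, abs_neg, abs_of_pos hE0]
    have c1 : |Real.exp (lam * h) - 1 - lam * h| ≤ (lam * h) ^ 2 := by
      apply Real.abs_exp_sub_one_sub_id_le
      rw [abs_of_pos (by positivity)]
      have := (lt_div_iff₀ hlam).1 h2
      linarith
    have c2 : |F| ≤ C := hC _ ⟨hq0.trans hle, hq1⟩
    have c3 : |h * F - I| ≤ ε' * h := by
      have e : h * F - I = ∫ s in (q * h)..(((q + 1 : ℕ) : ℝ) * h), (F - f s) := by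
        rw [intervalIntegral.integral_sub (by simp) (hintegrable _ _ hq0 hle)]
        rw [intervalIntegral.integral_const, smul_eq_mul, hqq, add_sub_cancel_left, ← hqq]
      rw [e]
      have := intervalIntegral.norm_integral_le_of_norm_le_const (a := (q : ℝ) * h)
        (b := ((q + 1 : ℕ) : ℝ) * h) (f := fun s => F - f s) (C := ε') (by
          intro x hx
          rw [Set.uIoc_of_le hle] at hx
          have := hdc _ ⟨hq0.trans hle, hq1⟩ x ⟨hq0.trans hx.1.le, hx.2.trans hq1⟩ (by
            rw [Real.dist_eq, abs_of_nonneg (by linarith [hx.2])]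
            have := hx.1
            rw [hqq]; linarith)
          rw [Real.dist_eq] at this
          exact this.le)
      rw [Real.norm_eq_abs] at this
      refine this.trans (le_of_eq ?_)
      rw [abs_of_nonneg (by linarith), hqq]; ring
    calc E * |(Real.exp (lam * h) - 1 - lam * h) * F + lam * (h * F - I)|
        ≤ 1 * (|(Real.exp (lam * h) - 1 - lam * h)| * |F| + lam * |h * F - I|) := by
          gcongr
          refine (abs_add_le _ _).trans ?_
          rw [abs_mul, abs_mul, abs_of_pos hlam]
      _ ≤ 1 * ((lam * h) ^ 2 * C + lam * (ε' * h)) := by gcongr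
      _ = _ := by ring
  have hdiff : |ouApprox lam τ (f 0) B i m - f T| ≤ n * (h * (lam ^ 2 * h * C + lam * ε')) := by
    have : ouApprox lam τ (f 0) B i m - f T = ∑ q ∈ Finset.range n,
      (Real.exp (-lam * τ * (i - q / ((m : ℝ) + 1))) *
        (B ((q + 1 : ℕ) * τ / ((m : ℝ) + 1)) - B (q * τ / ((m : ℝ) + 1)))
      - (Real.exp (-lam * (T - (q + 1 : ℕ) * h)) * f ((q + 1 : ℕ) * h)
        - Real.exp (-lam * (T - q * h)) * f (q * h))) := by
      rw [tele, Finset.sum_sub_distrib, ouApprox]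
      rw [show -lam * τ * (i : ℝ) = -lam * T by rw [hT]; ring]
      rw [add_sub_add_left_eq_sub, ← Finset.sum_sub_distrib, ← Finset.sum_sub_distrib]
    rw [this]
    refine (Finset.abs_sum_le_sum_abs _ _).trans ((Finset.sum_le_sum hterm).trans ?_)
    simp
  rw [Real.dist_eq]
  refine hdiff.trans_lt ?_
  rw [← mul_assoc, hTn]
  have k1 : T * lam ^ 2 * C * h ≤ ε / 4 := by
    have h3' := h3.le
    rw [le_div_iff₀ (by positivity)] at h3'
    have : 0 ≤ T * lam ^ 2 * C * h := by positivity
    nlinarith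
  have k2 : T * lam * ε' ≤ ε / 4 := by
    have : ε' * (4 * (T * lam + 1)) = ε := by rw [hε']; field_simp
    nlinarith
  nlinarith

lemma geom_riemann_tendsto {x τ : ℝ} (hx : 0 < x) (hτ : 0 < τ) (L : ℕ) :
    Tendsto (fun m : ℕ => τ / ((m : ℝ) + 1) * ∑ q ∈ Finset.range (L * (m + 1)),
      Real.exp (x * τ * (q / ((m : ℝ) + 1)))) atTop (𝓝 ((Real.exp (x * τ * L) - 1) / x)) := by
  have hy : Tendsto (fun m : ℕ => x * τ / ((m : ℝ) + 1)) atTop (𝓝[≠] 0) := by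
    refine tendsto_nhdsWithin_iff.2 ⟨tendsto_const_nhds.div_atTop
      (tendsto_atTop_add_const_right _ _ tendsto_natCast_atTop_atTop), ?_⟩
    refine Eventually.of_forall fun m => ?_
    have : 0 < x * τ / ((m : ℝ) + 1) := by positivity
    exact this.ne'
  have hd := (hasDerivAt_iff_tendsto_slope_zero.1 (Real.hasDerivAt_exp 0)).comp hy
  simp only [Real.exp_zero, zero_add, smul_eq_mul, Function.comp_def] at hd
  have h2 := (hd.inv₀ one_ne_zero).const_mul ((Real.exp (x * τ * L) - 1) / x)
  simp only [inv_one, mul_one] at h2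
  refine h2.congr fun m => ?_
  have hm : (0 : ℝ) < (m : ℝ) + 1 := by positivity
  set y := x * τ / ((m : ℝ) + 1) with hyd
  have hy0 : 0 < y := by positivity
  have hne : Real.exp y - 1 ≠ 0 := by
    have := Real.add_one_lt_exp hy0.ne'
    linarith
  have e : ∀ q : ℕ, Real.exp (x * τ * (q / ((m : ℝ) + 1))) = Real.exp y ^ q := by
    intro q
    rw [← Real.exp_nat_mul, hyd]; congr 1; ring
  simp_rw [e]
  rw [geom_sum_eq (by intro h; rw [h] at hne; simp at hne), ← Real.exp_nat_mul]
  have : ((L * (m + 1) : ℕ) : ℝ) * y = x * τ * L := by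
    rw [hyd]; push_cast; field_simp
  rw [this]
  have hτ' : τ / ((m : ℝ) + 1) = y / x := by rw [hyd]; field_simp
  rw [hτ']
  field_simp

/-- Covariance of the stationary Ornstein–Uhlenbeck process with variance `v0` on the grid `τ ℕ`. -/
def ouCov (v0 lam τ : ℝ) (i j : ℕ) : ℝ := v0 * Real.exp (-lam * τ * |(i : ℝ) - j|)

lemma ouCov_tendsto {lam τ S : ℝ} (hlam : 0 < lam) (hτ : 0 < τ) (i j : ℕ) :
    Tendsto (fun m : ℕ => S / (2 * lam) * (Real.exp (-lam * τ * i) * Real.exp (-lam * τ * j))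
      + τ / ((m : ℝ) + 1) * ∑ q ∈ Finset.range (min i j * (m + 1)),
        S * (Real.exp (-lam * τ * (i - q / ((m : ℝ) + 1)))
          * Real.exp (-lam * τ * (j - q / ((m : ℝ) + 1)))))
      atTop (𝓝 (ouCov (S / (2 * lam)) lam τ i j)) := by
  have h := geom_riemann_tendsto (x := 2 * lam) (by positivity) hτ (min i j)
  have h2 := (h.const_mul (S * Real.exp (-lam * τ * (i + j)))).const_add
    (S / (2 * lam) * (Real.exp (-lam * τ * i) * Real.exp (-lam * τ * j)))
  have elim : S / (2 * lam) * (Real.exp (-lam * τ * i) * Real.exp (-lam * τ * j)) +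
      S * Real.exp (-lam * τ * (i + j)) *
        ((Real.exp (2 * lam * τ * (min i j : ℕ)) - 1) / (2 * lam))
      = ouCov (S / (2 * lam)) lam τ i j := by
    rw [ouCov, ← Real.exp_add]
    have : Real.exp (-lam * τ * |(i : ℝ) - j|)
        = Real.exp (-lam * τ * (i + j)) * Real.exp (2 * lam * τ * (min i j : ℕ)) := by
      rw [← Real.exp_add]
      congr 1
      rcases le_total i j with hij | hij
      · rw [min_eq_left hij, abs_of_nonpos (by simpa using hij)]; ring
      · rw [min_eq_right hij, abs_of_nonneg (by simpa using hij)]; ring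
    rw [this, show -lam * τ * i + -lam * τ * j = -lam * τ * (i + j) by ring]
    field_simp
    ring
  rw [elim] at h2
  refine h2.congr fun m => ?_
  congr 1
  rw [mul_left_comm, Finset.mul_sum]
  congr 1
  refine Finset.sum_congr rfl fun q _ => ?_
  rw [← Real.exp_add, mul_assoc, ← Real.exp_add]
  congr 2
  ring

end OrnsteinUhlenbeck

section Modes

variable {Ω : Type*} [MeasurableSpace Ω] {P : Measure Ω} [IsProbabilityMeasure P] {p : Coeffs}
  {β : ℕ → ℝ≥0 → Ω → ℝ} {u : ℕ → ℝ → Ω → ℝ} {X : ℝ → ℝ → Ω → ℝ}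

lemma Coeffs.Admissible.lam_lower (hp : p.Admissible) (j : ℕ) :
    p.th2 * min (Real.pi ^ 2) (p.Gam + Real.pi ^ 2) * ((j : ℝ) + 1) ^ 2 ≤ p.lam (j + 1) := by
  have h2 := hp.2.1
  rw [Coeffs.lam, mul_assoc]
  refine mul_le_mul_of_nonneg_left ?_ h2.le
  push_cast
  have h1 : (1 : ℝ) ≤ ((j : ℝ) + 1) ^ 2 := by
    have : (0 : ℝ) ≤ j := by positivity
    nlinarith
  rcases le_total 0 p.Gam with h | h
  · rw [min_eq_left (by linarith)]; nlinarith
  · rw [min_eq_right (by linarith)]; nlinarith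

lemma Coeffs.Admissible.lam_pos (hp : p.Admissible) (j : ℕ) : 0 < p.lam (j + 1) := by
  refine lt_of_lt_of_le ?_ (hp.lam_lower j)
  have := hp.2.1
  have := hp.2.2
  have : 0 < min (Real.pi ^ 2) (p.Gam + Real.pi ^ 2) := lt_min (by positivity) this
  positivity

/-- The covariance of the `j`-th coordinate process on the grid `τ ℕ`. -/
def modeCov (p : Coeffs) (τ : ℝ) (j : ℕ) (i i' : ℕ) : ℝ :=
  ouCov (p.sigmaSq / (2 * p.lam (j + 1))) (p.lam (j + 1)) τ i i'

lemma sum_ouApprox {A : Type*} (s : Finset A) (i : A → ℕ) (L : ℕ) (hL : ∀ a ∈ s, i a ≤ L)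
    (y : A → ℝ) (lam τ f0 : ℝ) (B : ℝ → ℝ) (m : ℕ) :
    ∑ a ∈ s, y a * ouApprox lam τ f0 B (i a) m
      = (∑ a ∈ s, y a * Real.exp (-lam * τ * i a)) * f0 + ∑ q ∈ Finset.range (L * (m + 1)),
        (∑ a ∈ s, if q < i a * (m + 1) then
          y a * Real.exp (-lam * τ * (i a - q / ((m : ℝ) + 1))) else 0) *
        (B ((q + 1 : ℕ) * τ / ((m : ℝ) + 1)) - B (q * τ / ((m : ℝ) + 1))) := by
  simp only [ouApprox, mul_add (y _), Finset.sum_add_distrib, Finset.sum_mul]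
  congr 1
  · exact Finset.sum_congr rfl fun a _ => by ring
  rw [Finset.sum_comm]
  refine Finset.sum_congr rfl fun a ha => ?_
  simp only [ite_mul, zero_mul]
  rw [← Finset.sum_filter]
  have : (Finset.range (L * (m + 1))).filter (fun q => q < i a * (m + 1))
      = Finset.range (i a * (m + 1)) := by
    ext q
    simp only [Finset.mem_filter, Finset.mem_range]
    exact ⟨fun h => h.2, fun h => ⟨h.trans_le (Nat.mul_le_mul_right _ (hL a ha)), h⟩⟩
  rw [this, Finset.mul_sum]
  exact Finset.sum_congr rfl fun q _ => by ring

lemma sum_ouApprox_var {A : Type*} (s : Finset A) (i : A → ℕ) (L : ℕ) (hL : ∀ a ∈ s, i a ≤ L)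
    (y : A → ℝ) (lam τ S : ℝ) (m : ℕ) :
    (∑ a ∈ s, y a * Real.exp (-lam * τ * i a)) ^ 2 * (S / (2 * lam))
      + ∑ q ∈ Finset.range (L * (m + 1)),
        (∑ a ∈ s, if q < i a * (m + 1) then
          y a * Real.exp (-lam * τ * (i a - q / ((m : ℝ) + 1))) else 0) ^ 2 *
        (S * (τ / ((m : ℝ) + 1)))
    = ∑ a ∈ s, ∑ b ∈ s, y a * y b * (S / (2 * lam) *
        (Real.exp (-lam * τ * i a) * Real.exp (-lam * τ * i b))
      + τ / ((m : ℝ) + 1) * ∑ q ∈ Finset.range (min (i a) (i b) * (m + 1)),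
        S * (Real.exp (-lam * τ * (i a - q / ((m : ℝ) + 1)))
          * Real.exp (-lam * τ * (i b - q / ((m : ℝ) + 1))))) := by
  simp only [mul_add (_ * _ : ℝ), Finset.sum_add_distrib]
  congr 1
  · rw [sq, Finset.sum_mul_sum, Finset.sum_mul]
    refine Finset.sum_congr rfl fun a _ => ?_
    rw [Finset.sum_mul]
    exact Finset.sum_congr rfl fun b _ => by ring
  have e : ∀ q, (∑ a ∈ s, if q < i a * (m + 1) then
          y a * Real.exp (-lam * τ * (i a - q / ((m : ℝ) + 1))) else 0) ^ 2 *
        (S * (τ / ((m : ℝ) + 1))) = ∑ a ∈ s, ∑ b ∈ s,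
        if q < min (i a) (i b) * (m + 1) then y a * y b * (τ / ((m : ℝ) + 1) *
        (S * (Real.exp (-lam * τ * (i a - q / ((m : ℝ) + 1)))
          * Real.exp (-lam * τ * (i b - q / ((m : ℝ) + 1)))))) else 0 := by
    intro q
    rw [sq, Finset.sum_mul_sum, Finset.sum_mul]
    refine Finset.sum_congr rfl fun a _ => ?_
    rw [Finset.sum_mul]
    refine Finset.sum_congr rfl fun b _ => ?_
    have : q < min (i a) (i b) * (m + 1) ↔ q < i a * (m + 1) ∧ q < i b * (m + 1) := by
      rw [← Nat.mul_min_mul_right, lt_min_iff]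
    by_cases h1 : q < i a * (m + 1) <;> by_cases h2 : q < i b * (m + 1) <;>
      simp only [this, h1, h2, and_true, and_false, if_true, if_false] <;> ring
  simp_rw [e]
  rw [Finset.sum_comm]
  refine Finset.sum_congr rfl fun a ha => ?_
  rw [Finset.sum_comm]
  refine Finset.sum_congr rfl fun b _ => ?_
  rw [← Finset.sum_filter]
  have : (Finset.range (L * (m + 1))).filter (fun q => q < min (i a) (i b) * (m + 1))
      = Finset.range (min (i a) (i b) * (m + 1)) := by
    ext q
    simp only [Finset.mem_filter, Finset.mem_range]
    refine ⟨fun h => h.2, fun h => ⟨h.trans_le (Nat.mul_le_mul_right _ ?_), h⟩⟩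
    exact (min_le_left _ _).trans (hL a ha)
  rw [this, Finset.mul_sum, Finset.mul_sum]

lemma IsStationarySolution.gaussLaw_modes (hp : p.Admissible)
    (hX : IsStationarySolution P p β u X) {τ : ℝ} (hτ : 0 < τ) {A : Type*} (s : Finset A)
    (i : A → ℕ) (y : ℕ → A → ℝ) (n : ℕ) :
    GaussLaw P (fun ω => ∑ j ∈ Finset.range n, ∑ a ∈ s, y j a * u j (i a * τ) ω)
      (∑ j ∈ Finset.range n, ∑ a ∈ s, ∑ b ∈ s, y j a * y j b * modeCov p τ j (i a) (i b)) := by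
  set L := s.sup i
  have hL : ∀ a ∈ s, i a ≤ L := fun a ha => Finset.le_sup ha
  set S := p.sigmaSq with hS
  have hS0 : 0 < S := hp.1
  set σ := Real.sqrt S with hσ
  have hσ2 : σ ^ 2 = S := Real.sq_sqrt hS0.le
  have hlam := fun j => hp.lam_pos j
  let A0 : ℕ → ℝ := fun j => ∑ a ∈ s, y j a * Real.exp (-p.lam (j + 1) * τ * i a)
  let W : ℕ → ℕ → ℕ → ℝ := fun j m q => ∑ a ∈ s, if q < i a * (m + 1) then
          y j a * Real.exp (-p.lam (j + 1) * τ * (i a - q / ((m : ℝ) + 1))) else 0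
  let g : ℕ → ℕ → ℝ≥0 := fun m q => (q * τ / ((m : ℝ) + 1)).toNNReal
  have hg : ∀ m, Monotone (g m) := by
    intro m q q' hqq
    apply Real.toNNReal_le_toNNReal
    gcongr
  let φ : ℕ → ℕ → (ℝ × (ℝ≥0 → ℝ)) → ℝ := fun m j z => A0 j * z.1
    + ∑ q ∈ Finset.range (L * (m + 1)), W j m q * (σ * z.2 (g m (q + 1)) - σ * z.2 (g m q))
  have hφm : ∀ m j, Measurable (φ m j) := by
    intro m j
    simp only [φ]
    fun_prop
  have hpair : ∀ j, Measurable (fun ω => (u j 0 ω, fun t => β j t ω)) := by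
    intro j
    exact (hX.measurable_init j).prodMk (measurable_pi_lambda _ fun t => hX.measurable_noise j t)
  have hφ : ∀ m j ω, φ m j (u j 0 ω, fun t => β j t ω)
      = ∑ a ∈ s, y j a * ouApprox (p.lam (j + 1)) τ (u j 0 ω)
          (fun t => σ * β j t.toNNReal ω) (i a) m := by
    intro m j ω
    rw [sum_ouApprox s i L hL]
  refine GaussLaw.of_tendsto (Z := fun m ω => ∑ j ∈ Finset.range n,
    φ m j (u j 0 ω, fun t => β j t ω)) (q := fun m => ∑ j ∈ Finset.range n,
      (A0 j ^ 2 * (S / (2 * p.lam (j + 1))) + ∑ q ∈ Finset.range (L * (m + 1)),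
        W j m q ^ 2 * (S * (τ / ((m : ℝ) + 1))))) ?_ ?_ ?_
  · intro m
    refine GaussLaw.sum (fun j => ?_) (fun j => (hφm m j).comp (hpair j))
      (hX.indep_modes.comp (fun j => φ m j) (hφm m)) _
    have g0 : GaussLaw P (fun ω => A0 j * u j 0 ω) (A0 j ^ 2 * (S / (2 * p.lam (j + 1)))) :=
      GaussLaw.const_mul ⟨by have := hlam j; positivity, hX.init_law j⟩ _
    have binc : ∀ q, GaussLaw P (fun ω => β j (g m (q + 1)) ω - β j (g m q) ω)
        (τ / ((m : ℝ) + 1)) := by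
      intro q
      refine ⟨by positivity, ?_⟩
      have h1 := (hX.brownian j).hasLaw_sub (g m (q + 1)) (g m q)
      have e : (τ / ((m : ℝ) + 1)).toNNReal = nndist (g m (q + 1) : ℝ) (g m q : ℝ) := by
        ext
        rw [coe_nndist, Real.coe_toNNReal _ (by positivity), Real.dist_eq]
        simp only [g]
        rw [Real.coe_toNNReal _ (by positivity), Real.coe_toNNReal _ (by positivity)]
        push_cast
        rw [show ((q : ℝ) + 1) * τ / (m + 1) - q * τ / (m + 1) = τ / (m + 1) by ring,
          abs_of_pos (by positivity)]
      rw [e]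
      exact h1
    have bsum : GaussLaw P (fun ω => ∑ q ∈ Finset.range (L * (m + 1)),
        (W j m q * σ) * (β j (g m (q + 1)) ω - β j (g m q) ω))
        (∑ q ∈ Finset.range (L * (m + 1)), (W j m q * σ) ^ 2 * (τ / ((m : ℝ) + 1))) := by
      refine GaussLaw.sum (fun q => (binc q).const_mul _) (fun q => ?_) ?_ _
      · exact ((hX.measurable_noise j _).sub (hX.measurable_noise j _)).const_mul _
      · exact ((hX.brownian j).hasIndepIncrements.nat (hg m)).comp
          (fun q x => (W j m q * σ) * x) (fun q => by fun_prop)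
    have hind : IndepFun (fun ω => A0 j * u j 0 ω) (fun ω => ∑ q ∈ Finset.range (L * (m + 1)),
        (W j m q * σ) * (β j (g m (q + 1)) ω - β j (g m q) ω)) P :=
      (hX.indep_init j).comp (φ := fun x => A0 j * x)
        (ψ := fun z : ℝ≥0 → ℝ => ∑ q ∈ Finset.range (L * (m + 1)),
          (W j m q * σ) * (z (g m (q + 1)) - z (g m q))) (by fun_prop) (by fun_prop)
    have := g0.add bsum hind
    convert this using 1
    · funext ω
      simp only [φ, Function.comp_apply]
      congr 1
      exact Finset.sum_congr rfl fun q _ => by ring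
    · congr 1
      refine Finset.sum_congr rfl fun q _ => ?_
      rw [mul_pow, hσ2]; ring
  · have h1 : ∀ᵐ ω ∂P, ∀ j, ContinuousOn (fun t => u j t ω) (Set.Ici 0) :=
      ae_all_iff.2 hX.continuous_paths
    have h2 := ae_all_iff.2 hX.dynamics
    filter_upwards [h1, h2] with ω hω1 hω2
    refine tendsto_finsetSum _ fun j _ => ?_
    simp_rw [hφ]
    refine tendsto_finsetSum _ fun a _ => ?_
    exact (ouApprox_tendsto (f := fun t => u j t ω) (hlam j) hτ (hω1 j) (hω2 j) (i a)).const_mul _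
  · refine tendsto_finsetSum _ fun j _ => ?_
    simp only [A0, W]
    simp_rw [sum_ouApprox_var s i L hL]
    refine tendsto_finsetSum _ fun a _ => tendsto_finsetSum _ fun b _ => ?_
    exact (ouCov_tendsto (hlam j) hτ (i a) (i b)).const_mul _

end Modes

section SpaceSieve

lemma hasSum_cos_div_sq {t : ℝ} (ht : t ∈ Set.Icc (0 : ℝ) 2) :
    HasSum (fun j : ℕ => 1 / ((j : ℝ) + 1) ^ 2 * Real.cos (Real.pi * ((j : ℝ) + 1) * t))
      (Real.pi ^ 2 * (t ^ 2 / 4 - t / 2 + 1 / 6)) := by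
  have h := hasSum_one_div_nat_pow_mul_cos (k := 1) one_ne_zero (x := t / 2)
    ⟨by linarith [ht.1], by linarith [ht.2]⟩
  rw [← hasSum_nat_add_iff' 1] at h
  convert! h using 1
  · funext j
    push_cast
    congr 2
    ring
  · simp [Polynomial.bernoulli, Finset.sum_range_succ, bernoulli_one, bernoulli_two,
      Nat.factorial]
    ring

lemma hasSum_sin_mul_sin {x y : ℝ} (hx : x ∈ Set.Icc (0 : ℝ) 1) (hy : y ∈ Set.Icc (0 : ℝ) 1) :
    HasSum (fun j : ℕ => 1 / ((j : ℝ) + 1) ^ 2 *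
      (Real.sin (Real.pi * ((j : ℝ) + 1) * x) * Real.sin (Real.pi * ((j : ℝ) + 1) * y)))
      (Real.pi ^ 2 / 2 * (min x y - x * y)) := by
  have h1 := hasSum_cos_div_sq (t := |x - y|)
    ⟨abs_nonneg _, by rw [abs_le]; constructor <;> linarith [hx.1, hx.2, hy.1, hy.2]⟩
  have h2 := hasSum_cos_div_sq (t := x + y)
    ⟨by linarith [hx.1, hy.1], by linarith [hx.2, hy.2]⟩
  have h := (h1.sub h2).mul_left (1 / 2)
  convert! h using 1
  · funext j
    have e : Real.cos (Real.pi * ((j : ℝ) + 1) * |x - y|)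
        = Real.cos (Real.pi * ((j : ℝ) + 1) * x - Real.pi * ((j : ℝ) + 1) * y) := by
      rw [← mul_sub]
      rcases abs_choice (x - y) with h | h <;> rw [h]
      rw [mul_neg, Real.cos_neg]
    rw [e, mul_add (Real.pi * ((j : ℝ) + 1)) x y, Real.cos_sub, Real.cos_add]
    ring
  · rw [min_def, sq_abs]
    split_ifs with hxy
    · rw [abs_of_nonpos (by linarith)]; ring
    · rw [abs_of_nonneg (by linarith)]; ring

lemma min_grid_diff {b δ : ℝ} (hδ : 0 ≤ δ) (q q' : ℕ) :
    min (b + ((q : ℝ) + 1) * δ) (b + ((q' : ℝ) + 1) * δ) - min (b + ((q : ℝ) + 1) * δ) (b + q' * δ)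
      - min (b + q * δ) (b + ((q' : ℝ) + 1) * δ) + min (b + q * δ) (b + q' * δ)
      = if q = q' then δ else 0 := by
  have mono : ∀ a c : ℝ, a ≤ c → b + a * δ ≤ b + c * δ := fun a c h => by nlinarith
  split_ifs with h
  · subst h
    rw [min_self, min_self, min_eq_right (mono _ _ (by linarith)),
      min_eq_left (mono _ _ (by linarith))]
    ring
  rcases Nat.lt_or_gt_of_ne h with h | h
  · have h' : (q : ℝ) + 1 ≤ q' := by exact_mod_cast h
    rw [min_eq_left (mono _ _ (by linarith)), min_eq_left (mono _ _ h'),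
      min_eq_left (mono _ _ (by linarith)), min_eq_left (mono _ _ (by linarith))]
    ring
  · have h' : (q' : ℝ) + 1 ≤ q := by exact_mod_cast h
    rw [min_eq_right (mono _ _ (by linarith)), min_eq_right (mono _ _ (by linarith)),
      min_eq_right (mono _ _ h'), min_eq_right (mono _ _ (by linarith))]
    ring

/-- Bessel-type inequality for the cell increments of the sine basis on a regular grid. -/
lemma sine_cells_bound {b δ : ℝ} (hb : 0 ≤ b) (hδ : 0 ≤ δ) (M : ℕ) (hM : b + M * δ ≤ 1)
    (D : ℕ → ℝ) (n : ℕ) :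
    ∑ j ∈ Finset.range n, 1 / ((j : ℝ) + 1) ^ 2 * (∑ q ∈ Finset.range M, D q *
      (Real.sin (Real.pi * ((j : ℝ) + 1) * (b + ((q : ℝ) + 1) * δ))
        - Real.sin (Real.pi * ((j : ℝ) + 1) * (b + q * δ)))) ^ 2
      ≤ Real.pi ^ 2 / 2 * δ * ∑ q ∈ Finset.range M, D q ^ 2 := by
  have hmem : ∀ a : ℝ, 0 ≤ a → a ≤ M → b + a * δ ∈ Set.Icc (0 : ℝ) 1 := by
    intro a h0 h1
    exact ⟨by positivity, by nlinarith⟩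
  have hs : HasSum (fun j : ℕ => 1 / ((j : ℝ) + 1) ^ 2 * (∑ q ∈ Finset.range M, D q *
      (Real.sin (Real.pi * ((j : ℝ) + 1) * (b + ((q : ℝ) + 1) * δ))
        - Real.sin (Real.pi * ((j : ℝ) + 1) * (b + q * δ)))) ^ 2)
      (∑ q ∈ Finset.range M, ∑ q' ∈ Finset.range M, D q * D q' *
        (Real.pi ^ 2 / 2 * ((if q = q' then δ else 0) - δ ^ 2))) := by
    have : ∀ q ∈ Finset.range M, ∀ q' ∈ Finset.range M, HasSum (fun j : ℕ => D q * D q' *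
        (1 / ((j : ℝ) + 1) ^ 2 *
      ((Real.sin (Real.pi * ((j : ℝ) + 1) * (b + ((q : ℝ) + 1) * δ))
        - Real.sin (Real.pi * ((j : ℝ) + 1) * (b + q * δ))) *
        (Real.sin (Real.pi * ((j : ℝ) + 1) * (b + ((q' : ℝ) + 1) * δ))
        - Real.sin (Real.pi * ((j : ℝ) + 1) * (b + q' * δ))))))
        (D q * D q' * (Real.pi ^ 2 / 2 * ((if q = q' then δ else 0) - δ ^ 2))) := by
      intro q hq q' hq'
      have a1 : ((q : ℝ) + 1) ≤ M := by exact_mod_cast Finset.mem_range.1 hq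
      have a2 : ((q' : ℝ) + 1) ≤ M := by exact_mod_cast Finset.mem_range.1 hq'
      have m1 := hmem ((q : ℝ) + 1) (by positivity) a1
      have m2 := hmem ((q' : ℝ) + 1) (by positivity) a2
      have m3 := hmem (q : ℝ) (by positivity) (by linarith)
      have m4 := hmem (q' : ℝ) (by positivity) (by linarith)
      refine HasSum.mul_left _ ?_
      have := (((hasSum_sin_mul_sin m1 m2).sub (hasSum_sin_mul_sin m1 m4)).sub
        (hasSum_sin_mul_sin m3 m2)).add (hasSum_sin_mul_sin m3 m4)
      convert! this using 1
      · funext j; ring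
      · rw [← min_grid_diff (b := b) hδ q q']; ring
    have := hasSum_sum fun q hq => hasSum_sum (this q hq)
    convert! this using 1
    funext j
    rw [sq (Finset.sum _ _), Finset.sum_mul_sum, Finset.mul_sum]
    refine Finset.sum_congr rfl fun q _ => ?_
    rw [Finset.mul_sum]
    exact Finset.sum_congr rfl fun q' _ => by ring
  refine (sum_le_hasSum _ (fun j _ => by positivity) hs).trans ?_
  have e : ∑ q ∈ Finset.range M, ∑ q' ∈ Finset.range M, D q * D q' *
        (Real.pi ^ 2 / 2 * ((if q = q' then δ else 0) - δ ^ 2))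
      = Real.pi ^ 2 / 2 * (δ * ∑ q ∈ Finset.range M, D q ^ 2
        - δ ^ 2 * (∑ q ∈ Finset.range M, D q) ^ 2) := by
    have e1 : ∀ q q' : ℕ, D q * D q' * (Real.pi ^ 2 / 2 * ((if q = q' then δ else 0) - δ ^ 2))
        = (if q = q' then Real.pi ^ 2 / 2 * δ * D q ^ 2 else 0)
          - Real.pi ^ 2 / 2 * δ ^ 2 * (D q * D q') := by
      intro q q'
      split_ifs with h
      · subst h; ring
      · ring
    simp only [e1, Finset.sum_sub_distrib, Finset.sum_ite_eq, ← Finset.mul_sum]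
    rw [sq (Finset.sum _ _), Finset.sum_mul]
    simp only [Finset.mul_sum, mul_sub]
    congr 1
    · exact Finset.sum_congr rfl fun q hq => by rw [if_pos hq]; ring
    · exact Finset.sum_congr rfl fun q hq => Finset.sum_congr rfl fun q' _ => by ring
  rw [e]
  have : 0 ≤ Real.pi ^ 2 / 2 * (δ ^ 2 * (∑ q ∈ Finset.range M, D q) ^ 2) := by positivity
  linarith

lemma sum_increment_eq (M w n : ℕ) (hn : n + w ≤ M + 1) (c f : ℕ → ℝ) :
    ∑ k ∈ Finset.range n, c k * (f (k + w) - f k)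
      = ∑ q ∈ Finset.range M, (∑ k ∈ Finset.range n, if k ≤ q ∧ q < k + w then c k else 0)
        * (f (q + 1) - f q) := by
  simp only [Finset.sum_mul]
  rw [Finset.sum_comm]
  refine Finset.sum_congr rfl fun k hk => ?_
  simp only [ite_mul, zero_mul]
  rw [← Finset.sum_filter, ← Finset.mul_sum]
  congr 1
  have : (Finset.range M).filter (fun q => k ≤ q ∧ q < k + w) = Finset.Ico k (k + w) := by
    ext q
    simp only [Finset.mem_filter, Finset.mem_range, Finset.mem_Ico] at hk ⊢
    omega
  rw [this, Finset.sum_Ico_eq_sum_range, Nat.add_sub_cancel_left]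
  exact (Finset.sum_range_sub (fun i => f (k + i)) w).symm

lemma sum_overlap_sq_le (M w n : ℕ) (c : ℕ → ℝ) :
    ∑ q ∈ Finset.range M, (∑ k ∈ Finset.range n, if k ≤ q ∧ q < k + w then c k else 0) ^ 2
      ≤ (w : ℝ) ^ 2 * ∑ k ∈ Finset.range n, c k ^ 2 := by
  have h1 : ∀ q, (∑ k ∈ Finset.range n, if k ≤ q ∧ q < k + w then c k else 0) ^ 2
      ≤ w * ∑ k ∈ Finset.range n, if k ≤ q ∧ q < k + w then c k ^ 2 else 0 := by
    intro q
    rw [← Finset.sum_filter, ← Finset.sum_filter]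
    refine sq_sum_le_card_mul_sum_sq.trans ?_
    refine mul_le_mul_of_nonneg_right ?_ (Finset.sum_nonneg fun _ _ => sq_nonneg _)
    have : (Finset.range n).filter (fun k => k ≤ q ∧ q < k + w) ⊆ Finset.Ico (q + 1 - w) (q + 1) := by
      intro k
      simp only [Finset.mem_filter, Finset.mem_range, Finset.mem_Ico]
      omega
    have := Finset.card_le_card this
    rw [Nat.card_Ico] at this
    exact_mod_cast this.trans (by omega)
  refine (Finset.sum_le_sum fun q _ => h1 q).trans ?_
  rw [← Finset.mul_sum, sq, mul_assoc, Finset.sum_comm]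
  refine mul_le_mul_of_nonneg_left ?_ (by positivity)
  rw [Finset.mul_sum]
  refine Finset.sum_le_sum fun k _ => ?_
  rw [← Finset.sum_filter, Finset.sum_const, nsmul_eq_mul]
  refine mul_le_mul_of_nonneg_right ?_ (sq_nonneg _)
  have : (Finset.range M).filter (fun q => k ≤ q ∧ q < k + w) ⊆ Finset.Ico k (k + w) := by
    intro q
    simp only [Finset.mem_filter, Finset.mem_range, Finset.mem_Ico]
    omega
  have := Finset.card_le_card this
  rw [Nat.card_Ico] at this
  exact_mod_cast this.trans (by omega)

lemma sum_one_div_sq_le (n : ℕ) : ∑ j ∈ Finset.range n, 1 / ((j : ℝ) + 1) ^ 2 ≤ 2 := by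
  have h := hasSum_cos_div_sq (t := 0) (by simp)
  simp only [mul_zero, Real.cos_zero, mul_one] at h
  refine (sum_le_hasSum _ (fun j _ => by positivity) h).trans ?_
  have := Real.pi_lt_d2
  have := Real.pi_pos
  nlinarith

/-- The sine increments over `w` cells of a regular grid, weighted by an exponential. -/
def expSine (κ : ℝ) (j : ℕ) (x : ℝ) : ℝ :=
  Real.sin (Real.pi * ((j : ℝ) + 1) * x) * Real.exp (-κ * x / 2)

lemma abs_exp_sub_exp_le {κ x y : ℝ} (hx : x ∈ Set.Icc (0 : ℝ) 1) (hy : y ∈ Set.Icc (0 : ℝ) 1) :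
    |Real.exp (-κ * x / 2) - Real.exp (-κ * y / 2)| ≤ |κ| * Real.exp |κ| * |x - y| := by
  have h := (convex_Icc (0 : ℝ) 1).norm_image_sub_le_of_norm_hasDerivWithin_le
    (f := fun x => Real.exp (-κ * x / 2)) (f' := fun x => Real.exp (-κ * x / 2) * (-κ / 2))
    (C := |κ| * Real.exp |κ|) (fun z _ => ?_) (fun z hz => ?_) hy hx
  · exact h
  · have : HasDerivAt (fun x : ℝ => -κ * x / 2) (-κ / 2) z := by
      have := ((hasDerivAt_id z).const_mul (-κ)).div_const 2
      simpa using this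
    exact this.exp.hasDerivWithinAt
  · rw [Real.norm_eq_abs, abs_mul, abs_of_pos (Real.exp_pos _), mul_comm, abs_div, abs_neg]
    have h1 : |κ| / |2| ≤ |κ| := by
      rw [abs_of_pos (by norm_num : (0 : ℝ) < 2)]
      linarith [abs_nonneg κ]
    have h2 : -κ * z / 2 ≤ |κ| := by
      have := neg_abs_le κ
      have := abs_nonneg κ
      nlinarith [hz.1, hz.2]
    gcongr

lemma exp_half_le {κ x : ℝ} (hx : x ∈ Set.Icc (0 : ℝ) 1) :
    Real.exp (-κ * x / 2) ≤ Real.exp |κ| := by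
  apply Real.exp_le_exp.2
  have := neg_abs_le κ
  have := abs_nonneg κ
  nlinarith [hx.1, hx.2]

/-- The constant in `expSine_increment_bound`. -/
def sieveConst (κ : ℝ) : ℝ := (Real.pi ^ 2 + 4 * |κ| ^ 2) * Real.exp |κ| ^ 2

lemma sieveConst_pos (κ : ℝ) : 0 < sieveConst κ := by
  have := Real.pi_pos
  unfold sieveConst; positivity

lemma expSine_increment_bound (κ : ℝ) {b δ : ℝ} (hb : 0 ≤ b) (hδ : 0 ≤ δ) (M : ℕ)
    (hM : b + M * δ ≤ 1) (w m : ℕ) (hm : m + w ≤ M + 1) (c : ℕ → ℝ) (n : ℕ) :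
    ∑ j ∈ Finset.range n, 1 / ((j : ℝ) + 1) ^ 2 * (∑ k ∈ Finset.range m, c k *
      (expSine κ j (b + (k + w : ℕ) * δ) - expSine κ j (b + k * δ))) ^ 2
      ≤ sieveConst κ * (w * (w * δ)) * ∑ k ∈ Finset.range m, c k ^ 2 := by
  rcases Nat.eq_zero_or_pos w with hw0 | hwpos
  · subst hw0; simp
  have hmem : ∀ a : ℕ, a ≤ M → b + a * δ ∈ Set.Icc (0 : ℝ) 1 := by
    intro a h1
    have : (a : ℝ) ≤ M := by exact_mod_cast h1
    exact ⟨by positivity, by nlinarith⟩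
  set s : ℕ → ℕ → ℝ := fun j q => Real.sin (Real.pi * ((j : ℝ) + 1) * (b + q * δ)) with hs
  set e : ℕ → ℝ := fun q => Real.exp (-κ * (b + q * δ) / 2) with he
  set E := Real.exp |κ| with hE
  have hE0 : 0 < E := Real.exp_pos _
  have hw1 : (1 : ℝ) ≤ w := by exact_mod_cast hwpos
  set Q := ∑ k ∈ Finset.range m, c k ^ 2 with hQ
  have hQ0 : 0 ≤ Q := Finset.sum_nonneg fun _ _ => sq_nonneg _
  have split : ∀ j, ∑ k ∈ Finset.range m, c k *
      (expSine κ j (b + (k + w : ℕ) * δ) - expSine κ j (b + k * δ))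
      = ∑ k ∈ Finset.range m, c k * e (k + w) * (s j (k + w) - s j k)
        + ∑ k ∈ Finset.range m, c k * (e (k + w) - e k) * s j k := by
    intro j
    rw [← Finset.sum_add_distrib]
    refine Finset.sum_congr rfl fun k _ => ?_
    simp only [expSine, hs, he]
    ring
  have first : ∑ j ∈ Finset.range n, 1 / ((j : ℝ) + 1) ^ 2 *
      (∑ k ∈ Finset.range m, c k * e (k + w) * (s j (k + w) - s j k)) ^ 2
      ≤ Real.pi ^ 2 / 2 * δ * ((w : ℝ) ^ 2 * (E ^ 2 * Q)) := by
    have h1 := sine_cells_bound hb hδ M hM (fun q => ∑ k ∈ Finset.range m,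
      if k ≤ q ∧ q < k + w then c k * e (k + w) else 0) n
    have h2 : ∀ j, ∑ k ∈ Finset.range m, c k * e (k + w) * (s j (k + w) - s j k)
        = ∑ q ∈ Finset.range M, (∑ k ∈ Finset.range m,
          if k ≤ q ∧ q < k + w then c k * e (k + w) else 0) *
      (Real.sin (Real.pi * ((j : ℝ) + 1) * (b + ((q : ℝ) + 1) * δ))
        - Real.sin (Real.pi * ((j : ℝ) + 1) * (b + q * δ))) := by
      intro j
      rw [sum_increment_eq M w m hm (fun k => c k * e (k + w)) (s j)]
      simp only [hs]
      push_cast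
      rfl
    simp_rw [h2]
    refine h1.trans ?_
    refine mul_le_mul_of_nonneg_left ?_ (by positivity)
    refine (sum_overlap_sq_le M w m _).trans ?_
    refine mul_le_mul_of_nonneg_left ?_ (by positivity)
    rw [hQ, Finset.mul_sum]
    refine Finset.sum_le_sum fun k hk => ?_
    rw [mul_pow, mul_comm]
    have := exp_half_le (κ := κ) (hmem (k + w) (by have := Finset.mem_range.1 hk; omega))
    have h0 : 0 ≤ e (k + w) := (Real.exp_pos _).le
    gcongr
  have second : ∑ j ∈ Finset.range n, 1 / ((j : ℝ) + 1) ^ 2 *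
      (∑ k ∈ Finset.range m, c k * (e (k + w) - e k) * s j k) ^ 2
      ≤ 2 * ((|κ| * E * (w * δ)) ^ 2 * (m * Q)) := by
    have h1 : ∀ j, (∑ k ∈ Finset.range m, c k * (e (k + w) - e k) * s j k) ^ 2
        ≤ (|κ| * E * (w * δ)) ^ 2 * (m * Q) := by
      intro j
      have := sq_sum_le_card_mul_sum_sq (s := Finset.range m)
        (f := fun k => c k * (e (k + w) - e k) * s j k)
      rw [Finset.card_range] at this
      refine this.trans ?_
      rw [mul_left_comm]
      refine mul_le_mul_of_nonneg_left ?_ (by positivity)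
      rw [hQ, Finset.mul_sum]
      refine Finset.sum_le_sum fun k hk => ?_
      have hk' := Finset.mem_range.1 hk
      have a1 : |e (k + w) - e k| ≤ |κ| * E * (w * δ) := by
        refine (abs_exp_sub_exp_le (hmem (k + w) (by omega)) (hmem k (by omega))).trans
          (le_of_eq ?_)
        rw [show b + ((k + w : ℕ) : ℝ) * δ - (b + k * δ) = w * δ by push_cast; ring,
          abs_of_nonneg (by positivity : (0 : ℝ) ≤ w * δ)]
      have a2 : (e (k + w) - e k) ^ 2 ≤ (|κ| * E * (w * δ)) ^ 2 := by
        rw [← sq_abs]; gcongr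
      have a3 : s j k ^ 2 ≤ 1 := Real.sin_sq_le_one _
      calc (c k * (e (k + w) - e k) * s j k) ^ 2
          = (e (k + w) - e k) ^ 2 * c k ^ 2 * s j k ^ 2 := by ring
        _ ≤ (|κ| * E * (w * δ)) ^ 2 * c k ^ 2 * 1 := by gcongr
        _ = _ := by ring
    refine (Finset.sum_le_sum fun j _ => mul_le_mul_of_nonneg_left (h1 j) (by positivity)).trans ?_
    rw [← Finset.sum_mul]
    exact mul_le_mul_of_nonneg_right (sum_one_div_sq_le n) (by positivity)
  have hmδ : (m : ℝ) * δ ≤ 1 := by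
    have : (m : ℝ) ≤ M := by exact_mod_cast (by omega : m ≤ M)
    nlinarith
  calc ∑ j ∈ Finset.range n, 1 / ((j : ℝ) + 1) ^ 2 * (∑ k ∈ Finset.range m, c k *
      (expSine κ j (b + (k + w : ℕ) * δ) - expSine κ j (b + k * δ))) ^ 2
      ≤ ∑ j ∈ Finset.range n, (2 * (1 / ((j : ℝ) + 1) ^ 2 *
      (∑ k ∈ Finset.range m, c k * e (k + w) * (s j (k + w) - s j k)) ^ 2)
        + 2 * (1 / ((j : ℝ) + 1) ^ 2 *
      (∑ k ∈ Finset.range m, c k * (e (k + w) - e k) * s j k) ^ 2)) := by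
        refine Finset.sum_le_sum fun j _ => ?_
        rw [split]
        set x := ∑ k ∈ Finset.range m, c k * e (k + w) * (s j (k + w) - s j k)
        set y := ∑ k ∈ Finset.range m, c k * (e (k + w) - e k) * s j k
        have : (x + y) ^ 2 ≤ 2 * x ^ 2 + 2 * y ^ 2 := by nlinarith [sq_nonneg (x - y)]
        have h0 : (0 : ℝ) ≤ 1 / ((j : ℝ) + 1) ^ 2 := by positivity
        nlinarith
    _ ≤ 2 * (Real.pi ^ 2 / 2 * δ * ((w : ℝ) ^ 2 * (E ^ 2 * Q)))
        + 2 * (2 * ((|κ| * E * (w * δ)) ^ 2 * (m * Q))) := by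
        rw [Finset.sum_add_distrib, ← Finset.mul_sum, ← Finset.mul_sum]
        linarith
    _ = Real.pi ^ 2 * E ^ 2 * (w * (w * δ)) * Q
        + 4 * |κ| ^ 2 * E ^ 2 * (w * (w * δ)) * Q * (m * δ) := by ring
    _ ≤ Real.pi ^ 2 * E ^ 2 * (w * (w * δ)) * Q
        + 4 * |κ| ^ 2 * E ^ 2 * (w * (w * δ)) * Q * 1 := by gcongr
    _ = _ := by rw [sieveConst]; ring

end SpaceSieve

section TimeSchur

lemma sum_abs_exp_diff_le {x : ℝ} (hx : 0 ≤ x) (a n : ℕ) :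
    ∑ i ∈ Finset.range n, |Real.exp (-x * |((a + 1 : ℕ) : ℝ) - i|) - Real.exp (-x * |(a : ℝ) - i|)|
      ≤ 2 := by
  set A := a + 1 with hA
  set F : ℕ → ℝ := fun i => Real.exp (-x * |(A : ℝ) - i|) with hF
  have hshift : ∀ i : ℕ, Real.exp (-x * |(a : ℝ) - i|) = F (i + 1) := by
    intro i; simp only [hF, hA]; push_cast; congr 3; ring
  have hF0 : ∀ i, 0 < F i := fun i => Real.exp_pos _
  have hup : ∀ i, i + 1 ≤ A → F i ≤ F (i + 1) := by
    intro i hi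
    have : ((i : ℝ) + 1) ≤ A := by exact_mod_cast hi
    apply Real.exp_le_exp.2
    push_cast
    rw [abs_of_nonneg (by linarith), abs_of_nonneg (by linarith)]
    nlinarith
  have hdown : ∀ i, A ≤ i → F (i + 1) ≤ F i := by
    intro i hi
    have : (A : ℝ) ≤ i := by exact_mod_cast hi
    apply Real.exp_le_exp.2
    push_cast
    rw [abs_of_nonpos (by linarith), abs_of_nonpos (by linarith)]
    nlinarith
  have hFA : F A = 1 := by simp [hF]
  have key : (n ≤ A → ∑ i ∈ Finset.range n, |F i - F (i + 1)| ≤ F n) ∧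
      (A ≤ n → ∑ i ∈ Finset.range n, |F i - F (i + 1)| ≤ 2 - F n) := by
    induction n with
    | zero => exact ⟨fun _ => by simpa using (hF0 0).le, fun h => by omega⟩
    | succ n ih =>
      have h1 : n + 1 ≤ A → ∑ i ∈ Finset.range (n + 1), |F i - F (i + 1)| ≤ F (n + 1) := by
        intro h
        rw [Finset.sum_range_succ, abs_of_nonpos (by linarith [hup n h])]
        linarith [ih.1 (by omega)]
      refine ⟨h1, fun h => ?_⟩
      rcases Nat.lt_or_ge n A with h' | h'
      · have : n + 1 = A := by omega
        have h2 := h1 this.le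
        rw [this, hFA] at h2 ⊢
        linarith
      · rw [Finset.sum_range_succ, abs_of_nonneg (by linarith [hdown n h'])]
        linarith [ih.2 h']
  simp_rw [hshift]
  have hle : ∀ i, F i ≤ 1 := by
    intro i
    simp only [hF]
    rw [Real.exp_le_one_iff]
    have := abs_nonneg ((A : ℝ) - i)
    nlinarith
  rcases le_total n A with h | h
  · linarith [key.1 h, hle n]
  · linarith [key.2 h, hF0 n]

lemma sum_abs_exp_diff_le_mul {x : ℝ} (hx : 0 ≤ x) (a V n : ℕ) :
    ∑ i ∈ Finset.range n, |Real.exp (-x * |((a + V : ℕ) : ℝ) - i|) - Real.exp (-x * |(a : ℝ) - i|)|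
      ≤ 2 * V := by
  induction V with
  | zero => simp
  | succ V ih =>
    have h := sum_abs_exp_diff_le hx (a + V) n
    push_cast at h ih ⊢
    calc _ ≤ ∑ i ∈ Finset.range n,
        (|Real.exp (-x * |(a : ℝ) + V + 1 - i|) - Real.exp (-x * |(a : ℝ) + V - i|)|
        + |Real.exp (-x * |(a : ℝ) + V - i|) - Real.exp (-x * |(a : ℝ) - i|)|) := by
          refine Finset.sum_le_sum fun i _ => ?_
          rw [← add_assoc]
          exact abs_sub_le _ _ _
      _ ≤ _ := by
          rw [Finset.sum_add_distrib]
          linarith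

lemma schur_bound (n : ℕ) (A : ℕ → ℕ → ℝ) (hA : ∀ i j, A i j = A j i) {R : ℝ}
    (hR : ∀ i, ∑ j ∈ Finset.range n, |A i j| ≤ R) (x : ℕ → ℝ) :
    ∑ i ∈ Finset.range n, ∑ j ∈ Finset.range n, x i * x j * A i j
      ≤ R * ∑ i ∈ Finset.range n, x i ^ 2 := by
  have h1 : ∀ i j, x i * x j * A i j ≤ x i ^ 2 / 2 * |A i j| + x j ^ 2 / 2 * |A j i| := by
    intro i j
    rw [hA j i]
    have : x i * x j * A i j ≤ |x i * x j| * |A i j| := by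
      rw [← abs_mul]; exact le_abs_self _
    have h2 : |x i * x j| ≤ x i ^ 2 / 2 + x j ^ 2 / 2 := by
      rw [abs_le]
      constructor <;> nlinarith [sq_nonneg (x i - x j), sq_nonneg (x i + x j)]
    nlinarith [abs_nonneg (A i j)]
  refine (Finset.sum_le_sum fun i _ => Finset.sum_le_sum fun j _ => h1 i j).trans ?_
  simp only [Finset.sum_add_distrib]
  rw [Finset.sum_comm (f := fun i j => x j ^ 2 / 2 * |A j i|)]
  simp only [← Finset.mul_sum]
  have h3 : ∑ i ∈ Finset.range n, x i ^ 2 / 2 * ∑ j ∈ Finset.range n, |A i j|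
      ≤ ∑ i ∈ Finset.range n, x i ^ 2 / 2 * R :=
    Finset.sum_le_sum fun i _ => mul_le_mul_of_nonneg_left (hR i) (by positivity)
  have h4 : ∑ i ∈ Finset.range n, x i ^ 2 / 2 * R = R / 2 * ∑ i ∈ Finset.range n, x i ^ 2 := by
    rw [Finset.mul_sum]; exact Finset.sum_congr rfl fun i _ => by ring
  linarith

end TimeSchur

section Field

variable {Ω : Type*} [MeasurableSpace Ω] {P : Measure Ω} [IsProbabilityMeasure P] {p : Coeffs}
  {β : ℕ → ℝ≥0 → Ω → ℝ} {u : ℕ → ℝ → Ω → ℝ} {X : ℝ → ℝ → Ω → ℝ}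

/-- Covariance of the increments over `V` time steps of the `j`-th coordinate process. -/
def incCov (p : Coeffs) (τ : ℝ) (V j i i' : ℕ) : ℝ :=
  modeCov p τ j (i + V) (i' + V) - modeCov p τ j (i + V) i' - modeCov p τ j i (i' + V)
    + modeCov p τ j i i'

/-- The increment of the eigenfunction over `w` cells. -/
def eigInc (p : Coeffs) (b : ℝ) (M w j k : ℕ) : ℝ :=
  p.eig (j + 1) (gridX b M (k + w)) - p.eig (j + 1) (gridX b M k)

lemma modeCov_comm (p : Coeffs) (τ : ℝ) (j i i' : ℕ) : modeCov p τ j i i' = modeCov p τ j i' i := by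
  rw [modeCov, modeCov, ouCov, ouCov, abs_sub_comm]

lemma incCov_comm (p : Coeffs) (τ : ℝ) (V j i i' : ℕ) :
    incCov p τ V j i i' = incCov p τ V j i' i := by
  rw [incCov, incCov, modeCov_comm p τ j (i + V) (i' + V), modeCov_comm p τ j (i + V) i',
    modeCov_comm p τ j i (i' + V), modeCov_comm p τ j i i']
  ring

lemma incCov_row_sum (hp : p.Admissible) {τ : ℝ} (hτ : 0 ≤ τ) (V j i n : ℕ) :
    ∑ i' ∈ Finset.range n, |incCov p τ V j i i'| ≤ 2 * p.sigmaSq / p.lam (j + 1) * V := by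
  have hl := hp.lam_pos j
  have hS := hp.1
  set v0 := p.sigmaSq / (2 * p.lam (j + 1)) with hv0
  have hv0p : 0 < v0 := by positivity
  set x := p.lam (j + 1) * τ with hx
  have hx0 : 0 ≤ x := by positivity
  set G : ℕ → ℝ := fun i' => |Real.exp (-x * |((i + V : ℕ) : ℝ) - i'|)
    - Real.exp (-x * |(i : ℝ) - i'|)| with hG
  have hb : ∀ i', |incCov p τ V j i i'| ≤ v0 * (G (i' + V) + G i') := by
    intro i'
    have e : incCov p τ V j i i' = v0 * ((Real.exp (-x * |((i + V : ℕ) : ℝ) - (i' + V : ℕ)|)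
        - Real.exp (-x * |(i : ℝ) - (i' + V : ℕ)|)) - (Real.exp (-x * |((i + V : ℕ) : ℝ) - i'|)
        - Real.exp (-x * |(i : ℝ) - i'|))) := by
      simp only [incCov, modeCov, ouCov, ← hv0, hx, ← neg_mul]
      ring
    rw [e, abs_mul, abs_of_pos hv0p]
    exact mul_le_mul_of_nonneg_left (abs_sub _ _) hv0p.le
  refine (Finset.sum_le_sum fun i' _ => hb i').trans ?_
  rw [← Finset.mul_sum, Finset.sum_add_distrib]
  have h1 := sum_abs_exp_diff_le_mul hx0 i V n
  have h2 := sum_abs_exp_diff_le_mul hx0 i V (V + n)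
  have h3 : ∑ i' ∈ Finset.range n, G (i' + V) ≤ ∑ i' ∈ Finset.range (V + n), G i' := by
    rw [Finset.sum_range_add]
    have : 0 ≤ ∑ i' ∈ Finset.range V, G i' := Finset.sum_nonneg fun _ _ => abs_nonneg _
    have h4 : ∑ i' ∈ Finset.range n, G (i' + V) = ∑ i' ∈ Finset.range n, G (V + i') :=
      Finset.sum_congr rfl fun i' _ => by rw [add_comm]
    linarith
  have : v0 * (∑ i' ∈ Finset.range n, G (i' + V) + ∑ i' ∈ Finset.range n, G i')
      ≤ v0 * (4 * V) := mul_le_mul_of_nonneg_left (by linarith) hv0p.le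
  refine this.trans (le_of_eq ?_)
  rw [hv0]; field_simp; ring

lemma abs_incCov_le (hp : p.Admissible) {τ : ℝ} (hτ : 0 ≤ τ) (V j i i' : ℕ) :
    |incCov p τ V j i i'| ≤ 2 * p.sigmaSq / p.lam (j + 1) := by
  have hl := hp.lam_pos j
  have hS := hp.1
  have hm : ∀ a c, 0 ≤ modeCov p τ j a c ∧ modeCov p τ j a c ≤ p.sigmaSq / (2 * p.lam (j + 1)) := by
    intro a c
    have h1 : Real.exp (-p.lam (j + 1) * τ * |(a : ℝ) - c|) ≤ 1 := by
      rw [Real.exp_le_one_iff]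
      have : 0 ≤ p.lam (j + 1) * τ * |(a : ℝ) - c| := by positivity
      linarith
    have h0 : 0 ≤ p.sigmaSq / (2 * p.lam (j + 1)) := by positivity
    rw [modeCov, ouCov]
    exact ⟨by positivity, by nlinarith⟩
  have e : 2 * p.sigmaSq / p.lam (j + 1) = 4 * (p.sigmaSq / (2 * p.lam (j + 1))) := by
    field_simp; ring
  rw [e, incCov, abs_le]
  obtain ⟨a1, a2⟩ := hm (i + V) (i' + V)
  obtain ⟨b1, b2⟩ := hm (i + V) i'
  obtain ⟨c1, c2⟩ := hm i (i' + V)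
  obtain ⟨d1, d2⟩ := hm i i'
  constructor <;> linarith

lemma eig_eq_expSine (p : Coeffs) (j : ℕ) (x : ℝ) :
    p.eig (j + 1) x = Real.sqrt 2 * expSine p.kappa j x := by
  rw [Coeffs.eig, expSine]; push_cast; ring

/-- A lower bound for `λ_ℓ / ℓ²`. -/
def lamConst (p : Coeffs) : ℝ := p.th2 * min (Real.pi ^ 2) (p.Gam + Real.pi ^ 2)

lemma lamConst_pos (hp : p.Admissible) : 0 < lamConst p :=
  mul_pos hp.2.1 (lt_min (by have := Real.pi_pos; positivity) hp.2.2)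

lemma one_div_lam_le (hp : p.Admissible) (j : ℕ) :
    1 / p.lam (j + 1) ≤ 1 / lamConst p * (1 / ((j : ℝ) + 1) ^ 2) := by
  have h := hp.lam_lower j
  have hc := lamConst_pos hp
  rw [one_div_mul_one_div]
  exact one_div_le_one_div_of_le (by positivity) h

lemma abs_expSine_le {κ x : ℝ} (hx : x ∈ Set.Icc (0 : ℝ) 1) (j : ℕ) :
    |expSine κ j x| ≤ Real.exp |κ| := by
  rw [expSine, abs_mul, abs_of_pos (Real.exp_pos _)]
  calc _ ≤ 1 * Real.exp |κ| := by
        gcongr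
        · exact Real.abs_sin_le_one _
        · exact Real.exp_le_exp.1 (exp_half_le hx)
    _ = _ := one_mul _

lemma abs_eigInc_le {b : ℝ} {M w k : ℕ} (h1 : gridX b M k ∈ Set.Icc (0 : ℝ) 1)
    (h2 : gridX b M (k + w) ∈ Set.Icc (0 : ℝ) 1) (j : ℕ) :
    |eigInc p b M w j k| ≤ 4 * Real.exp |p.kappa| := by
  rw [eigInc, eig_eq_expSine, eig_eq_expSine, ← mul_sub, abs_mul, abs_of_nonneg (Real.sqrt_nonneg _)]
  have h3 : Real.sqrt 2 ≤ 2 := by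
    rw [Real.sqrt_le_left (by norm_num)]; norm_num
  have h4 : |expSine p.kappa j (gridX b M (k + w)) - expSine p.kappa j (gridX b M k)|
      ≤ 2 * Real.exp |p.kappa| := by
    refine (abs_sub _ _).trans ?_
    linarith [abs_expSine_le (κ := p.kappa) h1 j, abs_expSine_le (κ := p.kappa) h2 j]
  calc _ ≤ 2 * (2 * Real.exp |p.kappa|) := by gcongr
    _ = _ := by ring

/-- Covariance of the double increments. -/
def incKernel (p : Coeffs) (τ b : ℝ) (M V w : ℕ) (a a' : ℕ × ℕ) : ℝ :=
  ∑' j, incCov p τ V j a.1 a'.1 * (eigInc p b M w j a.2 * eigInc p b M w j a'.2)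

lemma incKernel_comm (p : Coeffs) (τ b : ℝ) (M V w : ℕ) (a a' : ℕ × ℕ) :
    incKernel p τ b M V w a a' = incKernel p τ b M V w a' a := by
  unfold incKernel
  congr 1
  funext j
  rw [incCov_comm, mul_comm (eigInc p b M w j a.2)]

lemma summable_incKernel (hp : p.Admissible) {τ b : ℝ} (hτ : 0 ≤ τ) {M V w : ℕ} {a a' : ℕ × ℕ}
    (h1 : gridX b M a.2 ∈ Set.Icc (0 : ℝ) 1) (h2 : gridX b M (a.2 + w) ∈ Set.Icc (0 : ℝ) 1)
    (h3 : gridX b M a'.2 ∈ Set.Icc (0 : ℝ) 1) (h4 : gridX b M (a'.2 + w) ∈ Set.Icc (0 : ℝ) 1) :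
    Summable fun j => incCov p τ V j a.1 a'.1 * (eigInc p b M w j a.2 * eigInc p b M w j a'.2) := by
  have hs : Summable fun j : ℕ => 1 / ((j : ℝ) + 1) ^ 2 := by
    have := (hasSum_cos_div_sq (t := 0) (by simp)).summable
    simpa using this
  refine Summable.of_norm_bounded
    (hs.mul_left (2 * p.sigmaSq / lamConst p * (4 * Real.exp |p.kappa|) ^ 2)) fun j => ?_
  have hc := lamConst_pos hp
  have hS := hp.1
  rw [Real.norm_eq_abs, abs_mul, abs_mul]
  have e1 : |incCov p τ V j a.1 a'.1| ≤ 2 * p.sigmaSq / lamConst p * (1 / ((j : ℝ) + 1) ^ 2) := by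
    refine (abs_incCov_le hp hτ V j _ _).trans ?_
    have := one_div_lam_le hp j
    calc 2 * p.sigmaSq / p.lam (j + 1) = 2 * p.sigmaSq * (1 / p.lam (j + 1)) := by ring
      _ ≤ 2 * p.sigmaSq * (1 / lamConst p * (1 / ((j : ℝ) + 1) ^ 2)) := by gcongr
      _ = _ := by ring
  calc _ ≤ 2 * p.sigmaSq / lamConst p * (1 / ((j : ℝ) + 1) ^ 2) *
        ((4 * Real.exp |p.kappa|) * (4 * Real.exp |p.kappa|)) := by
        gcongr
        · exact abs_eigInc_le h1 h2 j
        · exact abs_eigInc_le h3 h4 j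
    _ = _ := by ring

lemma tendsto_partial_form (hp : p.Admissible) {τ b : ℝ} (hτ : 0 ≤ τ) {M V w : ℕ}
    (s : Finset (ℕ × ℕ)) (hs : ∀ a ∈ s, gridX b M a.2 ∈ Set.Icc (0 : ℝ) 1 ∧
      gridX b M (a.2 + w) ∈ Set.Icc (0 : ℝ) 1) (c : ℕ × ℕ → ℝ) :
    Tendsto (fun n => ∑ j ∈ Finset.range n, ∑ a ∈ s, ∑ a' ∈ s,
      c a * c a' * (incCov p τ V j a.1 a'.1 * (eigInc p b M w j a.2 * eigInc p b M w j a'.2)))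
      atTop (𝓝 (∑ a ∈ s, ∑ a' ∈ s, c a * c a' * incKernel p τ b M V w a a')) := by
  have := HasSum.tendsto_sum_nat (hasSum_sum fun a ha => hasSum_sum fun a' ha' =>
    ((summable_incKernel (V := V) hp hτ (hs a ha).1 (hs a ha).2 (hs a' ha').1
      (hs a' ha').2).hasSum.mul_left (c a * c a')))
  exact this

lemma IsStationarySolution.gaussFamily_doubleInc (hp : p.Admissible)
    (hX : IsStationarySolution P p β u X) {T b : ℝ} {M N V w : ℕ} (hτ : 0 < meshT T N)
    (s : Finset (ℕ × ℕ)) (hs : ∀ a ∈ s, gridX b M a.2 ∈ Set.Icc (0 : ℝ) 1 ∧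
      gridX b M (a.2 + w) ∈ Set.Icc (0 : ℝ) 1) :
    GaussFamily P s (fun a ω => doubleInc b T M N (fun t x => X t x ω) V w a.1 a.2)
      (incKernel p (meshT T N) b M V w) := by
  intro c
  set τ := meshT T N with hτd
  set y : ℕ → (ℕ × ℕ) × Bool → ℝ := fun j a =>
    (if a.2 then 1 else -1) * (c a.1 * eigInc p b M w j a.1.2) with hy
  set idx : (ℕ × ℕ) × Bool → ℕ := fun a => a.1.1 + (if a.2 then V else 0) with hidx
  refine GaussLaw.of_tendsto (fun n => hX.gaussLaw_modes hp hτ (s ×ˢ (Finset.univ : Finset Bool))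
    idx y n) ?_ ?_
  · have h : ∀ a : ℕ × ℕ, a ∈ s → ∀ᵐ ω ∂P, Tendsto (fun n => ∑ j ∈ Finset.range n,
        (u j ((a.1 + V : ℕ) * τ) ω - u j (a.1 * τ) ω) * eigInc p b M w j a.2) atTop
        (𝓝 (doubleInc b T M N (fun t x => X t x ω) V w a.1 a.2)) := by
      intro a ha
      have t1 : (0 : ℝ) ≤ (a.1 + V : ℕ) * τ := by positivity
      have t2 : (0 : ℝ) ≤ a.1 * τ := by positivity
      filter_upwards [hX.series _ t1 _ (hs a ha).1, hX.series _ t1 _ (hs a ha).2,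
        hX.series _ t2 _ (hs a ha).1, hX.series _ t2 _ (hs a ha).2] with ω h1 h2 h3 h4
      refine (((h2.sub h4).sub h1).add h3).congr fun n => ?_
      rw [← Finset.sum_sub_distrib, ← Finset.sum_sub_distrib, ← Finset.sum_add_distrib]
      refine Finset.sum_congr rfl fun j _ => ?_
      rw [eigInc]; ring
    have h' : ∀ᵐ ω ∂P, ∀ a ∈ s, Tendsto (fun n => ∑ j ∈ Finset.range n,
        (u j ((a.1 + V : ℕ) * τ) ω - u j (a.1 * τ) ω) * eigInc p b M w j a.2) atTop
        (𝓝 (doubleInc b T M N (fun t x => X t x ω) V w a.1 a.2)) :=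
      (ae_ball_iff s.countable_toSet).2 fun a ha => h a ha
    filter_upwards [h'] with ω hω
    refine (tendsto_finsetSum s fun a ha => (hω a ha).const_mul (c a)).congr fun n => ?_
    simp only [Finset.mul_sum]
    rw [Finset.sum_comm]
    refine Finset.sum_congr rfl fun j _ => ?_
    rw [Finset.sum_product]
    refine Finset.sum_congr rfl fun a _ => ?_
    simp only [Fintype.sum_bool, hy, hidx, if_true, add_zero, Bool.false_eq_true, if_false]
    ring
  · refine (tendsto_partial_form hp hτ.le s hs c).congr fun n => ?_
    refine Finset.sum_congr rfl fun j _ => ?_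
    rw [Finset.sum_product]
    refine Finset.sum_congr rfl fun a _ => ?_
    simp only [Finset.sum_product, Fintype.sum_bool, ← Finset.sum_add_distrib]
    refine Finset.sum_congr rfl fun a' _ => ?_
    simp only [hy, hidx, if_true, add_zero, Bool.false_eq_true, if_false, incCov]
    ring

/-- The constant in `incKernel_form_le`. -/
def opConst (p : Coeffs) : ℝ := 4 * p.sigmaSq / lamConst p * sieveConst p.kappa

lemma opConst_pos (hp : p.Admissible) : 0 < opConst p := by
  have := lamConst_pos hp
  have := sieveConst_pos p.kappa
  have := hp.1
  unfold opConst; positivity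

lemma sum_eigInc_bound (hp : p.Admissible) {b : ℝ} (hb : 0 ≤ b) (hb' : b < 1 / 2) {M w m : ℕ}
    (hM : 0 < M) (hm : m + w ≤ M + 1) (c : ℕ → ℝ) (n : ℕ) :
    ∑ j ∈ Finset.range n, 1 / p.lam (j + 1) * (∑ k ∈ Finset.range m, c k * eigInc p b M w j k) ^ 2
      ≤ 2 / lamConst p * sieveConst p.kappa * (w * (w * meshX b M)) *
        ∑ k ∈ Finset.range m, c k ^ 2 := by
  have hc := lamConst_pos hp
  have hδ : 0 ≤ meshX b M := div_nonneg (by linarith) (by positivity)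
  have hMδ : b + M * meshX b M ≤ 1 := by
    rw [meshX, mul_div_cancel₀ _ (by positivity)]; linarith
  have h := expSine_increment_bound p.kappa hb hδ M hMδ w m hm c n
  have h2 : ∑ j ∈ Finset.range n, 1 / p.lam (j + 1) *
      (∑ k ∈ Finset.range m, c k * eigInc p b M w j k) ^ 2
      ≤ 2 / lamConst p * ∑ j ∈ Finset.range n, 1 / ((j : ℝ) + 1) ^ 2 * (∑ k ∈ Finset.range m, c k *
      (expSine p.kappa j (b + (k + w : ℕ) * meshX b M)
        - expSine p.kappa j (b + k * meshX b M))) ^ 2 := by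
    rw [Finset.mul_sum]
    refine Finset.sum_le_sum fun j _ => ?_
    set Y := ∑ k ∈ Finset.range m, c k *
      (expSine p.kappa j (b + (k + w : ℕ) * meshX b M) - expSine p.kappa j (b + k * meshX b M))
    have e : ∑ k ∈ Finset.range m, c k * eigInc p b M w j k = Real.sqrt 2 * Y := by
      rw [Finset.mul_sum]
      refine Finset.sum_congr rfl fun k _ => ?_
      rw [eigInc, eig_eq_expSine, eig_eq_expSine, gridX, gridX]
      ring
    rw [e, mul_pow, Real.sq_sqrt (by norm_num)]
    have := mul_le_mul_of_nonneg_right (one_div_lam_le hp j) (by positivity : 0 ≤ 2 * Y ^ 2)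
    refine this.trans (le_of_eq ?_)
    ring
  refine h2.trans ((mul_le_mul_of_nonneg_left h (by positivity)).trans (le_of_eq ?_))
  ring

/-- Operator norm bound for the covariance of the double increments. -/
lemma incKernel_form_le (hp : p.Admissible) {τ b : ℝ} (hτ : 0 ≤ τ) (hb : 0 ≤ b) (hb' : b < 1 / 2)
    {M V w m nt : ℕ} (hM : 0 < M) (hm : m + w ≤ M + 1) (hs : ∀ k < m,
      gridX b M k ∈ Set.Icc (0 : ℝ) 1 ∧ gridX b M (k + w) ∈ Set.Icc (0 : ℝ) 1)
    (c : ℕ × ℕ → ℝ) :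
    ∑ a ∈ Finset.range nt ×ˢ Finset.range m, ∑ a' ∈ Finset.range nt ×ˢ Finset.range m,
      c a * c a' * incKernel p τ b M V w a a'
      ≤ opConst p * V * (w * (w * meshX b M)) *
        ∑ a ∈ Finset.range nt ×ˢ Finset.range m, c a ^ 2 := by
  have hS := hp.1
  refine le_of_tendsto' (tendsto_partial_form hp hτ _ (fun a ha => hs a.2
    (Finset.mem_range.1 (Finset.mem_product.1 ha).2)) c) fun n => ?_
  set x : ℕ → ℕ → ℝ := fun j i => ∑ k ∈ Finset.range m, c (i, k) * eigInc p b M w j k with hx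
  have e : ∀ j, ∑ a ∈ Finset.range nt ×ˢ Finset.range m, ∑ a' ∈ Finset.range nt ×ˢ Finset.range m,
      c a * c a' * (incCov p τ V j a.1 a'.1 * (eigInc p b M w j a.2 * eigInc p b M w j a'.2))
      = ∑ i ∈ Finset.range nt, ∑ i' ∈ Finset.range nt, x j i * x j i' * incCov p τ V j i i' := by
    intro j
    rw [Finset.sum_product]
    refine Finset.sum_congr rfl fun i _ => ?_
    simp only [Finset.sum_product]
    rw [Finset.sum_comm]
    refine Finset.sum_congr rfl fun i' _ => ?_
    rw [hx, Finset.sum_mul_sum, Finset.sum_mul]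
    refine Finset.sum_congr rfl fun k _ => ?_
    rw [Finset.sum_mul]
    exact Finset.sum_congr rfl fun k' _ => by ring
  simp_rw [e]
  calc _ ≤ ∑ j ∈ Finset.range n, 2 * p.sigmaSq / p.lam (j + 1) * V *
        ∑ i ∈ Finset.range nt, x j i ^ 2 :=
        Finset.sum_le_sum fun j _ => schur_bound nt _ (incCov_comm p τ V j)
          (fun i => incCov_row_sum hp hτ V j i nt) _
    _ = 2 * p.sigmaSq * V * ∑ i ∈ Finset.range nt, ∑ j ∈ Finset.range n,
          1 / p.lam (j + 1) * x j i ^ 2 := by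
        rw [Finset.sum_comm, Finset.mul_sum]
        refine Finset.sum_congr rfl fun j _ => ?_
        rw [Finset.mul_sum, Finset.mul_sum]
        exact Finset.sum_congr rfl fun i _ => by ring
    _ ≤ 2 * p.sigmaSq * V * ∑ i ∈ Finset.range nt,
          2 / lamConst p * sieveConst p.kappa * (w * (w * meshX b M)) *
            ∑ k ∈ Finset.range m, c (i, k) ^ 2 := by
        gcongr with i
        exact sum_eigInc_bound hp hb hb' hM hm (fun k => c (i, k)) n
    _ = _ := by
        rw [Finset.sum_product, ← Finset.mul_sum, opConst]
        ring

lemma incKernel_diag_le (hp : p.Admissible) {τ b : ℝ} (hτ : 0 ≤ τ) (hb : 0 ≤ b) (hb' : b < 1 / 2)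
    {M V w k : ℕ} (i : ℕ) (hM : 0 < M) (hk : k + w ≤ M) :
    incKernel p τ b M V w (i, k) (i, k) ≤ opConst p * (w * meshX b M) := by
  have hS := hp.1
  have hc := lamConst_pos hp
  have hδ : 0 ≤ meshX b M := div_nonneg (by linarith) (by positivity)
  have hMδ : b + M * meshX b M ≤ 1 := by
    rw [meshX, mul_div_cancel₀ _ (by positivity)]; linarith
  have hmem : ∀ a : ℕ, a ≤ M → gridX b M a ∈ Set.Icc (0 : ℝ) 1 := by
    intro a h1
    have : (a : ℝ) ≤ M := by exact_mod_cast h1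
    rw [gridX]
    exact ⟨by positivity, by nlinarith⟩
  have hsum := (summable_incKernel (p := p) (V := V) (a := (i, k)) (a' := (i, k)) hp hτ
    (hmem k (by omega)) (hmem _ hk) (hmem k (by omega)) (hmem _ hk)).hasSum.tendsto_sum_nat
  refine le_of_tendsto' hsum fun n => ?_
  have h := expSine_increment_bound p.kappa (b := gridX b M k) (δ := w * meshX b M)
    (hmem k (by omega)).1 (by positivity) 1 (by
      have := (hmem _ hk).2
      rw [gridX] at this ⊢
      push_cast at this ⊢
      linarith) 1 1 le_rfl (fun _ => 1) n
  simp only [Finset.range_one, Finset.sum_singleton, zero_add, Nat.cast_one, one_mul,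
    Nat.cast_zero, zero_mul, add_zero, one_pow, mul_one] at h
  have e : gridX b M k + w * meshX b M = gridX b M (k + w) := by
    rw [gridX, gridX]; push_cast; ring
  rw [e] at h
  calc _ ≤ ∑ j ∈ Finset.range n, 4 * p.sigmaSq / lamConst p * (1 / ((j : ℝ) + 1) ^ 2 *
        (expSine p.kappa j (gridX b M (k + w)) - expSine p.kappa j (gridX b M k)) ^ 2) := by
        refine Finset.sum_le_sum fun j _ => ?_
        rw [eigInc, eig_eq_expSine, eig_eq_expSine, ← mul_sub, mul_mul_mul_comm,
          Real.mul_self_sqrt (by norm_num), ← sq]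
        set Y := expSine p.kappa j (gridX b M (k + w)) - expSine p.kappa j (gridX b M k)
        have h1 := (le_abs_self _).trans (abs_incCov_le hp hτ V j i i)
        have h2 : 2 * p.sigmaSq / p.lam (j + 1)
            ≤ 2 * p.sigmaSq / lamConst p * (1 / ((j : ℝ) + 1) ^ 2) := by
          have := mul_le_mul_of_nonneg_left (one_div_lam_le hp j)
            (by positivity : 0 ≤ 2 * p.sigmaSq)
          refine (le_of_eq ?_).trans (this.trans (le_of_eq ?_)) <;> ring
        have := mul_le_mul_of_nonneg_right (h1.trans h2) (by positivity : 0 ≤ 2 * Y ^ 2)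
        refine this.trans (le_of_eq ?_)
        ring
    _ ≤ _ := by
        rw [← Finset.mul_sum, opConst]
        refine (mul_le_mul_of_nonneg_left h (by positivity)).trans (le_of_eq ?_)
        ring

end Field

section Theta

/-- The periodized Gaussian sum `∑_n e^{-π (n + x)² / a}`. -/
def gaussSum (a x : ℝ) : ℝ := ∑' n : ℤ, Real.exp (-Real.pi * ((n : ℝ) + x) ^ 2 / a)

lemma summable_int_sq : Summable fun n : ℤ => 1 / (|(n : ℝ)| + 1) ^ 2 := by
  have hs : Summable fun j : ℕ => 1 / ((j : ℝ) + 1) ^ 2 := by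
    have := (hasSum_cos_div_sq (t := 0) (by simp)).summable
    simpa using this
  refine Summable.of_nat_of_neg ?_ ?_
  · simpa using hs
  · simpa using hs

/-- The sum of `1 / (|n| + 1)²` over the integers. -/
def intSqConst : ℝ := ∑' n : ℤ, 1 / (|(n : ℝ)| + 1) ^ 2

lemma intSqConst_nonneg : 0 ≤ intSqConst := tsum_nonneg fun _ => by positivity

lemma exp_neg_le_inv {y : ℝ} (hy : 0 < y) : Real.exp (-y) ≤ 1 / y := by
  rw [Real.exp_neg, ← one_div]
  exact one_div_le_one_div_of_le hy (by linarith [Real.add_one_le_exp y])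

lemma gaussTerm_le {a b y t : ℝ} (ha : 0 < a) (hb : 0 < b) (ht : 0 < t) (h : b * t / 2 ≤ |y|) :
    Real.exp (-Real.pi * y ^ 2 / a) ≤ 2 * a / b ^ 2 * (1 / t ^ 2) := by
  have hpi := Real.pi_gt_three
  have h1 : (b * t / 2) ^ 2 ≤ y ^ 2 := by
    rw [← sq_abs y]; gcongr
  have hy : 0 < y ^ 2 := lt_of_lt_of_le (by positivity) h1
  have h2 := exp_neg_le_inv (y := Real.pi * y ^ 2 / a) (by positivity)
  rw [show -Real.pi * y ^ 2 / a = -(Real.pi * y ^ 2 / a) by ring]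
  refine h2.trans ?_
  rw [one_div_div, show 2 * a / b ^ 2 * (1 / t ^ 2) = a / (2 * (b * t / 2) ^ 2) by field_simp]
  apply div_le_div_of_nonneg_left ha.le (by positivity)
  nlinarith

lemma int_add_lower {b x : ℝ} (hb2 : b ≤ 1 / 2) (hx : b ≤ x) (hx' : x ≤ 1 - b)
    (hb : 0 < b) (n : ℤ) : b * (|(n : ℝ)| + 1) / 2 ≤ |(n : ℝ) + x| := by
  rcases le_or_gt 0 n with h | h
  · have h0 : (0 : ℝ) ≤ n := by exact_mod_cast h
    rw [abs_of_nonneg h0, abs_of_nonneg (by linarith)]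
    nlinarith
  · have h0 : (n : ℝ) ≤ -1 := by exact_mod_cast (by omega : n ≤ -1)
    rw [abs_of_nonpos (by linarith), abs_of_nonpos (by linarith)]
    nlinarith

lemma int_add_lower_center {x : ℝ} (hx : |x| ≤ 1 / 2) {n : ℤ} (hn : n ≠ 0) :
    1 / 2 * (|(n : ℝ)| + 1) / 2 ≤ |(n : ℝ) + x| := by
  have h1 : (1 : ℝ) ≤ |(n : ℝ)| := by exact_mod_cast Int.one_le_abs hn
  have h2 := abs_sub_abs_le_abs_add (n : ℝ) x
  linarith

lemma summable_gauss {a : ℝ} (ha : 0 < a) {x : ℝ} (hx : |x| ≤ 1) :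
    Summable fun n : ℤ => Real.exp (-Real.pi * ((n : ℝ) + x) ^ 2 / a) := by
  have hfin : (({n : ℤ | |n| < 2} : Set ℤ)).Finite := by
    refine (Set.finite_Icc (-2 : ℤ) 2).subset fun n hn => ?_
    have := abs_lt.1 (show |n| < 2 by simpa using hn)
    exact ⟨by omega, by omega⟩
  refine Summable.of_norm_bounded_eventually (summable_int_sq.mul_left (2 * a / (1 / 2) ^ 2)) ?_
  refine hfin.subset fun n hn => ?_
  by_contra hcon
  apply hn
  simp only [Set.mem_ofPred_eq]
  rw [Real.norm_eq_abs, abs_of_pos (Real.exp_pos _)]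
  refine gaussTerm_le ha (by norm_num) (by positivity) ?_
  have h1 : (2 : ℝ) ≤ |(n : ℝ)| := by
    have : (1 : ℤ) < |n| := by simpa using hcon
    have : (2 : ℤ) ≤ |n| := this
    exact_mod_cast this
  have h2 := abs_sub_abs_le_abs_add (n : ℝ) x
  linarith

lemma gaussSum_off {a b x : ℝ} (ha : 0 < a) (hb : 0 < b) (hb2 : b ≤ 1 / 2) (hx : b ≤ x)
    (hx' : x ≤ 1 - b) : 0 ≤ gaussSum a x ∧ gaussSum a x ≤ 2 * a / b ^ 2 * intSqConst := by
  refine ⟨tsum_nonneg fun _ => (Real.exp_pos _).le, ?_⟩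
  rw [intSqConst, ← tsum_mul_left]
  refine (summable_gauss ha (by rw [abs_le]; constructor <;> linarith)).tsum_le_tsum
    (fun n => ?_) (summable_int_sq.mul_left _)
  exact gaussTerm_le ha hb (by positivity) (int_add_lower hb2 hx hx' hb n)

lemma gaussSum_center {a x : ℝ} (ha : 0 < a) (hx : |x| ≤ 1 / 2) :
    0 ≤ gaussSum a x - Real.exp (-Real.pi * x ^ 2 / a) ∧
      gaussSum a x - Real.exp (-Real.pi * x ^ 2 / a) ≤ 8 * a * intSqConst := by
  have hsum := summable_gauss ha (x := x) (by linarith)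
  have e := hsum.tsum_eq_add_tsum_ite (0 : ℤ)
  rw [gaussSum, e]
  simp only [Int.cast_zero, zero_add, add_sub_cancel_left]
  constructor
  · exact tsum_nonneg fun n => by split_ifs; exacts [le_rfl, (Real.exp_pos _).le]
  · rw [intSqConst, ← tsum_mul_left]
    have hb : ∀ n : ℤ, (if n = 0 then 0 else Real.exp (-Real.pi * ((n : ℝ) + x) ^ 2 / a))
        ≤ 8 * a * (1 / (|(n : ℝ)| + 1) ^ 2) := by
      intro n
      split_ifs with h
      · positivity
      · refine (gaussTerm_le ha (b := 1 / 2) (by norm_num) (by positivity)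
          (int_add_lower_center hx h)).trans (le_of_eq ?_)
        ring
    refine Summable.tsum_le_tsum hb ?_ (summable_int_sq.mul_left _)
    refine Summable.of_nonneg_of_le (fun n => ?_) hb (summable_int_sq.mul_left _)
    split_ifs; exacts [le_rfl, (Real.exp_pos _).le]

lemma summable_exp_cos {a : ℝ} (ha : 0 < a) (x : ℝ) :
    Summable fun n : ℤ => Real.exp (-Real.pi * a * (n : ℝ) ^ 2) * Real.cos (2 * Real.pi * n * x) := by
  have h := summable_gauss (a := 1 / a) (by positivity) (x := 0) (by simp)
  refine Summable.of_norm_bounded h fun n => ?_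
  rw [norm_mul, Real.norm_eq_abs, Real.norm_eq_abs, abs_of_pos (Real.exp_pos _)]
  have : Real.exp (-Real.pi * ((n : ℝ) + 0) ^ 2 / (1 / a))
      = Real.exp (-Real.pi * a * (n : ℝ) ^ 2) := by
    congr 1
    field_simp
    ring
  rw [this]
  exact mul_le_of_le_one_right (Real.exp_pos _).le (Real.abs_cos_le_one _)

/-- Poisson summation for the real theta function. -/
lemma tsum_exp_cos {a : ℝ} (ha : 0 < a) (x : ℝ) :
    ∑' n : ℤ, Real.exp (-Real.pi * a * (n : ℝ) ^ 2) * Real.cos (2 * Real.pi * n * x)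
      = 1 / Real.sqrt a * gaussSum a x := by
  have h := Complex.tsum_exp_neg_quadratic (a := (a : ℂ)) (by simpa using ha)
    (-(Complex.I * (x : ℂ)))
  have hr := congrArg Complex.re h
  have sumC : Summable fun n : ℤ =>
      Complex.exp (-Real.pi * a * n ^ 2 + 2 * Real.pi * -(Complex.I * x) * n) := by
    have h0 := summable_exp_cos ha 0
    simp only [mul_zero, Real.cos_zero, mul_one] at h0
    refine Summable.of_norm (h0.congr fun n => ?_)
    rw [Complex.norm_exp]
    congr 1
    simp [← Complex.ofReal_intCast, ← Complex.ofReal_pow]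
  rw [Complex.re_tsum sumC] at hr
  have e1 : ∀ n : ℤ, (Complex.exp (-Real.pi * a * n ^ 2 + 2 * Real.pi * -(Complex.I * x) * n)).re
      = Real.exp (-Real.pi * a * (n : ℝ) ^ 2) * Real.cos (2 * Real.pi * n * x) := by
    intro n
    rw [Complex.exp_re]
    congr 1
    · congr 1
      simp [← Complex.ofReal_intCast, ← Complex.ofReal_pow]
    · rw [← Real.cos_neg]
      congr 1
      simp [← Complex.ofReal_intCast, ← Complex.ofReal_pow]
      ring
  simp_rw [e1] at hr
  rw [hr]
  have e2 : (∑' n : ℤ, Complex.exp (-Real.pi / a * (n + Complex.I * -(Complex.I * x)) ^ 2))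
      = ((gaussSum a x : ℝ) : ℂ) := by
    rw [gaussSum, Complex.ofReal_tsum]
    refine tsum_congr fun n => ?_
    rw [Complex.ofReal_exp]
    congr 1
    have : Complex.I * -(Complex.I * (x : ℂ)) = x := by
      rw [mul_neg, ← mul_assoc, Complex.I_mul_I]; ring
    rw [this]
    push_cast
    ring
  rw [e2]
  have e3 : (a : ℂ) ^ (1 / 2 : ℂ) = ((Real.sqrt a : ℝ) : ℂ) := by
    rw [Real.sqrt_eq_rpow, Complex.ofReal_cpow ha.le]
    push_cast; rfl
  rw [e3, ← Complex.ofReal_one, ← Complex.ofReal_div, ← Complex.ofReal_mul, Complex.ofReal_re]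

lemma hasSum_exp_cos_nat {a : ℝ} (ha : 0 < a) (x : ℝ) :
    HasSum (fun j : ℕ => Real.exp (-Real.pi * a * ((j : ℝ) + 1) ^ 2)
      * Real.cos (2 * Real.pi * ((j : ℝ) + 1) * x))
      ((1 / Real.sqrt a * gaussSum a x - 1) / 2) := by
  have h := (summable_exp_cos ha x).hasSum
  rw [tsum_exp_cos ha x] at h
  have h2 := h.nat_add_neg
  rw [← hasSum_nat_add_iff' 1] at h2
  have h3 := h2.div_const 2
  convert! h3 using 1
  · funext j
    push_cast
    rw [show 2 * Real.pi * (-((j : ℝ) + 1)) * x = -(2 * Real.pi * ((j : ℝ) + 1) * x) by ring,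
      Real.cos_neg, neg_sq]
    ring
  · simp

end Theta

section Psi

/-- The Gaussian tail integral `∫_t^∞ e^{-z²} dz`. -/
def tailQ (t : ℝ) : ℝ := ∫ z in Set.Ioi t, Real.exp (-z ^ 2)

lemma integrable_exp_neg_sq : Integrable fun z : ℝ => Real.exp (-z ^ 2) := by
  simpa using integrable_exp_neg_mul_sq (b := 1) one_pos

lemma tailQ_eq (t : ℝ) : tailQ t = tailQ 0 - ∫ z in (0 : ℝ)..t, Real.exp (-z ^ 2) := by
  have := intervalIntegral.integral_interval_add_Ioi (a := (0 : ℝ)) (b := t)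
    (f := fun z : ℝ => Real.exp (-z ^ 2)) (μ := volume) integrable_exp_neg_sq.integrableOn
    integrable_exp_neg_sq.integrableOn
  rw [tailQ, tailQ, ← this]; ring

lemma hasDerivAt_tailQ (t : ℝ) : HasDerivAt tailQ (-Real.exp (-t ^ 2)) t := by
  have hc : Continuous fun z : ℝ => Real.exp (-z ^ 2) := by fun_prop
  have h := (hc.integral_hasStrictDerivAt 0 t).hasDerivAt.const_sub (tailQ 0)
  exact h.congr_of_eventuallyEq (Eventually.of_forall tailQ_eq)

lemma continuous_tailQ : Continuous tailQ :=
  continuous_iff_continuousAt.2 fun t => (hasDerivAt_tailQ t).continuousAt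

lemma tailQ_tendsto : Tendsto tailQ atTop (𝓝 0) := by
  have h := intervalIntegral_tendsto_integral_Ioi 0
    (integrable_exp_neg_sq.integrableOn (s := Set.Ioi 0)) tendsto_id
  have h2 := h.const_sub (tailQ 0)
  rw [← tailQ, sub_self] at h2
  exact h2.congr fun t => (tailQ_eq t).symm

lemma tailQ_strictAnti : StrictAnti tailQ :=
  strictAnti_of_hasDerivAt_neg hasDerivAt_tailQ fun t => by
    have := Real.exp_pos (-t ^ 2)
    linarith

lemma tailQ_pos (t : ℝ) : 0 < tailQ t := by
  have h1 : tailQ (t + 1) < tailQ t := tailQ_strictAnti (by linarith)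
  have h2 : 0 ≤ tailQ (t + 1) := setIntegral_nonneg measurableSet_Ioi fun _ _ => (Real.exp_pos _).le
  linarith

/-- The classical bound for the Gaussian tail. -/
lemma tailQ_le {t : ℝ} (ht : 0 < t) : 2 * t * tailQ t ≤ Real.exp (-t ^ 2) := by
  have hlim : Tendsto (fun t : ℝ => Real.exp (-t ^ 2) / (2 * t) - tailQ t) atTop (𝓝 0) := by
    have h1 : Tendsto (fun t : ℝ => Real.exp (-t ^ 2) / (2 * t)) atTop (𝓝 0) := by
      have ha : Tendsto (fun t : ℝ => 2 * t) atTop atTop :=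
        tendsto_id.const_mul_atTop (by norm_num)
      refine squeeze_zero' (Eventually.mono (eventually_gt_atTop 0) fun x hx => ?_)
        (Eventually.mono (eventually_gt_atTop 0) fun x hx => ?_) (tendsto_inv_atTop_zero.comp ha)
      · positivity
      · rw [Function.comp, div_eq_mul_inv]
        have : Real.exp (-x ^ 2) ≤ 1 := by
          rw [Real.exp_le_one_iff]; nlinarith
        have h0 : 0 ≤ (2 * x)⁻¹ := by positivity
        nlinarith
    simpa using h1.sub tailQ_tendsto
  have hanti : AntitoneOn (fun t : ℝ => Real.exp (-t ^ 2) / (2 * t) - tailQ t) (Set.Ioi 0) := by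
    have hd : ∀ x ∈ Set.Ioi (0 : ℝ), HasDerivAt (fun t : ℝ => Real.exp (-t ^ 2) / (2 * t) - tailQ t)
        (-(Real.exp (-x ^ 2) / (2 * x ^ 2))) x := by
      intro x hx
      have hx' : x ≠ 0 := (Set.mem_Ioi.1 hx).ne'
      have h1 : HasDerivAt (fun t : ℝ => -t ^ 2) (-(2 * x)) x := by
        have := (hasDerivAt_pow 2 x).fun_neg
        exact this.congr_deriv (by norm_num)
      have h2 : HasDerivAt (fun t : ℝ => 2 * t) 2 x := by
        simpa using (hasDerivAt_id x).const_mul (2 : ℝ)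
      refine ((h1.exp.fun_div h2 (by positivity)).fun_sub (hasDerivAt_tailQ x)).congr_deriv ?_
      field_simp
      ring
    refine antitoneOn_of_deriv_nonpos (convex_Ioi 0) (fun x hx => (hd x hx).continuousAt.continuousWithinAt)
      (fun x hx => ?_) fun x hx => ?_
    · rw [interior_Ioi] at hx
      exact (hd x hx).differentiableAt.differentiableWithinAt
    · rw [interior_Ioi] at hx
      rw [(hd x hx).deriv]
      have : 0 ≤ Real.exp (-x ^ 2) / (2 * x ^ 2) := by positivity
      linarith
  have h0 : 0 ≤ Real.exp (-t ^ 2) / (2 * t) - tailQ t := by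
    refine le_of_tendsto hlim ?_
    filter_upwards [eventually_ge_atTop t] with x hx
    exact hanti ht (lt_of_lt_of_le ht hx) hx
  have : tailQ t ≤ Real.exp (-t ^ 2) / (2 * t) := by linarith
  rw [le_div_iff₀ (by positivity)] at this
  linarith

/-- The profile of `ψ`: `ψ_ϑ(r) = 2 / √(πϑ) · g(r / √ϑ)`. -/
def gfun (s : ℝ) : ℝ := 1 - Real.exp (-s ^ 2 / 4) + s * tailQ (s / 2)

lemma psi_eq {th : ℝ} (hth : 0 < th) (r : ℝ) :
    psi th r = 2 / Real.sqrt (Real.pi * th) * gfun (r / Real.sqrt th) := by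
  have hs : 0 < Real.sqrt th := Real.sqrt_pos.2 hth
  rw [psi, gfun, tailQ, div_pow, Real.sq_sqrt hth.le, div_div]
  rw [show -(r ^ 2 / th) / 4 = -r ^ 2 / (4 * th) by field_simp, mul_comm (Real.sqrt th) 2]

lemma hasDerivAt_gfun (s : ℝ) : HasDerivAt gfun (tailQ (s / 2)) s := by
  have h1 : HasDerivAt (fun s : ℝ => -s ^ 2 / 4) (-(s / 2)) s := by
    have := (hasDerivAt_pow 2 s).fun_neg.div_const 4
    exact this.congr_deriv (by norm_num; ring)
  have h2 : HasDerivAt (fun s : ℝ => s / 2) (1 / 2) s := (hasDerivAt_id s).div_const 2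
  have h3 : HasDerivAt (fun s => tailQ (s / 2)) (-Real.exp (-(s / 2) ^ 2) * (1 / 2)) s :=
    HasDerivAt.comp (h₂ := tailQ) s (hasDerivAt_tailQ (s / 2)) h2
  have h4 := (h1.exp.const_sub 1).fun_add ((hasDerivAt_id s).fun_mul h3)
  refine h4.congr_deriv ?_
  rw [show -(s / 2) ^ 2 = -s ^ 2 / 4 by ring]
  simp only [id]
  ring

lemma continuous_gfun : Continuous gfun :=
  continuous_iff_continuousAt.2 fun t => (hasDerivAt_gfun t).continuousAt

lemma gfun_pos {s : ℝ} (hs : 0 < s) : 0 < gfun s := by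
  have h1 : Real.exp (-s ^ 2 / 4) ≤ 1 := by
    rw [Real.exp_le_one_iff]; nlinarith
  have h2 := mul_pos hs (tailQ_pos (s / 2))
  rw [gfun]; linarith

lemma psi_pos {th r : ℝ} (hth : 0 < th) (hr : 0 < r) : 0 < psi th r := by
  rw [psi_eq hth]
  have := gfun_pos (s := r / Real.sqrt th) (by positivity)
  have := Real.pi_pos
  positivity

lemma log_psi {th r : ℝ} (hth : 0 < th) (hr : 0 < r) :
    Real.log (psi th r) = Real.log (2 / Real.sqrt (Real.pi * th))
      + Real.log (gfun (r / Real.sqrt th)) := by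
  have := gfun_pos (s := r / Real.sqrt th) (by positivity)
  have := Real.pi_pos
  rw [psi_eq hth, Real.log_mul (by positivity) (by positivity)]

lemma continuousOn_psi (r : ℝ) : ContinuousOn (fun th => psi th r) (Set.Ioi 0) := by
  have : ContinuousOn (fun th => 2 / Real.sqrt (Real.pi * th) * gfun (r / Real.sqrt th))
      (Set.Ioi 0) := by
    refine ContinuousOn.mul ?_ (continuous_gfun.comp_continuousOn ?_)
    · refine continuousOn_const.div (by fun_prop) fun x hx => ?_
      have : 0 < Real.pi * x := mul_pos Real.pi_pos hx
      positivity
    · refine continuousOn_const.div (by fun_prop) fun x hx => ?_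
      exact (Real.sqrt_pos.2 hx).ne'
  exact this.congr fun th hth => psi_eq hth r

lemma strictMonoOn_tail_ratio :
    StrictMonoOn (fun t : ℝ => (1 - Real.exp (-t ^ 2)) / (t * tailQ t)) (Set.Ioi 0) := by
  have hd : ∀ t ∈ Set.Ioi (0 : ℝ), HasDerivAt (fun t : ℝ => (1 - Real.exp (-t ^ 2)) / (t * tailQ t))
      ((2 * t * Real.exp (-t ^ 2) * (t * tailQ t) - (1 - Real.exp (-t ^ 2)) *
        (tailQ t - t * Real.exp (-t ^ 2))) / (t * tailQ t) ^ 2) t := by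
    intro t ht
    have h1 : HasDerivAt (fun t : ℝ => -t ^ 2) (-(2 * t)) t := by
      have := (hasDerivAt_pow 2 t).fun_neg
      exact this.congr_deriv (by norm_num)
    have h2 := h1.exp.const_sub 1
    have h3 := (hasDerivAt_id t).fun_mul (hasDerivAt_tailQ t)
    have hne : id t * tailQ t ≠ 0 := (mul_pos ht (tailQ_pos t)).ne'
    refine (h2.fun_div h3 hne).congr_deriv ?_
    simp only [id]
    congr 1
    ring
  refine strictMonoOn_of_deriv_pos (convex_Ioi 0)
    (fun t ht => (hd t ht).continuousAt.continuousWithinAt) fun t ht => ?_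
  rw [interior_Ioi] at ht
  rw [(hd t ht).deriv]
  have ht' : 0 < t := ht
  have hQ := tailQ_pos t
  set E := Real.exp (-t ^ 2) with hE
  have hE0 : 0 < E := Real.exp_pos _
  have hE1 : E ≤ 1 := by rw [hE, Real.exp_le_one_iff]; nlinarith
  have hEl : 1 - t ^ 2 ≤ E := by
    have := Real.add_one_le_exp (-t ^ 2)
    linarith
  have hrhs : 0 < 2 * t * E * (t * tailQ t) := by positivity
  refine div_pos ?_ (by positivity)
  rcases le_or_gt (tailQ t) (t * E) with h | h
  · have : (1 - E) * (tailQ t - t * E) ≤ 0 := mul_nonpos_of_nonneg_of_nonpos (by linarith)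
      (by linarith)
    linarith
  · have htl : t ^ 2 < 1 / 2 := by
      by_contra hcon
      push Not at hcon
      have := tailQ_le ht'
      rw [← hE] at this
      nlinarith
    have h1 : (1 - E) * (tailQ t - t * E) ≤ t ^ 2 * (tailQ t - t * E) :=
      mul_le_mul_of_nonneg_right (by linarith) (by linarith)
    have h2 : t ^ 2 * (tailQ t - t * E) < t ^ 2 * tailQ t :=
      mul_lt_mul_of_pos_left (by linarith [mul_pos ht' hE0]) (by positivity)
    have h3 : t ^ 2 * tailQ t * 1 ≤ t ^ 2 * tailQ t * (2 * E) :=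
      mul_le_mul_of_nonneg_left (by linarith) (by positivity)
    nlinarith

lemma gfun_elasticity_lt {s s' : ℝ} (hs : 0 < s) (hss : s < s') :
    s' * tailQ (s' / 2) / gfun s' < s * tailQ (s / 2) / gfun s := by
  have hs' : 0 < s' := hs.trans hss
  have h := strictMonoOn_tail_ratio (show s / 2 ∈ Set.Ioi (0 : ℝ) from half_pos hs)
    (show s' / 2 ∈ Set.Ioi (0 : ℝ) from half_pos hs') (by linarith)
  have hQ := tailQ_pos (s / 2)
  have hQ' := tailQ_pos (s' / 2)
  simp only [] at h
  rw [div_lt_div_iff₀ (by positivity) (by positivity)] at h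
  rw [div_lt_div_iff₀ (gfun_pos hs') (gfun_pos hs), gfun, gfun,
    show -s ^ 2 / 4 = -(s / 2) ^ 2 by ring, show -s' ^ 2 / 4 = -(s' / 2) ^ 2 by ring]
  nlinarith

lemma exists_lower_lipschitz {f f' : ℝ → ℝ} {A B : ℝ}
    (hf : ∀ x ∈ Set.Icc A B, HasDerivAt f (f' x) x) (hc : ContinuousOn f' (Set.Icc A B))
    (hpos : ∀ x ∈ Set.Icc A B, 0 < f' x) :
    ∃ c > 0, ∀ x ∈ Set.Icc A B, ∀ y ∈ Set.Icc A B, c * |x - y| ≤ |f x - f y| := by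
  rcases (Set.Icc A B).eq_empty_or_nonempty with h | h
  · exact ⟨1, one_pos, fun x hx => by rw [h] at hx; exact absurd hx (Set.notMem_empty x)⟩
  obtain ⟨x0, hx0, hmin⟩ := isCompact_Icc.exists_isMinOn h hc
  refine ⟨f' x0, hpos x0 hx0, ?_⟩
  have key : ∀ x ∈ Set.Icc A B, ∀ y ∈ Set.Icc A B, x < y → f' x0 * |x - y| ≤ |f x - f y| := by
    intro x hx y hy hxy
    have hsub : Set.Icc x y ⊆ Set.Icc A B := Set.Icc_subset_Icc hx.1 hy.2
    obtain ⟨z, hz, hz'⟩ := exists_hasDerivAt_eq_slope f f' hxy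
      (fun z hz => (hf z (hsub hz)).continuousAt.continuousWithinAt)
      (fun z hz => hf z (hsub (Set.Ioo_subset_Icc_self hz)))
    have hm : f' x0 ≤ f' z := hmin (hsub (Set.Ioo_subset_Icc_self hz))
    have hyx : 0 < y - x := by linarith
    rw [eq_div_iff hyx.ne'] at hz'
    rw [abs_sub_comm x y, abs_sub_comm (f x), abs_of_pos hyx, ← hz']
    refine le_trans ?_ (le_abs_self _)
    exact mul_le_mul_of_nonneg_right hm hyx.le
  intro x hx y hy
  rcases lt_trichotomy x y with h | h | h
  · exact key x hx y hy h
  · subst h; simp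
  · rw [abs_sub_comm, abs_sub_comm (f x)]; exact key y hy x hx h

/-- `ϑ` is identified, with a Lipschitz bound, by the ratio `ψ_ϑ(r/√2) / ψ_ϑ(r)`. -/
lemma exists_psi_ratio_lipschitz {r A B : ℝ} (hr : 0 < r) (hA : 0 < A) :
    ∃ C > 0, ∀ x ∈ Set.Icc A B, ∀ y ∈ Set.Icc A B, |x - y| ≤ C *
      |(Real.log (psi x (r / Real.sqrt 2)) - Real.log (psi x r))
        - (Real.log (psi y (r / Real.sqrt 2)) - Real.log (psi y r))| := by
  set q := 1 / Real.sqrt 2 with hq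
  have hq0 : 0 < q := by positivity
  have hq1 : q < 1 := by
    rw [hq, div_lt_one (by positivity)]
    exact (Real.lt_sqrt (by norm_num)).2 (by norm_num)
  set f : ℝ → ℝ := fun s => Real.log (gfun (q * s)) - Real.log (gfun s) with hf
  set f' : ℝ → ℝ := fun s => tailQ (q * s / 2) * q / gfun (q * s) - tailQ (s / 2) / gfun s with hf'
  rcases lt_or_ge B A with hBA | hAB
  · exact ⟨1, one_pos, fun x hx => absurd (hx.1.trans hx.2) (not_le.2 hBA)⟩
  have hB : 0 < B := hA.trans_le hAB
  set a := r / Real.sqrt B with ha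
  set c := r / Real.sqrt A with hc
  have ha0 : 0 < a := by positivity
  have hpos : ∀ s ∈ Set.Icc a c, 0 < s := fun s hs => ha0.trans_le hs.1
  obtain ⟨m, hm, hm'⟩ := exists_lower_lipschitz (f := f) (f' := f') (A := a) (B := c)
    (fun s hs => by
      have hs0 := hpos s hs
      have h1 : HasDerivAt (fun s : ℝ => q * s) q s := by
        simpa using (hasDerivAt_id s).const_mul q
      have h2 : HasDerivAt (fun s => gfun (q * s)) (tailQ (q * s / 2) * q) s :=
        (hasDerivAt_gfun (q * s)).comp s h1
      exact (h2.log (gfun_pos (by positivity)).ne').fun_sub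
        ((hasDerivAt_gfun s).log (gfun_pos hs0).ne'))
    (by
      refine ContinuousOn.sub (ContinuousOn.div ?_ ?_ ?_) (ContinuousOn.div ?_ ?_ ?_)
      · exact ((continuous_tailQ.comp (by fun_prop)).mul continuous_const).continuousOn
      · exact (continuous_gfun.comp (by fun_prop)).continuousOn
      · exact fun s hs => (gfun_pos (mul_pos hq0 (hpos s hs))).ne'
      · exact (continuous_tailQ.comp (by fun_prop)).continuousOn
      · exact continuous_gfun.continuousOn
      · exact fun s hs => (gfun_pos (hpos s hs)).ne')
    (fun s hs => by
      have hs0 := hpos s hs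
      have h := gfun_elasticity_lt (s := q * s) (s' := s) (by positivity) (by nlinarith)
      have e : f' s = 1 / s * (q * s * tailQ (q * s / 2) / gfun (q * s)
          - s * tailQ (s / 2) / gfun s) := by
        have := (gfun_pos hs0).ne'
        have := (gfun_pos (mul_pos hq0 hs0)).ne'
        simp only [hf']
        field_simp
      rw [e]
      exact mul_pos (by positivity) (by linarith))
  refine ⟨2 * r ^ 2 * c / a ^ 4 / m, by positivity, fun x hx y hy => ?_⟩
  have hmem : ∀ x ∈ Set.Icc A B, r / Real.sqrt x ∈ Set.Icc a c := by
    intro x hx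
    have hx0 : 0 < x := hA.trans_le hx.1
    exact ⟨div_le_div_of_nonneg_left hr.le (Real.sqrt_pos.2 hx0) (Real.sqrt_le_sqrt hx.2),
      div_le_div_of_nonneg_left hr.le (Real.sqrt_pos.2 hA) (Real.sqrt_le_sqrt hx.1)⟩
  have hfe : ∀ x ∈ Set.Icc A B, Real.log (psi x (r / Real.sqrt 2)) - Real.log (psi x r)
      = f (r / Real.sqrt x) := by
    intro x hx
    have hx0 : 0 < x := hA.trans_le hx.1
    rw [log_psi hx0 (by positivity), log_psi hx0 hr, hf]
    rw [show r / Real.sqrt 2 / Real.sqrt x = q * (r / Real.sqrt x) by rw [hq]; ring]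
    ring
  rw [hfe x hx, hfe y hy]
  have hx0 : 0 < x := hA.trans_le hx.1
  have hy0 : 0 < y := hA.trans_le hy.1
  have sx : r ^ 2 / (r / Real.sqrt x) ^ 2 = x := by
    rw [div_pow, Real.sq_sqrt hx0.le]; field_simp
  have sy : r ^ 2 / (r / Real.sqrt y) ^ 2 = y := by
    rw [div_pow, Real.sq_sqrt hy0.le]; field_simp
  have hmx := hmem x hx
  have hmy := hmem y hy
  have hlow := hm' _ hmx _ hmy
  set s := r / Real.sqrt x
  set t := r / Real.sqrt y
  have hs0 := hpos s hmx
  have ht0 := hpos t hmy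
  have e : x - y = r ^ 2 * (t + s) / (s ^ 2 * t ^ 2) * (t - s) := by
    rw [← sx, ← sy]; field_simp; ring
  have hb : r ^ 2 * (t + s) / (s ^ 2 * t ^ 2) ≤ r ^ 2 * (c + c) / (a ^ 2 * a ^ 2) := by
    have h1 := hmx.1
    have h2 := hmx.2
    have h3 := hmy.1
    have h4 := hmy.2
    gcongr
  rw [e, abs_mul, abs_of_pos (by positivity), abs_sub_comm t s]
  have hms : |s - t| ≤ |f s - f t| / m := by
    rw [le_div_iff₀ hm]; linarith
  calc _ ≤ r ^ 2 * (c + c) / (a ^ 2 * a ^ 2) * (|f s - f t| / m) := by gcongr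
    _ = _ := by field_simp; ring

end Psi

section Bias

lemma one_div_sqrt_eq {s : ℝ} (hs : 0 ≤ s) : 1 / Real.sqrt s = s ^ (-(1 / 2) : ℝ) := by
  rw [Real.rpow_neg hs, Real.sqrt_eq_rpow, one_div]

lemma integrableOn_one_div_sqrt (D : ℝ) :
    IntegrableOn (fun s : ℝ => 1 / Real.sqrt s) (Set.Ioc 0 D) := by
  rcases le_or_gt D 0 with h | h
  · rw [Set.Ioc_eq_empty (not_lt.2 h)]; simp
  have := intervalIntegral.intervalIntegrable_rpow' (a := 0) (b := D) (r := -(1 / 2)) (by norm_num)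
  rw [intervalIntegrable_iff_integrableOn_Ioc_of_le h.le] at this
  exact this.congr_fun (fun s hs => (one_div_sqrt_eq hs.1.le).symm) measurableSet_Ioc

lemma integral_one_div_sqrt {D : ℝ} (hD : 0 < D) :
    ∫ s in Set.Ioc 0 D, 1 / Real.sqrt s = 2 * Real.sqrt D := by
  rw [setIntegral_congr_fun measurableSet_Ioc (fun s hs => one_div_sqrt_eq hs.1.le),
    ← intervalIntegral.integral_of_le hD.le, integral_rpow (Or.inl (by norm_num)),
    Real.sqrt_eq_rpow, Real.zero_rpow (by norm_num)]
  norm_num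
  ring

/-- The leading term of the variance density of the double increments. -/
def mainDensity (th h s : ℝ) : ℝ :=
  1 / Real.sqrt (Real.pi * th * s) * (1 - Real.exp (-(h ^ 2 / th) / s))

lemma abs_mainDensity_le {th h s : ℝ} (hth : 0 < th) (hs : 0 < s) :
    |mainDensity th h s| ≤ 1 / Real.sqrt (Real.pi * th) * (1 / Real.sqrt s) := by
  have hpi := Real.pi_pos
  have h1 : Real.exp (-(h ^ 2 / th) / s) ≤ 1 := by
    rw [Real.exp_le_one_iff]
    have : 0 ≤ h ^ 2 / th / s := by positivity
    rw [neg_div]; linarith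
  have h0 := Real.exp_pos (-(h ^ 2 / th) / s)
  rw [mainDensity, abs_mul, Real.sqrt_mul (by positivity), ← one_div_mul_one_div,
    abs_of_nonneg (by positivity), abs_of_nonneg (by linarith)]
  exact mul_le_of_le_one_right (by positivity) (by linarith)

lemma measurable_mainDensity (th h : ℝ) : Measurable (mainDensity th h) := by
  unfold mainDensity; fun_prop

lemma integrableOn_mainDensity {th : ℝ} (hth : 0 < th) (h D : ℝ) :
    IntegrableOn (mainDensity th h) (Set.Ioc 0 D) := by
  refine Integrable.mono' ((integrableOn_one_div_sqrt D).const_mul (1 / Real.sqrt (Real.pi * th)))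
    (measurable_mainDensity th h).aestronglyMeasurable ?_
  filter_upwards [ae_restrict_mem measurableSet_Ioc] with s hs
  exact abs_mainDensity_le hth hs.1

lemma integral_mainDensity {th d D : ℝ} (hth : 0 < th) (hd : 0 < d) (hD : 0 < D) :
    ∫ s in Set.Ioc 0 D, mainDensity th (d / 2) s
      = Real.sqrt D * psi th (d / Real.sqrt D) := by
  have hpi := Real.pi_pos
  obtain ⟨c, hc⟩ : ∃ c, c = d / (2 * Real.sqrt th) := ⟨_, rfl⟩
  have hc0 : 0 < c := by rw [hc]; positivity
  have hc2 : (d / 2) ^ 2 / th = c ^ 2 := by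
    rw [hc, div_pow d (2 * _), mul_pow, Real.sq_sqrt hth.le]; field_simp
  set K := 1 / Real.sqrt (Real.pi * th) with hK
  set F : ℝ → ℝ := fun t => K * (2 * Real.sqrt t * (1 - Real.exp (-c ^ 2 / t))
    + 4 * c * tailQ (c / Real.sqrt t)) with hF
  have hderiv : ∀ t ∈ Set.Ioi (0 : ℝ), HasDerivAt F (mainDensity th (d / 2) t) t := by
    intro t ht
    have ht0 : 0 < t := ht
    have hst : 0 < Real.sqrt t := Real.sqrt_pos.2 ht0
    have h1 : HasDerivAt Real.sqrt (1 / (2 * Real.sqrt t)) t := Real.hasDerivAt_sqrt ht0.ne'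
    have h2 : HasDerivAt (fun t : ℝ => -c ^ 2 / t) (c ^ 2 / t ^ 2) t := by
      have := (hasDerivAt_inv ht0.ne').const_mul (-c ^ 2)
      refine (this.congr_deriv ?_).congr_of_eventuallyEq (Eventually.of_forall fun s => ?_)
      · field_simp
      · simp only [div_eq_mul_inv]
    have h3 : HasDerivAt (fun t : ℝ => c / Real.sqrt t) (-(c / (2 * t * Real.sqrt t))) t := by
      have := (h1.fun_inv hst.ne').const_mul c
      refine (this.congr_deriv ?_).congr_of_eventuallyEq (Eventually.of_forall fun s => ?_)
      · rw [Real.sq_sqrt ht0.le]; field_simp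
      · simp only [div_eq_mul_inv]
    have h4 : HasDerivAt (fun t : ℝ => tailQ (c / Real.sqrt t))
        (-Real.exp (-(c / Real.sqrt t) ^ 2) * (-(c / (2 * t * Real.sqrt t)))) t :=
      HasDerivAt.comp (h₂ := tailQ) t (hasDerivAt_tailQ (c / Real.sqrt t)) h3
    have h5 := (((h1.const_mul 2).fun_mul (h2.exp.const_sub 1)).fun_add
      (h4.const_mul (4 * c))).const_mul K
    refine h5.congr_deriv ?_
    rw [mainDensity, hc2, Real.sqrt_mul (by positivity) t, div_pow c, Real.sq_sqrt ht0.le, ← neg_div]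
    set E := Real.exp (-c ^ 2 / t)
    have hq : t = Real.sqrt t ^ 2 := (Real.sq_sqrt ht0.le).symm
    set q := Real.sqrt t
    rw [hq, ← one_div_mul_one_div (Real.sqrt (Real.pi * th)) q, ← hK]
    field_simp
    ring
  have h0 : Tendsto F (𝓝[>] 0) (𝓝 0) := by
    have a1 : Tendsto (fun t : ℝ => Real.sqrt t) (𝓝[>] 0) (𝓝 0) := by
      have := (Real.continuous_sqrt.tendsto 0).mono_left (nhdsWithin_le_nhds (s := Set.Ioi 0))
      simpa using this
    have a2 : Tendsto (fun t : ℝ => 2 * Real.sqrt t * (1 - Real.exp (-c ^ 2 / t))) (𝓝[>] 0)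
        (𝓝 0) := by
      refine squeeze_zero_norm' (a := fun t => 2 * Real.sqrt t) ?_ (by simpa using a1.const_mul 2)
      filter_upwards [self_mem_nhdsWithin] with t ht
      have ht0 : (0 : ℝ) < t := ht
      have e1 : Real.exp (-c ^ 2 / t) ≤ 1 := by
        rw [Real.exp_le_one_iff, neg_div]
        have : 0 ≤ c ^ 2 / t := by positivity
        linarith
      have e2 := Real.exp_pos (-c ^ 2 / t)
      rw [Real.norm_eq_abs, abs_of_nonneg (mul_nonneg (by positivity) (by linarith))]
      exact mul_le_of_le_one_right (by positivity) (by linarith)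
    have a3 : Tendsto (fun t : ℝ => c / Real.sqrt t) (𝓝[>] 0) atTop := by
      have : Tendsto (fun t : ℝ => Real.sqrt t) (𝓝[>] 0) (𝓝[>] 0) := by
        refine tendsto_nhdsWithin_iff.2 ⟨a1, ?_⟩
        filter_upwards [self_mem_nhdsWithin] with t ht
        exact Real.sqrt_pos.2 ht
      exact (tendsto_inv_nhdsGT_zero.comp this).const_mul_atTop hc0
    have a4 := (tailQ_tendsto.comp a3).const_mul (4 * c)
    have := (a2.add a4).const_mul K
    simpa using this
  have hend : Tendsto F (𝓝[<] D) (𝓝 (F D)) :=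
    (hderiv D hD).continuousAt.tendsto.mono_left nhdsWithin_le_nhds
  have hintegrable : IntervalIntegrable (mainDensity th (d / 2)) volume 0 D :=
    (intervalIntegrable_iff_integrableOn_Ioc_of_le hD.le).2 (integrableOn_mainDensity hth _ _)
  rw [← intervalIntegral.integral_of_le hD.le,
    intervalIntegral.integral_eq_sub_of_hasDerivAt_of_tendsto hD
      (fun x hx => hderiv x hx.1) hintegrable h0 hend, sub_zero, psi_eq hth, gfun, hF]
  have e1 : d / Real.sqrt D / Real.sqrt th / 2 = c / Real.sqrt D := by rw [hc]; ring
  have hsd : 0 < Real.sqrt D := Real.sqrt_pos.2 hD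
  have e2 : -(d / Real.sqrt D / Real.sqrt th) ^ 2 / 4 = -c ^ 2 / D := by
    rw [hc]
    simp only [div_pow, mul_pow, Real.sq_sqrt hD.le, Real.sq_sqrt hth.le]
    field_simp
    norm_num
  have e3 : d / Real.sqrt D / Real.sqrt th = 2 * c / Real.sqrt D := by rw [hc]; field_simp
  rw [e1, e2, e3]
  simp only []
  rw [show 2 / Real.sqrt (Real.pi * th) = 2 * K by rw [hK]; ring]
  field_simp
  ring

variable {p : Coeffs}

/-- The squared eigenfunction increment, divided by `e^{-κ z}`. -/
def sqInc (κ z h : ℝ) (j : ℕ) : ℝ :=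
  (Real.exp (κ * h) + Real.exp (-(κ * h))) * Real.cos (2 * Real.pi * ((j : ℝ) + 1) * 0)
    - 2 * Real.cos (2 * Real.pi * ((j : ℝ) + 1) * h)
    + 2 * Real.cos (2 * Real.pi * ((j : ℝ) + 1) * z)
    - Real.exp (-(κ * h)) * Real.cos (2 * Real.pi * ((j : ℝ) + 1) * (z + h))
    - Real.exp (κ * h) * Real.cos (2 * Real.pi * ((j : ℝ) + 1) * (z - h))

lemma sq_eig_sub (p : Coeffs) (z h : ℝ) (j : ℕ) :
    (p.eig (j + 1) (z + h) - p.eig (j + 1) (z - h)) ^ 2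
      = Real.exp (-p.kappa * z) * sqInc p.kappa z h j := by
  rw [eig_eq_expSine, eig_eq_expSine, ← mul_sub, mul_pow, Real.sq_sqrt (by norm_num), expSine,
    expSine, sqInc]
  set y := Real.pi * ((j : ℝ) + 1) with hy
  set κ := p.kappa
  have c2 : ∀ x : ℝ, Real.cos (2 * Real.pi * ((j : ℝ) + 1) * x) = 1 - 2 * Real.sin (y * x) ^ 2 := by
    intro x
    rw [show 2 * Real.pi * ((j : ℝ) + 1) * x = 2 * (y * x) by rw [hy]; ring, Real.cos_two_mul,
      Real.cos_sq']
    ring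
  have hss : 2 * Real.cos (2 * Real.pi * ((j : ℝ) + 1) * h)
      - 2 * Real.cos (2 * Real.pi * ((j : ℝ) + 1) * z)
      = 4 * (Real.sin (y * (z + h)) * Real.sin (y * (z - h))) := by
    rw [show 2 * Real.pi * ((j : ℝ) + 1) * h = y * (z + h) - y * (z - h) by rw [hy]; ring,
      show 2 * Real.pi * ((j : ℝ) + 1) * z = y * (z + h) + y * (z - h) by rw [hy]; ring,
      Real.cos_sub, Real.cos_add]
    ring
  have e1 : Real.exp (-κ * (z + h) / 2) ^ 2 = Real.exp (-κ * z) * Real.exp (-(κ * h)) := by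
    rw [← Real.exp_nat_mul, ← Real.exp_add]; congr 1; push_cast; ring
  have e2 : Real.exp (-κ * (z - h) / 2) ^ 2 = Real.exp (-κ * z) * Real.exp (κ * h) := by
    rw [← Real.exp_nat_mul, ← Real.exp_add]; congr 1; push_cast; ring
  have e3 : Real.exp (-κ * (z + h) / 2) * Real.exp (-κ * (z - h) / 2) = Real.exp (-κ * z) := by
    rw [← Real.exp_add]; congr 1; ring
  rw [c2 0, c2 (z + h), c2 (z - h)]
  simp only [mul_zero, Real.sin_zero]
  linear_combination (2 * Real.sin (y * (z + h)) ^ 2) * e1 + (2 * Real.sin (y * (z - h)) ^ 2) * e2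
    - (4 * Real.sin (y * (z + h)) * Real.sin (y * (z - h))) * e3 + Real.exp (-κ * z) * hss

/-- The Poisson-summed variance density. -/
def thetaDensity (p : Coeffs) (z h s : ℝ) : ℝ :=
  Real.exp (-(p.th2 * p.Gam * s)) * (1 / Real.sqrt (Real.pi * p.th2 * s)) *
    (((Real.exp (p.kappa * h) + Real.exp (-(p.kappa * h))) * gaussSum (Real.pi * p.th2 * s) 0
      - 2 * gaussSum (Real.pi * p.th2 * s) h + 2 * gaussSum (Real.pi * p.th2 * s) z
      - Real.exp (-(p.kappa * h)) * gaussSum (Real.pi * p.th2 * s) (z + h)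
      - Real.exp (p.kappa * h) * gaussSum (Real.pi * p.th2 * s) (z - h)) / 2)

lemma hasSum_thetaDensity (hp : p.Admissible) (z h : ℝ) {s : ℝ} (hs : 0 < s) :
    HasSum (fun j : ℕ => Real.exp (-(p.lam (j + 1) * s)) * sqInc p.kappa z h j)
      (thetaDensity p z h s) := by
  set a := Real.pi * p.th2 * s with ha
  have ha0 : 0 < a := mul_pos (mul_pos Real.pi_pos hp.2.1) hs
  have H := fun x => hasSum_exp_cos_nat ha0 x
  have h1 := (((((H 0).mul_left (Real.exp (p.kappa * h) + Real.exp (-(p.kappa * h)))).sub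
    ((H h).mul_left 2)).add ((H z).mul_left 2)).sub
    ((H (z + h)).mul_left (Real.exp (-(p.kappa * h))))).sub
    ((H (z - h)).mul_left (Real.exp (p.kappa * h)))
  have h2 := h1.mul_left (Real.exp (-(p.th2 * p.Gam * s)))
  convert! h2 using 1
  · funext j
    have : Real.exp (-(p.lam (j + 1) * s)) = Real.exp (-(p.th2 * p.Gam * s)) *
        Real.exp (-Real.pi * a * ((j : ℝ) + 1) ^ 2) := by
      rw [← Real.exp_add, Coeffs.lam, ha]
      congr 1
      push_cast
      ring
    rw [this, sqInc]
    ring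
  · rw [thetaDensity, ← ha]
    ring

lemma abs_sqInc_le (κ z h : ℝ) (hh : |h| ≤ 1) (j : ℕ) : |sqInc κ z h j| ≤ 4 + 4 * Real.exp |κ| := by
  have hk : ∀ x : ℝ, |x| ≤ |κ| → Real.exp x ≤ Real.exp |κ| := fun x hx =>
    Real.exp_le_exp.2 ((le_abs_self x).trans hx)
  have hkh : |κ * h| ≤ |κ| := by
    rw [abs_mul]; exact mul_le_of_le_one_right (abs_nonneg _) hh
  have e1 := hk (κ * h) hkh
  have e2 := hk (-(κ * h)) (by rwa [abs_neg])
  have p1 := Real.exp_pos (κ * h)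
  have p2 := Real.exp_pos (-(κ * h))
  rw [sqInc]
  have c := fun x : ℝ => abs_le.1 (Real.abs_cos_le_one x)
  set c0 := Real.cos (2 * Real.pi * ((j : ℝ) + 1) * 0)
  set c1 := Real.cos (2 * Real.pi * ((j : ℝ) + 1) * h)
  set c2 := Real.cos (2 * Real.pi * ((j : ℝ) + 1) * z)
  set c3 := Real.cos (2 * Real.pi * ((j : ℝ) + 1) * (z + h))
  set c4 := Real.cos (2 * Real.pi * ((j : ℝ) + 1) * (z - h))
  have k0 : |c0| ≤ 1 := Real.abs_cos_le_one _
  have k1 : |c1| ≤ 1 := Real.abs_cos_le_one _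
  have k2 : |c2| ≤ 1 := Real.abs_cos_le_one _
  have k3 : |c3| ≤ 1 := Real.abs_cos_le_one _
  have k4 : |c4| ≤ 1 := Real.abs_cos_le_one _
  rw [abs_le] at k0 k1 k2 k3 k4 ⊢
  constructor <;> nlinarith

lemma incCov_self (p : Coeffs) {τ : ℝ} (hp : p.Admissible) (hτ : 0 ≤ τ) (V j i : ℕ) :
    incCov p τ V j i i
      = p.sigmaSq * ∫ s in Set.Ioc 0 (V * τ), Real.exp (-(p.lam (j + 1) * s)) := by
  have hl := hp.lam_pos j
  set lam := p.lam (j + 1) with hlam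
  have hI : ∫ s in Set.Ioc 0 (V * τ), Real.exp (-(lam * s))
      = (1 - Real.exp (-(lam * (V * τ)))) / lam := by
    rw [← intervalIntegral.integral_of_le (by positivity)]
    have : ∀ x ∈ Set.uIcc 0 (V * τ), HasDerivAt (fun s => -(Real.exp (-(lam * s)) / lam))
        (Real.exp (-(lam * x))) x := by
      intro x _
      have h1 : HasDerivAt (fun s : ℝ => -(lam * s)) (-lam) x := by
        have := ((hasDerivAt_id x).const_mul lam).fun_neg
        simpa using this
      refine (h1.exp.div_const lam).fun_neg.congr_deriv ?_
      field_simp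
    rw [intervalIntegral.integral_eq_sub_of_hasDerivAt this
      ((by fun_prop : Continuous fun s : ℝ => Real.exp (-(lam * s))).intervalIntegrable _ _)]
    simp
    ring
  rw [hI, incCov]
  simp only [modeCov, ouCov, ← hlam]
  push_cast
  have e1 : |(i : ℝ) + V - i| = V := by rw [add_sub_cancel_left, abs_of_nonneg (by positivity)]
  have e2 : |(i : ℝ) - (i + V)| = V := by
    rw [sub_add_cancel_left, abs_neg, abs_of_nonneg (by positivity)]
  rw [e1, e2, sub_self, sub_self, abs_zero, mul_zero, Real.exp_zero,
    show -lam * τ * (V : ℝ) = -(lam * (V * τ)) by ring]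
  field_simp
  ring

lemma incKernel_diag_eq (hp : p.Admissible) {τ b : ℝ} (hτ : 0 ≤ τ) {M V w : ℕ} (i k : ℕ) {z h : ℝ}
    (h1 : gridX b M (k + w) = z + h) (h2 : gridX b M k = z - h) (hh : |h| ≤ 1) :
    AEStronglyMeasurable (thetaDensity p z h) (volume.restrict (Set.Ioc 0 (V * τ))) ∧
    incKernel p τ b M V w (i, k) (i, k)
      = p.sigmaSq * Real.exp (-p.kappa * z) * ∫ s in Set.Ioc 0 (V * τ), thetaDensity p z h s := by
  set D := (V : ℝ) * τ with hD
  have hD0 : 0 ≤ D := by positivity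
  set C := 4 + 4 * Real.exp |p.kappa| with hC
  have hC0 : 0 ≤ C := by positivity
  set F : ℕ → ℝ → ℝ := fun j s => Real.exp (-(p.lam (j + 1) * s)) * sqInc p.kappa z h j with hF
  have hIexp : ∀ j, IntegrableOn (fun s => Real.exp (-(p.lam (j + 1) * s))) (Set.Ioc 0 D) :=
    fun j => ((by fun_prop : Continuous fun s : ℝ =>
      Real.exp (-(p.lam (j + 1) * s))).integrableOn_Ioc)
  have hInt : ∀ j, Integrable (F j) (volume.restrict (Set.Ioc 0 D)) := fun j =>
    (hIexp j).mul_const _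
  have hbd : ∀ j, ∫ s in Set.Ioc 0 D, Real.exp (-(p.lam (j + 1) * s)) ≤
      2 * (1 / lamConst p * (1 / ((j : ℝ) + 1) ^ 2)) := by
    intro j
    have h1 := incCov_self p hp hτ V j i
    have h2 := (le_abs_self _).trans (abs_incCov_le hp hτ V j i i)
    rw [h1] at h2
    have hS := hp.1
    have h3 : ∫ s in Set.Ioc 0 D, Real.exp (-(p.lam (j + 1) * s)) ≤ 2 * (1 / p.lam (j + 1)) := by
      have : p.sigmaSq * ∫ s in Set.Ioc 0 D, Real.exp (-(p.lam (j + 1) * s))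
          ≤ p.sigmaSq * (2 * (1 / p.lam (j + 1))) := h2.trans (le_of_eq (by ring))
      exact le_of_mul_le_mul_left this hS
    linarith [one_div_lam_le hp j]
  have hs : Summable fun j : ℕ => 1 / ((j : ℝ) + 1) ^ 2 := by
    have := (hasSum_cos_div_sq (t := 0) (by simp)).summable
    simpa using this
  have hsum : Summable fun j => ∫ s in Set.Ioc 0 D, ‖F j s‖ := by
    refine Summable.of_nonneg_of_le (fun j => integral_nonneg fun _ => norm_nonneg _) (fun j => ?_)
      (hs.mul_left (2 * (1 / lamConst p) * C))
    have e : ∀ s, ‖F j s‖ = Real.exp (-(p.lam (j + 1) * s)) * |sqInc p.kappa z h j| := by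
      intro s
      rw [hF, norm_mul, Real.norm_eq_abs, Real.norm_eq_abs, abs_of_pos (Real.exp_pos _)]
    simp_rw [e]
    rw [integral_mul_const]
    have hi0 : 0 ≤ ∫ s in Set.Ioc 0 D, Real.exp (-(p.lam (j + 1) * s)) :=
      integral_nonneg fun _ => (Real.exp_pos _).le
    have hc := lamConst_pos hp
    calc _ ≤ 2 * (1 / lamConst p * (1 / ((j : ℝ) + 1) ^ 2)) * C :=
          mul_le_mul (hbd j) (abs_sqInc_le _ _ _ hh j) (abs_nonneg _) (by positivity)
      _ = _ := by ring
  have key := hasSum_integral_of_summable_integral_norm hInt hsum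
  have hae : ∀ᵐ s ∂(volume.restrict (Set.Ioc 0 D)), ∑' j, F j s = thetaDensity p z h s := by
    filter_upwards [ae_restrict_mem measurableSet_Ioc] with s hs
    exact (hasSum_thetaDensity hp z h hs.1).tsum_eq
  rw [integral_congr_ae hae] at key
  constructor
  · refine aestronglyMeasurable_of_tendsto_ae atTop
      (f := fun n s => ∑ j ∈ Finset.range n, F j s) (fun n => ?_) ?_
    · exact (by simp only [hF]; fun_prop : Measurable
        fun s => ∑ j ∈ Finset.range n, F j s).aestronglyMeasurable
    · filter_upwards [ae_restrict_mem measurableSet_Ioc] with s hs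
      exact (hasSum_thetaDensity hp z h hs.1).tendsto_sum_nat
  · rw [incKernel]
    have key2 := key.mul_left (p.sigmaSq * Real.exp (-p.kappa * z))
    rw [← key2.tsum_eq]
    refine tsum_congr fun j => ?_
    simp only [eigInc, h1, h2, hF]
    rw [integral_mul_const, incCov_self p hp hτ, ← sq, sq_eig_sub]
    ring

end Bias

section BiasBound

variable {p : Coeffs}

lemma abs_exp_sub_one_le_mul_exp (x : ℝ) : |Real.exp x - 1| ≤ |x| * Real.exp |x| := by
  have h1 := Real.add_one_le_exp x
  have h2 := Real.add_one_le_exp (-x)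
  have hx := Real.exp_pos x
  have h3 : Real.exp x - 1 ≤ x * Real.exp x := by
    have : Real.exp x * Real.exp (-x) = 1 := by rw [← Real.exp_add]; simp
    nlinarith
  rcases le_total 0 x with h | h
  · rw [abs_of_nonneg h, abs_of_nonneg (by linarith)]
    exact h3
  · rw [abs_of_nonpos h, abs_of_nonpos (by nlinarith)]
    have : 1 ≤ Real.exp (-x) := by rw [Real.one_le_exp_iff]; linarith
    nlinarith

set_option maxHeartbeats 800000 in
lemma exists_thetaDensity_bound (hp : p.Admissible) {b : ℝ} (hb : 0 < b) (hb' : b ≤ 1 / 2) :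
    ∃ C, 0 < C ∧ ∀ z h s : ℝ, 0 < s → s ≤ 1 → |h| ≤ 1 / 2 → b ≤ z - |h| → z + |h| ≤ 1 - b →
      |thetaDensity p z h s - mainDensity p.th2 h s| ≤ C * (h ^ 2 + s) * (1 / Real.sqrt s) := by
  have hth := hp.2.1
  set I := intSqConst
  have hI : 0 ≤ I := intSqConst_nonneg
  set κ := p.kappa
  set G := |p.th2 * p.Gam| with hG
  set Cc := Real.exp (κ ^ 2 / 2) with hCc
  have hCc1 : 0 < Cc := Real.exp_pos _
  set K1 := κ ^ 2 / 2 * Cc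
  set K2 := (Cc + 1) * (8 * (Real.pi * p.th2) * I) + (1 + Cc) * (2 * (Real.pi * p.th2) / b ^ 2 * I)
  have hK1 : 0 ≤ K1 := by positivity
  have hK2 : 0 ≤ K2 := by positivity
  set Q := 1 / Real.sqrt (Real.pi * p.th2)
  have hQ : 0 < Q := by positivity
  refine ⟨Q * (Real.exp G * (K1 + K2) + G * Real.exp G + 1), by positivity, ?_⟩
  intro z h s hs hs1 hh hz1 hz2
  have hh0 := abs_nonneg h
  have hh1 := le_abs_self h
  have hh2 := neg_abs_le h
  set a := Real.pi * p.th2 * s with ha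
  have ha0 : 0 < a := by positivity
  have g0 := gaussSum_center (a := a) (x := 0) ha0 (by simp)
  have gh := gaussSum_center ha0 hh
  have gz := gaussSum_off (a := a) (x := z) ha0 hb hb' (by linarith) (by linarith)
  have gp := gaussSum_off (a := a) (x := z + h) ha0 hb hb' (by linarith) (by linarith)
  have gm := gaussSum_off (a := a) (x := z - h) ha0 hb hb' (by linarith) (by linarith)
  rw [thetaDensity, mainDensity, ← ha]
  have he : Real.exp (-Real.pi * h ^ 2 / a) = Real.exp (-(h ^ 2 / p.th2) / s) := by
    congr 1; rw [ha]; field_simp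
  rw [he] at gh
  have e00 : Real.exp (-Real.pi * 0 ^ 2 / a) = 1 := by simp
  rw [e00] at g0
  set e := Real.exp (-(h ^ 2 / p.th2) / s)
  have he0 : 0 < e := Real.exp_pos _
  have he1 : e ≤ 1 := by
    rw [Real.exp_le_one_iff, neg_div]
    have : 0 ≤ h ^ 2 / p.th2 / s := by positivity
    linarith
  set E := Real.exp (-(p.th2 * p.Gam * s))
  have hGs : |-(p.th2 * p.Gam * s)| = G * s := by rw [abs_neg, abs_mul, abs_of_pos hs]
  have hGs1 : G * s ≤ G := mul_le_of_le_one_right (abs_nonneg _) hs1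
  have hE0 : 0 < E := Real.exp_pos _
  have hE : E ≤ Real.exp G := Real.exp_le_exp.2 ((le_abs_self _).trans (hGs.le.trans hGs1))
  have hE1 : |E - 1| ≤ G * Real.exp G * s := by
    refine (abs_exp_sub_one_le_mul_exp _).trans ?_
    rw [hGs]
    have := Real.exp_le_exp.2 hGs1
    have hG0 : 0 ≤ G * s := mul_nonneg (abs_nonneg _) hs.le
    exact (mul_le_mul_of_nonneg_left this hG0).trans (le_of_eq (by ring))
  have hkh : (κ * h) ^ 2 ≤ κ ^ 2 := by
    rw [mul_pow]
    have : h ^ 2 ≤ 1 := by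
      rw [← sq_abs]
      exact pow_le_one₀ hh0 (by linarith)
    exact mul_le_of_le_one_right (sq_nonneg _) this
  have hcosh := Real.cosh_le_exp_half_sq (κ * h)
  rw [Real.cosh_eq] at hcosh
  have x1 := Real.exp_pos (κ * h)
  have x2 := Real.exp_pos (-(κ * h))
  set ep := Real.exp (κ * h) with hep
  set em := Real.exp (-(κ * h)) with hem
  have hc1 : 1 ≤ (ep + em) / 2 := by
    have := Real.one_le_cosh (κ * h)
    rwa [Real.cosh_eq] at this
  have hexp2 : Real.exp ((κ * h) ^ 2 / 2) ≤ Cc := Real.exp_le_exp.2 (by linarith)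
  have hc2 : (ep + em) / 2 ≤ Cc := hcosh.trans hexp2
  have hc3 : (ep + em) / 2 - 1 ≤ K1 * h ^ 2 := by
    have := (le_abs_self _).trans (abs_exp_sub_one_le_mul_exp ((κ * h) ^ 2 / 2))
    rw [abs_of_nonneg (by positivity : (0 : ℝ) ≤ (κ * h) ^ 2 / 2)] at this
    have h3 : (κ * h) ^ 2 / 2 * Real.exp ((κ * h) ^ 2 / 2) ≤ (κ * h) ^ 2 / 2 * Cc :=
      mul_le_mul_of_nonneg_left hexp2 (by positivity)
    have h4 : (κ * h) ^ 2 / 2 * Cc = K1 * h ^ 2 := by simp only [K1]; ring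
    linarith
  set O := 2 * a / b ^ 2 * I with hO
  have hO0 : 0 ≤ O := by positivity
  set A := 8 * a * I with hA
  have hA0 : 0 ≤ A := by positivity
  set S := ((ep + em) * gaussSum a 0 - 2 * gaussSum a h + 2 * gaussSum a z
      - em * gaussSum a (z + h) - ep * gaussSum a (z - h)) / 2 with hS
  have hK2s : (Cc + 1) * A + (1 + Cc) * O = K2 * s := by simp only [K2, hA, hO, ha]; ring
  have hSb : |S - (1 - e)| ≤ (K1 + K2) * (h ^ 2 + s) := by
    have m1 : em * gaussSum a (z + h) ≤ em * O := mul_le_mul_of_nonneg_left gp.2 x2.le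
    have m2 : ep * gaussSum a (z - h) ≤ ep * O := mul_le_mul_of_nonneg_left gm.2 x1.le
    have m3 : 0 ≤ em * gaussSum a (z + h) := mul_nonneg x2.le gp.1
    have m4 : 0 ≤ ep * gaussSum a (z - h) := mul_nonneg x1.le gm.1
    have m5 : (ep + em) / 2 * (gaussSum a 0 - 1) ≤ Cc * A :=
      mul_le_mul hc2 g0.2 g0.1 (by positivity)
    have m6 : 0 ≤ (ep + em) / 2 * (gaussSum a 0 - 1) := mul_nonneg (by linarith) g0.1
    have m7 : (ep + em) / 2 * O ≤ Cc * O := mul_le_mul_of_nonneg_right hc2 hO0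
    have m8 : 0 ≤ K1 * s := by positivity
    have m9 : 0 ≤ K2 * h ^ 2 := by positivity
    have eq : S - (1 - e) = ((ep + em) / 2 - 1) + (ep + em) / 2 * (gaussSum a 0 - 1)
        - (gaussSum a h - e) + gaussSum a z
        - (em * gaussSum a (z + h) + ep * gaussSum a (z - h)) / 2 := by rw [hS]; ring
    have hk2' : K2 * s = Cc * A + A + O + Cc * O := by rw [← hK2s]; ring
    have hcA : 0 ≤ Cc * A := by positivity
    have hcO : 0 ≤ Cc * O := by positivity
    have hk1' : 0 ≤ K1 * h ^ 2 := by positivity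
    have ex : (K1 + K2) * (h ^ 2 + s) = K1 * h ^ 2 + K1 * s + K2 * h ^ 2 + K2 * s := by ring
    rw [eq, ex, abs_le]
    constructor <;> linarith [g0.1, gh.1, gz.1, gh.2, gz.2]
  have hq : 1 / Real.sqrt a = Q * (1 / Real.sqrt s) := by
    rw [ha, Real.sqrt_mul (by positivity), one_div_mul_one_div]
  rw [hq]
  have hqs : 0 < 1 / Real.sqrt s := by positivity
  have hmain : |E * S - (1 - e)| ≤ (Real.exp G * (K1 + K2) + G * Real.exp G + 1) * (h ^ 2 + s) := by
    have : E * S - (1 - e) = E * (S - (1 - e)) + (E - 1) * (1 - e) := by ring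
    rw [this]
    refine (abs_add_le _ _).trans ?_
    rw [abs_mul, abs_mul, abs_of_pos hE0, abs_of_nonneg (by linarith : 0 ≤ 1 - e)]
    have b1 : E * |S - (1 - e)| ≤ Real.exp G * ((K1 + K2) * (h ^ 2 + s)) :=
      mul_le_mul hE hSb (abs_nonneg _) (Real.exp_pos _).le
    have b2 : |E - 1| * (1 - e) ≤ |E - 1| := mul_le_of_le_one_right (abs_nonneg _) (by linarith)
    have b3 : 0 ≤ G * Real.exp G * h ^ 2 := by positivity
    have b4 : 0 ≤ h ^ 2 := sq_nonneg _
    have b5 : (Real.exp G * (K1 + K2) + G * Real.exp G + 1) * (h ^ 2 + s)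
      = Real.exp G * ((K1 + K2) * (h ^ 2 + s)) + G * Real.exp G * h ^ 2 + G * Real.exp G * s
        + h ^ 2 + s := by ring
    linarith
  have hfin : E * (Q * (1 / Real.sqrt s)) * S - Q * (1 / Real.sqrt s) * (1 - e)
      = Q * (1 / Real.sqrt s) * (E * S - (1 - e)) := by ring
  rw [hfin, abs_mul, abs_of_pos (mul_pos hQ hqs)]
  refine (mul_le_mul_of_nonneg_left hmain (mul_pos hQ hqs).le).trans (le_of_eq ?_)
  ring

/-- The variance of a double increment, to leading order. -/
lemma exists_incKernel_diag_approx (hp : p.Admissible) {b : ℝ} (hb : 0 < b) (hb' : b < 1 / 2) :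
    ∃ C, 0 < C ∧ ∀ (τ : ℝ) (M V w i k : ℕ), 0 < τ → 0 < V → (V : ℝ) * τ ≤ 1 → 0 < M → 0 < w →
      k + w ≤ M →
      |incKernel p τ b M V w (i, k) (i, k)
        - p.sigmaSq * Real.exp (-p.kappa * ((gridX b M k + gridX b M (k + w)) / 2)) *
          (Real.sqrt (V * τ) * psi p.th2 (w * meshX b M / Real.sqrt (V * τ)))|
        ≤ C * ((w * meshX b M) ^ 2 + V * τ) * Real.sqrt (V * τ) := by
  obtain ⟨C, hC, hbd⟩ := exists_thetaDensity_bound hp hb hb'.le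
  have hσ := hp.1
  refine ⟨p.sigmaSq * Real.exp |p.kappa| * (C * 2), by positivity, ?_⟩
  intro τ M V w i k hτ hV hD1 hM hw hk
  set D := (V : ℝ) * τ with hD
  have hD0 : 0 < D := by positivity
  set d := (w : ℝ) * meshX b M with hd
  have hM' : (0 : ℝ) < M := by exact_mod_cast hM
  have hmesh : 0 < meshX b M := div_pos (by linarith) hM'
  have hd0 : 0 < d := by positivity
  have hMm : (M : ℝ) * meshX b M = 1 - 2 * b := by rw [meshX]; field_simp
  have hkd : (k : ℝ) * meshX b M + d ≤ 1 - 2 * b := by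
    rw [← hMm, hd, ← add_mul]
    exact mul_le_mul_of_nonneg_right (by exact_mod_cast hk) hmesh.le
  have hk0 : 0 ≤ (k : ℝ) * meshX b M := by positivity
  have hg2 : gridX b M (k + w) = gridX b M k + d := by
    simp only [gridX, hd]; push_cast; ring
  have hg1 : gridX b M k = b + k * meshX b M := rfl
  set z := (gridX b M k + gridX b M (k + w)) / 2 with hz
  have hz' : z = gridX b M k + d / 2 := by rw [hz, hg2]; ring
  have hh : |d / 2| = d / 2 := abs_of_pos (by positivity)
  obtain ⟨hmeas, hker⟩ := incKernel_diag_eq (V := V) hp hτ.le i k (z := z) (h := d / 2)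
    (by rw [hz', hg2]; ring) (by rw [hz']; ring) (by rw [hh]; linarith)
  rw [hker, ← integral_mainDensity hp.2.1 hd0 hD0, ← mul_sub]
  have hmi := integrableOn_mainDensity hp.2.1 (d / 2) D
  have hbI : IntegrableOn (fun s => C * ((d / 2) ^ 2 + D) * (1 / Real.sqrt s)) (Set.Ioc 0 D) :=
    (integrableOn_one_div_sqrt D).const_mul _
  have hpt : ∀ s ∈ Set.Ioc 0 D, |thetaDensity p z (d / 2) s - mainDensity p.th2 (d / 2) s|
      ≤ C * ((d / 2) ^ 2 + D) * (1 / Real.sqrt s) := by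
    intro s hs
    refine (hbd z (d / 2) s hs.1 (hs.2.trans hD1) (by rw [hh]; linarith)
      (by rw [hh, hz']; linarith) (by rw [hh, hz']; linarith)).trans ?_
    have := hs.2
    gcongr
  have hdiff : IntegrableOn (fun s => thetaDensity p z (d / 2) s - mainDensity p.th2 (d / 2) s)
      (Set.Ioc 0 D) := by
    refine Integrable.mono' hbI (hmeas.sub hmi.aestronglyMeasurable) ?_
    filter_upwards [ae_restrict_mem measurableSet_Ioc] with s hs
    exact hpt s hs
  have hti : IntegrableOn (thetaDensity p z (d / 2)) (Set.Ioc 0 D) := by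
    have h1 : IntegrableOn (fun s => (thetaDensity p z (d / 2) s - mainDensity p.th2 (d / 2) s)
      + mainDensity p.th2 (d / 2) s) (Set.Ioc 0 D) := hdiff.add hmi
    simpa using h1
  rw [← integral_sub hti hmi]
  have hintegrable : |∫ s in Set.Ioc 0 D, (thetaDensity p z (d / 2) s - mainDensity p.th2 (d / 2) s)|
      ≤ C * ((d / 2) ^ 2 + D) * (2 * Real.sqrt D) := by
    rw [← integral_one_div_sqrt hD0, ← integral_const_mul]
    refine norm_integral_le_of_norm_le (f := fun s => thetaDensity p z (d / 2) s -
      mainDensity p.th2 (d / 2) s) hbI ?_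
    filter_upwards [ae_restrict_mem measurableSet_Ioc] with s hs
    exact hpt s hs
  rw [abs_mul, abs_of_pos (by positivity : 0 < p.sigmaSq * Real.exp (-p.kappa * z))]
  have hez : Real.exp (-p.kappa * z) ≤ Real.exp |p.kappa| := by
    refine Real.exp_le_exp.2 ((le_abs_self _).trans ?_)
    rw [abs_mul, abs_neg]
    refine mul_le_of_le_one_right (abs_nonneg _) ?_
    rw [abs_le, hz', hg1]
    constructor <;> linarith
  calc _ ≤ p.sigmaSq * Real.exp |p.kappa| * (C * ((d / 2) ^ 2 + D) * (2 * Real.sqrt D)) := by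
        gcongr
    _ ≤ p.sigmaSq * Real.exp |p.kappa| * (C * (d ^ 2 + D) * (2 * Real.sqrt D)) := by
        have : (d / 2) ^ 2 ≤ d ^ 2 := by nlinarith
        gcongr
    _ = _ := by ring

end BiasBound

section SecondMoment

variable {Ω : Type*} [MeasurableSpace Ω] {P : Measure Ω} [IsProbabilityMeasure P]
  {p : Coeffs} {β : ℕ → ℝ≥0 → Ω → ℝ} {u : ℕ → ℝ → Ω → ℝ} {X : ℝ → ℝ → Ω → ℝ}

/-- The deviation of the rescaled quadratic variation at the `k`-th spatial position from `f`. -/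
def cellError (b T : ℝ) (M N V w : ℕ) (x : ℝ → ℝ → ℝ) (f : ℝ → ℝ) (k : ℕ) : ℝ :=
  1 / (((N : ℝ) - V + 1) * Real.sqrt (V * meshT T N)) *
      (∑ i ∈ Finset.range (N + 1 - V), doubleInc b T M N x V w i k ^ 2)
    - f ((gridX b M k + gridX b M (k + w)) / 2)

lemma contrastPart_eq (b T : ℝ) (M N v w : ℕ) (x : ℝ → ℝ → ℝ) (ν : ℕ)
    (h : EuclideanSpace ℝ (Fin 3)) :
    contrastPart b T M N v w x ν h = 1 / ((M : ℝ) - w + 1) * ∑ k ∈ Finset.range (M + 1 - w),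
      cellError b T M N (ν * v) w x (regr (ratio b T M N v w) ν h) k ^ 2 := by
  simp only [contrastPart, cellError]
  push_cast
  rfl

lemma gridX_mem_Icc {b : ℝ} (hb : 0 ≤ b) (hb' : b < 1 / 2) {M k : ℕ} (hk : k ≤ M) :
    gridX b M k ∈ Set.Icc (0 : ℝ) 1 := by
  have hk' : (k : ℝ) ≤ M := by exact_mod_cast hk
  have h1 : (k : ℝ) * meshX b M ≤ 1 - 2 * b := by
    rw [meshX]
    rcases Nat.eq_zero_or_pos M with h | h
    · subst h
      simp
      linarith
    · have hM : (0 : ℝ) < M := by exact_mod_cast h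
      rw [mul_div_assoc', div_le_iff₀ hM, mul_comm]
      exact mul_le_mul_of_nonneg_left hk' (by linarith)
  have h2 : 0 ≤ (k : ℝ) * meshX b M :=
    mul_nonneg (by positivity) (div_nonneg (by linarith) (by positivity))
  rw [gridX]
  constructor <;> linarith

/-- Second moments of the partial sums of the errors. -/
lemma IsStationarySolution.exists_second_moment_bound (hp : p.Admissible)
    (hX : IsStationarySolution P p β u X) {b T : ℝ} (hb : 0 < b) (hb' : b < 1 / 2) (hT : 0 < T) :
    ∃ C, 0 < C ∧ ∀ M N V w m : ℕ, 0 < V → 0 < w → 2 * w ≤ M → 2 * V ≤ N → V * meshT T N ≤ 1 →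
      m ≤ M + 1 - w → ∀ f : ℝ → ℝ, (∀ z, f z = p.sigmaSq *
        psi p.th2 (w * meshX b M / Real.sqrt (V * meshT T N)) * Real.exp (-p.kappa * z)) →
      Integrable (fun ω => (1 / ((M : ℝ) - w + 1) * ∑ k ∈ Finset.range m,
        cellError b T M N V w (fun t x => X t x ω) f k) ^ 2) P ∧
      ∫ ω, (1 / ((M : ℝ) - w + 1) * ∑ k ∈ Finset.range m,
        cellError b T M N V w (fun t x => X t x ω) f k) ^ 2 ∂P
        ≤ C * ((w * meshX b M) ^ 3 + ((w * meshX b M) ^ 2 + V * meshT T N) ^ 2) := by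
  obtain ⟨C, hC, hbias⟩ := exists_incKernel_diag_approx hp hb hb'
  have hK := opConst_pos hp
  set K := opConst p
  have hb2 : 0 < 1 - 2 * b := by linarith
  refine ⟨8 * K ^ 2 / (T * (1 - 2 * b)) + C ^ 2, by positivity, ?_⟩
  intro M N V w m hV hw hwM hVN hD1 hm f hf
  have hM : 0 < M := by omega
  have hN : 0 < N := by omega
  have hMr : (0 : ℝ) < M := by exact_mod_cast hM
  have hNr : (0 : ℝ) < N := by exact_mod_cast hN
  have hτ : 0 < meshT T N := div_pos hT hNr
  set τ := meshT T N with hτd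
  have hNτ : N * τ = T := by rw [hτd, meshT]; field_simp
  have hδ : 0 < meshX b M := div_pos hb2 hMr
  set δ := meshX b M with hδd
  have hMδ : M * δ = 1 - 2 * b := by rw [hδd, meshX]; field_simp
  set D := (V : ℝ) * τ with hD
  set d := (w : ℝ) * δ with hd
  have hVr : (0 : ℝ) < V := by exact_mod_cast hV
  have hwr : (0 : ℝ) < w := by exact_mod_cast hw
  have hD0 : 0 < D := by positivity
  have hd0 : 0 < d := by positivity
  set q := Real.sqrt D with hq
  have hq0 : 0 < q := Real.sqrt_pos.2 hD0
  have hqq : q ^ 2 = D := Real.sq_sqrt hD0.le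
  set nt := N + 1 - V with hnt
  have hntr : (nt : ℝ) = (N : ℝ) - V + 1 := by
    rw [hnt, Nat.cast_sub (by omega)]; push_cast; ring
  have hnr : ((M + 1 - w : ℕ) : ℝ) = (M : ℝ) - w + 1 := by
    rw [Nat.cast_sub (by omega)]; push_cast; ring
  set n : ℝ := (M : ℝ) - w + 1 with hn
  have hwM' : 2 * (w : ℝ) ≤ M := by exact_mod_cast hwM
  have hVN' : 2 * (V : ℝ) ≤ N := by exact_mod_cast hVN
  have hn2 : (M : ℝ) ≤ 2 * n := by rw [hn]; linarith
  have hnt2 : (N : ℝ) ≤ 2 * nt := by rw [hntr]; linarith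
  have hn0 : 0 < n := by linarith
  have hnt0 : (0 : ℝ) < nt := by linarith
  have hmn : (m : ℝ) ≤ n := by rw [← hnr]; exact_mod_cast hm
  have hgrid : ∀ k < m, gridX b M k ∈ Set.Icc (0 : ℝ) 1 ∧ gridX b M (k + w) ∈ Set.Icc (0 : ℝ) 1 :=
    fun k hk => ⟨gridX_mem_Icc hb.le hb' (by omega), gridX_mem_Icc hb.le hb' (by omega)⟩
  set s := Finset.range nt ×ˢ Finset.range m with hs
  have hmem : ∀ a ∈ s, a.2 < m := fun a ha => Finset.mem_range.1 (Finset.mem_product.1 ha).2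
  have hG := hX.gaussFamily_doubleInc hp (b := b) (M := M) (V := V) (w := w) hτ s
    (fun a ha => hgrid a.2 (hmem a ha))
  set κf : ℕ → ℝ := fun k => f ((gridX b M k + gridX b M (k + w)) / 2) with hκf
  set m0 : ℝ := ∑ a ∈ s, q * κf a.2 with hm0
  obtain ⟨hintegrable, hval⟩ := hG.integral_sum_sq_sub (incKernel_comm p τ b M V w) m0
  have hrew : ∀ ω, (1 / n * ∑ k ∈ Finset.range m,
      cellError b T M N V w (fun t x => X t x ω) f k) ^ 2
      = 1 / (n * (nt * q)) ^ 2 *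
        (∑ a ∈ s, doubleInc b T M N (fun t x => X t x ω) V w a.1 a.2 ^ 2 - m0) ^ 2 := by
    intro ω
    rw [← one_div_pow, ← mul_pow]
    congr 1
    rw [hs, hm0, hs, Finset.sum_product_right, Finset.sum_product_right, ← Finset.sum_sub_distrib,
      ← one_div_mul_one_div, mul_assoc]
    congr 1
    rw [Finset.mul_sum]
    refine Finset.sum_congr rfl fun k _ => ?_
    rw [cellError, ← hntr, ← hτd, ← hD, ← hq, mul_sub]
    congr 1
    change κf k = 1 / (nt * q) * ∑ x ∈ Finset.range nt, q * κf k
    rw [Finset.sum_const, Finset.card_range, nsmul_eq_mul]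
    field_simp
  simp_rw [hrew]
  refine ⟨hintegrable.const_mul _, ?_⟩
  rw [integral_const_mul, hval]
  have hcard : (s.card : ℝ) = nt * m := by
    rw [hs, Finset.card_product, Finset.card_range, Finset.card_range]; push_cast; ring
  have hdiag : ∀ a ∈ s, incKernel p τ b M V w a a ≤ K * d := fun a ha =>
    incKernel_diag_le hp hτ.le hb.le hb' a.1 hM (by have := hmem a ha; omega)
  set Λ := K * V * (w * d) with hΛ
  have hΛ0 : 0 < Λ := by positivity
  have hvar : ∑ a ∈ s, ∑ a' ∈ s, incKernel p τ b M V w a a' ^ 2 ≤ nt * m * (Λ * (K * d)) := by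
    rw [← hcard, ← nsmul_eq_mul]
    refine Finset.sum_le_card_nsmul _ _ _ fun a ha => ?_
    refine (hG.sum_sq_le (incKernel_comm p τ b M V w) hΛ0 (fun c => ?_) ha).trans
      (mul_le_mul_of_nonneg_left (hdiag a ha) hΛ0.le)
    exact incKernel_form_le hp hτ.le hb.le hb' hM (by omega) hgrid c
  have hb3 : |∑ a ∈ s, incKernel p τ b M V w a a - m0| ≤ nt * m * (C * (d ^ 2 + D) * q) := by
    rw [hm0, ← Finset.sum_sub_distrib, ← hcard, ← nsmul_eq_mul]
    refine (Finset.abs_sum_le_sum_abs _ _).trans (Finset.sum_le_card_nsmul _ _ _ fun a ha => ?_)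
    have := hbias τ M V w a.1 a.2 hτ hV hD1 hM hw (by have := hmem a ha; omega)
    refine le_of_eq_of_le ?_ this
    congr 2
    simp only [hκf]
    rw [hf]
    ring
  have hb4 : (∑ a ∈ s, incKernel p τ b M V w a a - m0) ^ 2 ≤ (nt * m * (C * (d ^ 2 + D) * q)) ^ 2 :=
    sq_le_sq' (abs_le.1 hb3).1 (abs_le.1 hb3).2
  have hm0' : (0 : ℝ) ≤ m := by positivity
  have ew : (w : ℝ) ≤ 2 * n * d / (1 - 2 * b) := by
    rw [le_div_iff₀ hb2, ← hMδ, hd]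
    have : (w : ℝ) * δ * M ≤ w * δ * (2 * n) := mul_le_mul_of_nonneg_left hn2 (by positivity)
    linarith
  have eV : (V : ℝ) ≤ 2 * nt * D / T := by
    rw [le_div_iff₀ hT, ← hNτ, hD]
    have : (V : ℝ) * τ * N ≤ V * τ * (2 * nt) := mul_le_mul_of_nonneg_left hnt2 (by positivity)
    linarith
  calc _ ≤ 1 / (n * (nt * q)) ^ 2 * (2 * (nt * m * (Λ * (K * d)))
          + (nt * m * (C * (d ^ 2 + D) * q)) ^ 2) := by gcongr
    _ ≤ 1 / (n * (nt * q)) ^ 2 * (2 * (nt * n * (K * (2 * nt * D / T) *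
          ((2 * n * d / (1 - 2 * b)) * d) * (K * d))) + (nt * n * (C * (d ^ 2 + D) * q)) ^ 2) := by
        rw [hΛ]; gcongr
    _ = 8 * K ^ 2 / (T * (1 - 2 * b)) * d ^ 3 + C ^ 2 * (d ^ 2 + D) ^ 2 := by
        rw [← hqq]; field_simp; ring
    _ ≤ _ := by
        have h1 : 0 ≤ 8 * K ^ 2 / (T * (1 - 2 * b)) * (d ^ 2 + D) ^ 2 := by positivity
        have h2 : 0 ≤ C ^ 2 * d ^ 3 := by positivity
        linarith

end SecondMoment

section Identification

lemma contDiff_gfun : ContDiff ℝ 1 gfun := by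
  rw [contDiff_one_iff_deriv]
  refine ⟨fun s => (hasDerivAt_gfun s).differentiableAt, ?_⟩
  rw [funext fun s => (hasDerivAt_gfun s).deriv]
  exact continuous_tailQ.comp (by fun_prop)

lemma exists_log_psi_lipschitz {r A : ℝ} (hr : 0 < r) (hA : 0 < A) (B : ℝ) :
    ∃ C > 0, ∀ x ∈ Set.Icc A B, ∀ y ∈ Set.Icc A B,
      |Real.log (psi x r) - Real.log (psi y r)| ≤ C * |x - y| := by
  have hF : ContDiffOn ℝ 1 (fun th => Real.log (2 / Real.sqrt (Real.pi * th))
      + Real.log (gfun (r / Real.sqrt th))) (Set.Icc A B) := by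
    intro x hx
    have hx0 : 0 < x := hA.trans_le hx.1
    have hpx : 0 < Real.pi * x := mul_pos Real.pi_pos hx0
    have h1 : ContDiffAt ℝ 1 (fun th => 2 / Real.sqrt (Real.pi * th)) x :=
      contDiffAt_const.div ((contDiffAt_const.mul contDiffAt_id).sqrt hpx.ne')
        (Real.sqrt_pos.2 hpx).ne'
    have h2 : ContDiffAt ℝ 1 (fun th => r / Real.sqrt th) x :=
      contDiffAt_const.div (contDiffAt_id.sqrt hx0.ne') (Real.sqrt_pos.2 hx0).ne'
    have h3 : ContDiffAt ℝ 1 (fun th => gfun (r / Real.sqrt th)) x :=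
      contDiff_gfun.contDiffAt.comp x h2
    exact ((h1.log (by positivity)).add
      (h3.log (gfun_pos (div_pos hr (Real.sqrt_pos.2 hx0))).ne')).contDiffWithinAt
  obtain ⟨K, hK⟩ := hF.exists_lipschitzOnWith one_ne_zero (convex_Icc A B) isCompact_Icc
  refine ⟨K + 1, by positivity, fun x hx y hy => ?_⟩
  have := hK.dist_le_mul x hx y hy
  rw [Real.dist_eq, Real.dist_eq, ← log_psi (hA.trans_le hx.1) hr,
    ← log_psi (hA.trans_le hy.1) hr] at this
  linarith [abs_nonneg (x - y)]

/-- The level `σ² ψ_ϑ(r/√ν)` of the regression function. -/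
def level (r : ℝ) (ν : ℕ) (h : EuclideanSpace ℝ (Fin 3)) : ℝ :=
  h 0 * psi (h 1) (r / Real.sqrt ν)

lemma level_pos {r : ℝ} (hr : 0 < r) {ν : ℕ} (hν : 0 < ν) {h : EuclideanSpace ℝ (Fin 3)}
    (h0 : 0 < h 0) (h1 : 0 < h 1) : 0 < level r ν h := by
  have : (0 : ℝ) < ν := by exact_mod_cast hν
  exact mul_pos h0 (psi_pos h1 (by positivity))

/-- The distance of `h` to `e` in the coordinates in which the regression functions are affine,
up to the exponential function. -/
def logDist (r : ℝ) (h e : EuclideanSpace ℝ (Fin 3)) : ℝ :=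
  |Real.log (level r 1 h) - Real.log (level r 1 e)|
    + |Real.log (level r 2 h) - Real.log (level r 2 e)| + |h 2 - e 2|

lemma exists_bounds_of_isCompact {H : Set (EuclideanSpace ℝ (Fin 3))} (hH : IsCompact H)
    (hne : H.Nonempty) (hHpos : ∀ h ∈ H, 0 < h 0 ∧ 0 < h 1) :
    ∃ A B : ℝ, 0 < A ∧ ∀ h ∈ H, h 0 ∈ Set.Icc A B ∧ h 1 ∈ Set.Icc A B := by
  have c : ∀ i : Fin 3, ContinuousOn (fun h : EuclideanSpace ℝ (Fin 3) => h i) H := fun i => by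
    fun_prop
  obtain ⟨x0, hx0, m0⟩ := hH.exists_isMinOn hne (c 0)
  obtain ⟨x1, hx1, m1⟩ := hH.exists_isMinOn hne (c 1)
  obtain ⟨y0, hy0, n0⟩ := hH.exists_isMaxOn hne (c 0)
  obtain ⟨y1, hy1, n1⟩ := hH.exists_isMaxOn hne (c 1)
  refine ⟨min (x0 0) (x1 1), max (y0 0) (y1 1), lt_min (hHpos x0 hx0).1 (hHpos x1 hx1).2,
    fun h hh => ⟨⟨(min_le_left _ _).trans (m0 hh), (n0 hh).trans (le_max_left _ _)⟩,
      ⟨(min_le_right _ _).trans (m1 hh), (n1 hh).trans (le_max_right _ _)⟩⟩⟩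

lemma abs_sub_le_mul_abs_log_sub {x y B : ℝ} (hx : 0 < x) (hy : 0 < y) (hxB : x ≤ B) (hyB : y ≤ B) :
    |x - y| ≤ B * |Real.log x - Real.log y| := by
  have key : ∀ x y : ℝ, 0 < x → 0 < y → x ≤ B → y ≤ x → |x - y| ≤ B * |Real.log x - Real.log y| := by
    intro x y hx hy hxB hyx
    have h1 := Real.log_le_sub_one_of_pos (div_pos hy hx)
    rw [Real.log_div hy.ne' hx.ne'] at h1
    have h2 : Real.log y ≤ Real.log x := Real.log_le_log hy hyx
    rw [abs_of_nonneg (by linarith), abs_of_nonneg (by linarith)]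
    have h3 : x * (Real.log y - Real.log x) ≤ x * (y / x - 1) := mul_le_mul_of_nonneg_left h1 hx.le
    have h4 : x * (y / x - 1) = y - x := by field_simp
    have h5 : x * (Real.log x - Real.log y) ≤ B * (Real.log x - Real.log y) :=
      mul_le_mul_of_nonneg_right hxB (by linarith)
    linarith
  rcases le_total y x with h | h
  · exact key x y hx hy hxB h
  · rw [abs_sub_comm, abs_sub_comm (Real.log x)]
    exact key y x hy hx hyB h

lemma exists_norm_sub_le_logDist {H : Set (EuclideanSpace ℝ (Fin 3))} (hH : IsCompact H)
    (hHpos : ∀ h ∈ H, 0 < h 0 ∧ 0 < h 1) {r : ℝ} (hr : 0 < r) :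
    ∃ C > 0, ∀ h ∈ H, ∀ e ∈ H, ‖h - e‖ ≤ C * logDist r h e := by
  rcases H.eq_empty_or_nonempty with hne | hne
  · exact ⟨1, one_pos, fun h hh => by rw [hne] at hh; exact absurd hh (Set.notMem_empty h)⟩
  obtain ⟨A, B, hA, hAB⟩ := exists_bounds_of_isCompact hH hne hHpos
  obtain ⟨C1, hC1, h1⟩ := exists_psi_ratio_lipschitz (B := B) hr hA
  obtain ⟨C2, hC2, h2⟩ := exists_log_psi_lipschitz hr hA B
  have hB : 0 < B := by
    obtain ⟨h, hh⟩ := hne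
    exact hA.trans_le ((hAB h hh).1.1.trans (hAB h hh).1.2)
  refine ⟨B * (1 + C2 * C1) + C1 + 1, by positivity, fun h hh e he => ?_⟩
  have hlog : ∀ x ∈ H, Real.log (level r 1 x) = Real.log (x 0) + Real.log (psi (x 1) r) ∧
      Real.log (level r 2 x) = Real.log (x 0) + Real.log (psi (x 1) (r / Real.sqrt 2)) := by
    intro x hx
    obtain ⟨p0, p1⟩ := hHpos x hx
    constructor
    · rw [level, Nat.cast_one, Real.sqrt_one, div_one, Real.log_mul p0.ne' (psi_pos p1 hr).ne']
    · rw [level, Nat.cast_ofNat, Real.log_mul p0.ne' (psi_pos p1 (by positivity)).ne']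
  set Ξ := logDist r h e with hΞ
  set L1 := Real.log (level r 1 h) - Real.log (level r 1 e) with hL1
  set L2 := Real.log (level r 2 h) - Real.log (level r 2 e) with hL2
  have hΞe : Ξ = |L1| + |L2| + |h 2 - e 2| := rfl
  have n1 := abs_nonneg L1
  have n2 := abs_nonneg L2
  have n3 := abs_nonneg (h 2 - e 2)
  have b1 : |h 1 - e 1| ≤ C1 * Ξ := by
    refine (h1 _ (hAB h hh).2 _ (hAB e he).2).trans (mul_le_mul_of_nonneg_left ?_ hC1.le)
    have : (Real.log (psi (h 1) (r / Real.sqrt 2)) - Real.log (psi (h 1) r))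
        - (Real.log (psi (e 1) (r / Real.sqrt 2)) - Real.log (psi (e 1) r)) = L2 - L1 := by
      rw [hL1, hL2, (hlog h hh).1, (hlog h hh).2, (hlog e he).1, (hlog e he).2]; ring
    rw [this]
    linarith [abs_sub L2 L1]
  have b2 : |Real.log (h 0) - Real.log (e 0)| ≤ (1 + C2 * C1) * Ξ := by
    have e1 : Real.log (h 0) - Real.log (e 0)
        = L1 - (Real.log (psi (h 1) r) - Real.log (psi (e 1) r)) := by
      rw [hL1, (hlog h hh).1, (hlog e he).1]; ring
    rw [e1]
    have e2 := h2 _ (hAB h hh).2 _ (hAB e he).2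
    have e3 := mul_le_mul_of_nonneg_left b1 hC2.le
    have e4 := abs_sub L1 (Real.log (psi (h 1) r) - Real.log (psi (e 1) r))
    have e5 : (1 + C2 * C1) * Ξ = Ξ + C2 * (C1 * Ξ) := by ring
    linarith
  have b3 : |h 0 - e 0| ≤ B * ((1 + C2 * C1) * Ξ) :=
    (abs_sub_le_mul_abs_log_sub (hHpos h hh).1 (hHpos e he).1 (hAB h hh).1.2 (hAB e he).1.2).trans
      (mul_le_mul_of_nonneg_left b2 hB.le)
  have hnorm : ‖h - e‖ ≤ |h 0 - e 0| + |h 1 - e 1| + |h 2 - e 2| := by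
    rw [EuclideanSpace.norm_eq]
    refine Real.sqrt_le_iff.2 ⟨by positivity, ?_⟩
    rw [Fin.sum_univ_three]
    simp only [PiLp.sub_apply, Real.norm_eq_abs]
    have a0 := abs_nonneg (h 0 - e 0)
    have a1 := abs_nonneg (h 1 - e 1)
    nlinarith [mul_nonneg a0 a1, mul_nonneg a0 n3, mul_nonneg a1 n3]
  have : (B * (1 + C2 * C1) + C1 + 1) * Ξ = B * ((1 + C2 * C1) * Ξ) + C1 * Ξ + Ξ := by ring
  linarith

lemma exists_logDist_bound {H : Set (EuclideanSpace ℝ (Fin 3))} (hH : IsCompact H)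
    (hHpos : ∀ h ∈ H, 0 < h 0 ∧ 0 < h 1) {r : ℝ} (hr : 0 < r) (e : EuclideanSpace ℝ (Fin 3)) :
    ∃ B > 0, ∀ h ∈ H, logDist r h e ≤ B := by
  have hlev : ∀ ν : ℕ, 0 < ν → ContinuousOn (fun h => Real.log (level r ν h)) H := by
    intro ν hν
    refine ContinuousOn.log ?_ fun h hh => (level_pos hr hν (hHpos h hh).1 (hHpos h hh).2).ne'
    refine ContinuousOn.mul (by fun_prop) ?_
    exact (continuousOn_psi (r / Real.sqrt ν)).comp (by fun_prop) fun h hh => (hHpos h hh).2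
  have hcont : ContinuousOn (fun h => logDist r h e) H := by
    refine ContinuousOn.add (ContinuousOn.add ?_ ?_) ?_
    · exact ((hlev 1 one_pos).sub continuousOn_const).abs
    · exact ((hlev 2 two_pos).sub continuousOn_const).abs
    · fun_prop
  obtain ⟨B, hB⟩ := hH.exists_bound_of_continuousOn hcont
  exact ⟨max B 1, by positivity, fun h hh =>
    (le_abs_self _).trans ((hB h hh).trans (le_max_left _ _))⟩

end Identification

section Estimator

lemma abs_exp_sub_exp_le_mul {x y m : ℝ} (hx : x ≤ m) (hy : y ≤ m) :
    |Real.exp x - Real.exp y| ≤ Real.exp m * |x - y| := by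
  have key : ∀ x y : ℝ, x ≤ m → y ≤ x → |Real.exp x - Real.exp y| ≤ Real.exp m * |x - y| := by
    intro x y hx hxy
    have h1 := Real.add_one_le_exp (y - x)
    have h2 : Real.exp x * Real.exp (y - x) = Real.exp y := by
      rw [← Real.exp_add, add_sub_cancel]
    have h3 := mul_le_mul_of_nonneg_left h1 (Real.exp_pos x).le
    rw [h2] at h3
    rw [abs_of_nonneg (sub_nonneg.2 (Real.exp_le_exp.2 hxy)), abs_of_nonneg (sub_nonneg.2 hxy)]
    have h4 := mul_le_mul_of_nonneg_right (Real.exp_le_exp.2 hx) (sub_nonneg.2 hxy)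
    linarith
  rcases le_total y x with h | h
  · exact key x y hx h
  · rw [abs_sub_comm, abs_sub_comm x]
    exact key y x hy h

lemma exp_neg_mul_abs_le {x m : ℝ} (hx : |x| ≤ m) : Real.exp (-m) * |x| ≤ |Real.exp x - 1| := by
  have hm : 0 ≤ m := (abs_nonneg x).trans hx
  rcases le_total 0 x with h | h
  · have h1 := Real.add_one_le_exp x
    have h2 : Real.exp (-m) ≤ 1 := by rw [Real.exp_le_one_iff]; linarith
    rw [abs_of_nonneg h, abs_of_nonneg (by linarith)]
    have := mul_le_mul_of_nonneg_right h2 h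
    linarith
  · rw [abs_of_nonpos h] at hx ⊢
    have h1 := Real.add_one_le_exp (-x)
    have h2 : Real.exp x * Real.exp (-x) = 1 := by rw [← Real.exp_add, add_neg_cancel, Real.exp_zero]
    have h3 := mul_le_mul_of_nonneg_left h1 (Real.exp_pos x).le
    rw [h2] at h3
    have h4 : Real.exp (-m) ≤ Real.exp x := Real.exp_le_exp.2 (by linarith)
    have h5 := mul_le_mul_of_nonneg_right h4 (by linarith : 0 ≤ -x)
    have h6 := Real.exp_le_one_iff.2 h
    rw [abs_of_nonpos (by linarith)]
    linarith

/-- An affine function on an equidistant grid is controlled by its mean square. -/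
lemma affine_sq_le_sum {n : ℕ} (hn : 2 ≤ n) {z : ℕ → ℝ} {z0 δ ρ : ℝ} (hρ : 0 < ρ)
    (hz : ∀ k, z k = z0 + k * δ) (hz01 : ∀ k < n, |z k| ≤ 1) (hnδ : ρ ≤ n * δ) (L K : ℝ) :
    n * (L ^ 2 + K ^ 2) ≤ (2 + 162 / ρ ^ 2) * ∑ k ∈ Finset.range n, (L - K * z k) ^ 2 := by
  set S := ∑ k ∈ Finset.range n, (L - K * z k) ^ 2 with hS
  have hnr : (0 : ℝ) < n := by exact_mod_cast (by omega : 0 < n)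
  have hδ : 0 < δ := by
    by_contra h
    have := mul_nonpos_of_nonneg_of_nonpos hnr.le (not_lt.1 h)
    linarith
  set q := n / 2 with hq
  have hq3 : (n : ℝ) ≤ 3 * q := by exact_mod_cast (by omega : n ≤ 3 * q)
  have hqδ : ρ / 3 ≤ q * δ := by
    have := mul_le_mul_of_nonneg_right hq3 hδ.le
    linarith
  have h1 : (q : ℝ) * (K ^ 2 * ρ ^ 2 / 18) ≤ S := by
    have hsub : ∑ k ∈ Finset.range (q + q), (L - K * z k) ^ 2 ≤ S :=
      Finset.sum_le_sum_of_subset_of_nonneg (Finset.range_mono (by omega))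
        fun _ _ _ => sq_nonneg _
    rw [Finset.sum_range_add, ← Finset.sum_add_distrib] at hsub
    refine le_trans ?_ hsub
    have : (q : ℝ) * (K ^ 2 * ρ ^ 2 / 18) = ∑ _k ∈ Finset.range q, K ^ 2 * ρ ^ 2 / 18 := by simp
    rw [this]
    refine Finset.sum_le_sum fun k _ => ?_
    have e : z (q + k) = z k + q * δ := by rw [hz, hz]; push_cast; ring
    rw [e]
    have e2 : (L - K * z k) ^ 2 + (L - K * (z k + q * δ)) ^ 2
        = (K * (q * δ)) ^ 2 / 2 + (2 * (L - K * z k) - K * (q * δ)) ^ 2 / 2 := by ring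
    have e3 : (ρ / 3) ^ 2 ≤ (q * δ) ^ 2 := pow_le_pow_left₀ (by positivity) hqδ 2
    have e4 := mul_le_mul_of_nonneg_left e3 (sq_nonneg K)
    have e5 := sq_nonneg (2 * (L - K * z k) - K * (q * δ))
    rw [e2, mul_pow]
    linarith
  have h2 : (n : ℝ) * K ^ 2 ≤ 54 / ρ ^ 2 * S := by
    have : (n : ℝ) * (K ^ 2 * ρ ^ 2 / 18) ≤ 3 * S := by
      have := mul_le_mul_of_nonneg_right hq3 (by positivity : 0 ≤ K ^ 2 * ρ ^ 2 / 18)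
      linarith
    rw [div_mul_eq_mul_div, le_div_iff₀ (by positivity)]
    linarith
  have h3 : (n : ℝ) * L ^ 2 ≤ 2 * S + 2 * (n * K ^ 2) := by
    have : (n : ℝ) * L ^ 2 = ∑ _k ∈ Finset.range n, L ^ 2 := by simp
    have e2 : 2 * S + 2 * (n * K ^ 2)
        = ∑ k ∈ Finset.range n, (2 * (L - K * z k) ^ 2 + 2 * K ^ 2) := by
      rw [Finset.sum_add_distrib, ← Finset.mul_sum, Finset.sum_const, Finset.card_range,
        nsmul_eq_mul]
      ring
    rw [this, e2]
    refine Finset.sum_le_sum fun k hk => ?_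
    have hzk : z k ^ 2 ≤ 1 := by
      rw [← sq_abs]
      exact pow_le_one₀ (abs_nonneg _) (hz01 k (Finset.mem_range.1 hk))
    have := mul_le_mul_of_nonneg_left hzk (sq_nonneg K)
    nlinarith [sq_nonneg (L - 2 * (K * z k))]
  have : (2 + 162 / ρ ^ 2) * S = 2 * S + 3 * (54 / ρ ^ 2 * S) := by ring
  linarith

/-- A bound by summation by parts. -/
lemma abs_sum_mul_le {n : ℕ} (hn : 0 < n) {φ ε : ℕ → ℝ} {Φ : ℝ} (h1 : ∀ k < n, |φ k| ≤ Φ)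
    (h2 : ∀ k, k + 1 < n → |φ (k + 1) - φ k| ≤ Φ * (1 / n)) :
    |∑ k ∈ Finset.range n, φ k * ε k| ≤ Φ * (|∑ k ∈ Finset.range n, ε k|
      + 1 / n * ∑ j ∈ Finset.range n, |∑ k ∈ Finset.range (j + 1), ε k|) := by
  have hΦ : 0 ≤ Φ := (abs_nonneg _).trans (h1 0 hn)
  have hs := Finset.sum_range_by_parts φ ε n
  simp only [smul_eq_mul] at hs
  rw [hs, mul_add]
  refine (abs_sub _ _).trans (add_le_add ?_ ?_)
  · rw [abs_mul]
    exact mul_le_mul_of_nonneg_right (h1 _ (by omega)) (abs_nonneg _)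
  · rw [← mul_assoc, Finset.mul_sum]
    refine (Finset.abs_sum_le_sum_abs _ _).trans ?_
    calc _ ≤ ∑ j ∈ Finset.range (n - 1), Φ * (1 / n) * |∑ k ∈ Finset.range (j + 1), ε k| := by
          refine Finset.sum_le_sum fun j hj => ?_
          rw [abs_mul]
          refine mul_le_mul_of_nonneg_right (h2 j ?_) (abs_nonneg _)
          have := Finset.mem_range.1 hj
          omega
      _ ≤ _ := Finset.sum_le_sum_of_subset_of_nonneg (Finset.range_mono (by omega))
          fun _ _ _ => by positivity

/-- Comparison of two exponential regression functions in logarithmic coordinates. -/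
lemma exp_regression_bounds {a a' κ κ' B : ℝ} (ha : 0 < a) (ha' : 0 < a')
    (hB : |Real.log a' - Real.log a| + |κ' - κ| ≤ B) {z y : ℝ} (hz : |z| ≤ 1) (hy : |y| ≤ 1) :
    |a' * Real.exp (-κ' * z) - a * Real.exp (-κ * z)|
      ≤ a * Real.exp |κ| * Real.exp B * (|Real.log a' - Real.log a| + |κ' - κ|) ∧
    a * Real.exp (-|κ|) * Real.exp (-B) * |(Real.log a' - Real.log a) - (κ' - κ) * z|
      ≤ |a' * Real.exp (-κ' * z) - a * Real.exp (-κ * z)| ∧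
    |(a' * Real.exp (-κ' * z) - a * Real.exp (-κ * z))
      - (a' * Real.exp (-κ' * y) - a * Real.exp (-κ * y))|
      ≤ a * Real.exp |κ| * (|κ| + 1) * Real.exp B * (|Real.log a' - Real.log a| + |κ' - κ|) *
        |z - y| := by
  set L := Real.log a' - Real.log a with hL
  set K := κ' - κ with hK
  have hB0 : 0 ≤ B := by linarith [abs_nonneg L, abs_nonneg K]
  have hid : ∀ t, a' * Real.exp (-κ' * t) - a * Real.exp (-κ * t)
      = a * Real.exp (-κ * t) * (Real.exp (L - K * t) - 1) := by
    intro t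
    have e1 : Real.exp (-κ' * t) = Real.exp (-κ * t) * Real.exp (-(K * t)) := by
      rw [← Real.exp_add, hK]; congr 1; ring
    have e2 : Real.exp (L - K * t) = a' / a * Real.exp (-(K * t)) := by
      rw [sub_eq_add_neg, Real.exp_add, hL, Real.exp_sub, Real.exp_log ha', Real.exp_log ha]
    rw [e1, e2]
    field_simp
  have hx : ∀ t : ℝ, |t| ≤ 1 → |L - K * t| ≤ |L| + |K| := by
    intro t ht
    refine (abs_sub _ _).trans (add_le_add le_rfl ?_)
    rw [abs_mul]
    exact mul_le_of_le_one_right (abs_nonneg _) ht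
  have hk : ∀ t : ℝ, |t| ≤ 1 → |-κ * t| ≤ |κ| := by
    intro t ht
    rw [abs_mul, abs_neg]
    exact mul_le_of_le_one_right (abs_nonneg _) ht
  have hup : ∀ t : ℝ, |t| ≤ 1 → |Real.exp (L - K * t) - 1| ≤ Real.exp B * (|L| + |K|) := by
    intro t ht
    have := abs_exp_sub_exp_le_mul (x := L - K * t) (y := 0) (m := B)
      ((le_abs_self _).trans ((hx t ht).trans hB)) hB0
    rw [Real.exp_zero, sub_zero] at this
    exact this.trans (mul_le_mul_of_nonneg_left (hx t ht) (Real.exp_pos _).le)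
  have heu : ∀ t : ℝ, |t| ≤ 1 → Real.exp (-κ * t) ≤ Real.exp |κ| := fun t ht =>
    Real.exp_le_exp.2 ((le_abs_self _).trans (hk t ht))
  have hel : ∀ t : ℝ, |t| ≤ 1 → Real.exp (-|κ|) ≤ Real.exp (-κ * t) := fun t ht =>
    Real.exp_le_exp.2 (abs_le.1 (hk t ht)).1
  refine ⟨?_, ?_, ?_⟩
  · rw [hid, abs_mul, abs_of_pos (by positivity), mul_assoc (a * Real.exp |κ|)]
    exact mul_le_mul (mul_le_mul_of_nonneg_left (heu z hz) ha.le) (hup z hz) (abs_nonneg _)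
      (by positivity)
  · rw [hid, abs_mul, abs_of_pos (by positivity : 0 < a * Real.exp (-κ * z)),
      mul_assoc (a * Real.exp (-|κ|))]
    exact mul_le_mul (mul_le_mul_of_nonneg_left (hel z hz) ha.le)
      (exp_neg_mul_abs_le ((hx z hz).trans hB)) (by positivity) (by positivity)
  · rw [hid, hid]
    have e : a * Real.exp (-κ * z) * (Real.exp (L - K * z) - 1)
        - a * Real.exp (-κ * y) * (Real.exp (L - K * y) - 1)
        = a * ((Real.exp (-κ * z) - Real.exp (-κ * y)) * (Real.exp (L - K * z) - 1)
          + Real.exp (-κ * y) * (Real.exp (L - K * z) - Real.exp (L - K * y))) := by ring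
    rw [e, abs_mul, abs_of_pos ha]
    have d1 : |Real.exp (-κ * z) - Real.exp (-κ * y)| ≤ Real.exp |κ| * (|κ| * |z - y|) := by
      refine (abs_exp_sub_exp_le_mul ((le_abs_self _).trans (hk z hz))
        ((le_abs_self _).trans (hk y hy))).trans (le_of_eq ?_)
      rw [← mul_sub, abs_mul, abs_neg]
    have d2 : |Real.exp (L - K * z) - Real.exp (L - K * y)|
        ≤ Real.exp B * ((|L| + |K|) * |z - y|) := by
      refine (abs_exp_sub_exp_le_mul ((le_abs_self _).trans ((hx z hz).trans hB))
        ((le_abs_self _).trans ((hx y hy).trans hB))).trans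
        (mul_le_mul_of_nonneg_left ?_ (Real.exp_pos _).le)
      rw [show L - K * z - (L - K * y) = K * (y - z) by ring, abs_mul, abs_sub_comm y z]
      exact mul_le_mul_of_nonneg_right (by linarith [abs_nonneg L]) (abs_nonneg _)
    calc _ ≤ a * (Real.exp |κ| * (|κ| * |z - y|) * (Real.exp B * (|L| + |K|))
          + Real.exp |κ| * (Real.exp B * ((|L| + |K|) * |z - y|))) := by
          refine mul_le_mul_of_nonneg_left ((abs_add_le _ _).trans (add_le_add ?_ ?_)) ha.le
          · rw [abs_mul]
            exact mul_le_mul d1 (hup z hz) (abs_nonneg _) (by positivity)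
          · rw [abs_mul, abs_of_pos (Real.exp_pos _)]
            exact mul_le_mul (heu y hy) d2 (abs_nonneg _) (by positivity)
      _ = _ := by ring

/-- Normalised partial sum of the errors. -/
def partialError (b T : ℝ) (M N V w : ℕ) (x : ℝ → ℝ → ℝ) (f : ℝ → ℝ) (m : ℕ) : ℝ :=
  1 / ((M : ℝ) - w + 1) * ∑ k ∈ Finset.range m, cellError b T M N V w x f k

/-- The statistic that controls the least squares estimator. -/
def errorSize (b T : ℝ) (M N V w : ℕ) (x : ℝ → ℝ → ℝ) (f : ℝ → ℝ) : ℝ :=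
  |partialError b T M N V w x f (M + 1 - w)| + 1 / ((M : ℝ) - w + 1) *
    ∑ j ∈ Finset.range (M + 1 - w), |partialError b T M N V w x f (j + 1)|

/-- One of the two contrasts: size of the difference of the regression functions, and correlation
of that difference with the errors. -/
lemma exists_contrast_bounds {b : ℝ} (hb : 0 < b) (hb' : b < 1 / 2) {a κ B : ℝ} (ha : 0 < a) :
    ∃ c C : ℝ, 0 < c ∧ 0 < C ∧ ∀ (T a' κ' : ℝ) (M N V w : ℕ) (x : ℝ → ℝ → ℝ), 0 < a' →
      |Real.log a' - Real.log a| + |κ' - κ| ≤ B → 0 < w → 2 * w ≤ M →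
      c * ((Real.log a' - Real.log a) ^ 2 + (κ' - κ) ^ 2) -
        C * (|Real.log a' - Real.log a| + |κ' - κ|) *
          errorSize b T M N V w x (fun z => a * Real.exp (-κ * z))
      ≤ 1 / ((M : ℝ) - w + 1) * ∑ k ∈ Finset.range (M + 1 - w),
          cellError b T M N V w x (fun z => a' * Real.exp (-κ' * z)) k ^ 2
        - 1 / ((M : ℝ) - w + 1) * ∑ k ∈ Finset.range (M + 1 - w),
          cellError b T M N V w x (fun z => a * Real.exp (-κ * z)) k ^ 2 := by
  set ρ := (1 - 2 * b) / 2 with hρ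
  have hρ0 : 0 < ρ := by rw [hρ]; linarith
  set m := a * Real.exp (-|κ|) * Real.exp (-B) with hm
  have hm0 : 0 < m := by positivity
  set C := a * Real.exp |κ| * (|κ| + 1) * Real.exp B with hC
  have hC0 : 0 < C := by positivity
  refine ⟨m ^ 2 / (2 + 162 / ρ ^ 2), 2 * C, by positivity, by positivity, ?_⟩
  intro T a' κ' M N V w x ha' hB hw hwM
  have hMr : (0 : ℝ) < M := by exact_mod_cast (by omega : 0 < M)
  set n := M + 1 - w with hn
  have hnr : (n : ℝ) = (M : ℝ) - w + 1 := by rw [hn, Nat.cast_sub (by omega)]; push_cast; ring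
  have hn0 : (0 : ℝ) < n := by exact_mod_cast (by omega : 0 < n)
  have hnM : (n : ℝ) ≤ M := by exact_mod_cast (by omega : n ≤ M)
  have hMn : (M : ℝ) ≤ 2 * n := by exact_mod_cast (by omega : M ≤ 2 * n)
  set δ := meshX b M with hδ
  have hδ0 : 0 < δ := div_pos (by linarith) hMr
  have hMδ : (M : ℝ) * δ = 1 - 2 * b := by rw [hδ, meshX]; field_simp
  have hδn : δ ≤ 1 / n := by
    rw [le_div_iff₀ hn0]
    have := mul_le_mul_of_nonneg_left hnM hδ0.le
    linarith
  set L := Real.log a' - Real.log a with hL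
  set K := κ' - κ with hK
  set z : ℕ → ℝ := fun k => (gridX b M k + gridX b M (k + w)) / 2 with hz
  have hz' : ∀ k, z k = (b + w * δ / 2) + k * δ := by
    intro k; simp only [hz, gridX, ← hδ]; push_cast; ring
  have hz01 : ∀ k < n, |z k| ≤ 1 := by
    intro k hk
    have h1 := gridX_mem_Icc hb.le hb' (by omega : k ≤ M)
    have h2 := gridX_mem_Icc hb.le hb' (by omega : k + w ≤ M)
    rw [abs_le]
    simp only [hz]
    constructor <;> linarith [h1.1, h1.2, h2.1, h2.2]
  set φ : ℕ → ℝ := fun k => a' * Real.exp (-κ' * z k) - a * Real.exp (-κ * z k) with hφ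
  set ε : ℕ → ℝ := fun k => cellError b T M N V w x (fun z => a * Real.exp (-κ * z)) k with hε
  have hce : ∀ k, cellError b T M N V w x (fun z => a' * Real.exp (-κ' * z)) k = ε k - φ k := by
    intro k; simp only [hε, hφ, cellError, hz]; ring
  have hlow : m ^ 2 / (2 + 162 / ρ ^ 2) * (L ^ 2 + K ^ 2)
      ≤ 1 / n * ∑ k ∈ Finset.range n, φ k ^ 2 := by
    have h1 := affine_sq_le_sum (n := n) (by omega) hρ0 hz' hz01
      (by have := mul_le_mul_of_nonneg_right hMn hδ0.le; rw [hρ]; linarith) L K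
    have h2 : m ^ 2 * ∑ k ∈ Finset.range n, (L - K * z k) ^ 2 ≤ ∑ k ∈ Finset.range n, φ k ^ 2 := by
      rw [Finset.mul_sum]
      refine Finset.sum_le_sum fun k hk => ?_
      have hzk := hz01 k (Finset.mem_range.1 hk)
      have h3 := (exp_regression_bounds ha ha' hB hzk hzk).2.1
      have h4 := pow_le_pow_left₀ (by positivity) h3 2
      rw [mul_pow, sq_abs, sq_abs] at h4
      exact h4
    rw [div_mul_eq_mul_div, div_le_iff₀ (by positivity), one_div, ← div_eq_inv_mul,
      div_mul_eq_mul_div, le_div_iff₀ hn0]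
    have h5 := mul_le_mul_of_nonneg_left h1 (sq_nonneg m)
    have h6 := mul_le_mul_of_nonneg_right h2 (by positivity : 0 ≤ 2 + 162 / ρ ^ 2)
    linarith
  have hΦ0 : 0 ≤ |L| + |K| := by positivity
  have hup : |∑ k ∈ Finset.range n, φ k * ε k| ≤ C * (|L| + |K|) *
      (|∑ k ∈ Finset.range n, ε k|
      + 1 / n * ∑ j ∈ Finset.range n, |∑ k ∈ Finset.range (j + 1), ε k|) := by
    refine abs_sum_mul_le (by omega) (fun k hk => ?_) fun k hk => ?_
    · refine (exp_regression_bounds ha ha' hB (hz01 k hk) (hz01 k hk)).1.trans ?_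
      refine mul_le_mul_of_nonneg_right ?_ hΦ0
      refine mul_le_mul_of_nonneg_right ?_ (Real.exp_pos _).le
      have : 0 ≤ a * Real.exp |κ| * |κ| := by positivity
      linarith
    · refine (exp_regression_bounds ha ha' hB (hz01 (k + 1) hk) (hz01 k (by omega))).2.2.trans ?_
      have : z (k + 1) - z k = δ := by rw [hz', hz']; push_cast; ring
      rw [this, abs_of_pos hδ0]
      exact mul_le_mul_of_nonneg_left hδn (by positivity)
  have hsize : 1 / n * (|∑ k ∈ Finset.range n, ε k|
      + 1 / n * ∑ j ∈ Finset.range n, |∑ k ∈ Finset.range (j + 1), ε k|)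
      = errorSize b T M N V w x (fun z => a * Real.exp (-κ * z)) := by
    have hab : ∀ j, |partialError b T M N V w x (fun z => a * Real.exp (-κ * z)) j|
        = 1 / n * |∑ k ∈ Finset.range j, ε k| := by
      intro j
      rw [partialError, ← hnr, abs_mul, abs_of_pos (by positivity : (0 : ℝ) < 1 / n)]
    rw [errorSize, ← hn, hab, ← hnr]
    simp_rw [hab]
    rw [← Finset.mul_sum]
    ring
  have hsq : ∑ k ∈ Finset.range n, cellError b T M N V w x (fun z => a' * Real.exp (-κ' * z)) k ^ 2
      = ∑ k ∈ Finset.range n, ε k ^ 2 - 2 * ∑ k ∈ Finset.range n, φ k * ε k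
        + ∑ k ∈ Finset.range n, φ k ^ 2 := by
    rw [Finset.mul_sum, ← Finset.sum_sub_distrib, ← Finset.sum_add_distrib]
    refine Finset.sum_congr rfl fun k _ => ?_
    rw [hce]; ring
  rw [← hnr, hsq, ← hsize]
  have h7 := mul_le_mul_of_nonneg_left ((le_abs_self _).trans hup)
    (by positivity : (0 : ℝ) ≤ 1 / n)
  have h8 : 1 / (n : ℝ) * (∑ k ∈ Finset.range n, ε k ^ 2 - 2 * ∑ k ∈ Finset.range n, φ k * ε k
        + ∑ k ∈ Finset.range n, φ k ^ 2) - 1 / n * ∑ k ∈ Finset.range n, ε k ^ 2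
      = 1 / n * ∑ k ∈ Finset.range n, φ k ^ 2 - 2 * (1 / n * ∑ k ∈ Finset.range n, φ k * ε k) := by
    ring
  rw [h8]
  linarith

lemma regr_eq (r : ℝ) (ν : ℕ) (h : EuclideanSpace ℝ (Fin 3)) :
    regr r ν h = fun z => level r ν h * Real.exp (-(h 2) * z) := rfl

lemma sum_abs_le_of_quadratic {c1 c2 C1 C2 L1 L2 K E1 E2 a1 a2 b1 b2 : ℝ} (hc1 : 0 < c1)
    (hc2 : 0 < c2) (hC1 : 0 < C1) (hC2 : 0 < C2) (hE1 : 0 ≤ E1) (hE2 : 0 ≤ E2)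
    (i1 : c1 * (L1 ^ 2 + K ^ 2) - C1 * (|L1| + |K|) * E1 ≤ a1 - b1)
    (i2 : c2 * (L2 ^ 2 + K ^ 2) - C2 * (|L2| + |K|) * E2 ≤ a2 - b2) (h : a1 + a2 ≤ b1 + b2) :
    |L1| + |L2| + |K| ≤ 3 * (C1 + C2) / min c1 c2 * (E1 + E2) := by
  have hc0 : 0 < min c1 c2 := lt_min hc1 hc2
  have n1 := abs_nonneg L1
  have n2 := abs_nonneg L2
  have n3 := abs_nonneg K
  have j1 : min c1 c2 * (L1 ^ 2 + K ^ 2) ≤ c1 * (L1 ^ 2 + K ^ 2) :=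
    mul_le_mul_of_nonneg_right (min_le_left _ _) (by positivity)
  have j2 : min c1 c2 * (L2 ^ 2 + K ^ 2) ≤ c2 * (L2 ^ 2 + K ^ 2) :=
    mul_le_mul_of_nonneg_right (min_le_right _ _) (by positivity)
  have j5 : (|L1| + |L2| + |K|) ^ 2 ≤ 3 * (L1 ^ 2 + L2 ^ 2 + K ^ 2) := by
    rw [← sq_abs L1, ← sq_abs L2, ← sq_abs K]
    nlinarith [sq_nonneg (|L1| - |L2|), sq_nonneg (|L1| - |K|), sq_nonneg (|L2| - |K|)]
  generalize min c1 c2 = c at *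
  generalize hΞ : |L1| + |L2| + |K| = Ξ at *
  have hΞ0 : 0 ≤ Ξ := by linarith
  have j3 : C1 * (|L1| + |K|) * E1 ≤ (C1 + C2) * Ξ * E1 :=
    mul_le_mul_of_nonneg_right (mul_le_mul (by linarith) (by linarith) (by positivity)
      (by positivity)) hE1
  have j4 : C2 * (|L2| + |K|) * E2 ≤ (C1 + C2) * Ξ * E2 :=
    mul_le_mul_of_nonneg_right (mul_le_mul (by linarith) (by linarith) (by positivity)
      (by positivity)) hE2
  have j6 : c * Ξ ^ 2 ≤ c * (3 * (L1 ^ 2 + L2 ^ 2 + K ^ 2)) := mul_le_mul_of_nonneg_left j5 hc0.le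
  have j7 : 0 ≤ c * K ^ 2 := by positivity
  have key : c * Ξ ^ 2 ≤ 3 * (C1 + C2) * (E1 + E2) * Ξ := by linarith
  rcases hΞ0.eq_or_lt with h0 | h0
  · rw [← h0]; positivity
  · rw [div_mul_eq_mul_div, le_div_iff₀ hc0]
    refine le_of_mul_le_mul_right (le_of_eq_of_le ?_ key) h0
    ring

lemma errorSize_nonneg {b T : ℝ} {M N V w : ℕ} (hw : w ≤ M) (x : ℝ → ℝ → ℝ) (f : ℝ → ℝ) :
    0 ≤ errorSize b T M N V w x f := by
  have hw' : (w : ℝ) ≤ M := by exact_mod_cast hw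
  have : (0 : ℝ) ≤ 1 / ((M : ℝ) - w + 1) := one_div_nonneg.2 (by linarith)
  rw [errorSize]
  positivity

lemma exists_leastSquares_bound {H : Set (EuclideanSpace ℝ (Fin 3))} (hH : IsCompact H)
    (hHpos : ∀ h ∈ H, 0 < h 0 ∧ 0 < h 1) {r : ℝ} (hr : 0 < r) {e : EuclideanSpace ℝ (Fin 3)}
    (he : e ∈ H) {b : ℝ} (hb : 0 < b) (hb' : b < 1 / 2) :
    ∃ C, 0 < C ∧ ∀ (T : ℝ) (M N v w : ℕ) (x : ℝ → ℝ → ℝ) (h : EuclideanSpace ℝ (Fin 3)),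
      0 < w → 2 * w ≤ M → ratio b T M N v w = r → IsLeastSquares b T M N v w H x h →
      ‖h - e‖ ≤ C * (errorSize b T M N (1 * v) w x (regr r 1 e)
        + errorSize b T M N (2 * v) w x (regr r 2 e)) := by
  obtain ⟨C0, hC0, hnorm⟩ := exists_norm_sub_le_logDist hH hHpos hr
  obtain ⟨B, hB, hbd⟩ := exists_logDist_bound hH hHpos hr e
  have hl1 := level_pos hr one_pos (hHpos e he).1 (hHpos e he).2
  have hl2 := level_pos hr two_pos (hHpos e he).1 (hHpos e he).2
  obtain ⟨c1, C1, hc1, hC1, H1⟩ := exists_contrast_bounds hb hb' (κ := e 2) (B := B) hl1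
  obtain ⟨c2, C2, hc2, hC2, H2⟩ := exists_contrast_bounds hb hb' (κ := e 2) (B := B) hl2
  have hc0 : 0 < min c1 c2 := lt_min hc1 hc2
  refine ⟨C0 * (3 * (C1 + C2) / min c1 c2), by positivity, ?_⟩
  intro T M N v w x h hw hwM hrat hls
  have hh := hls.1
  have hmin : contrast b T M N v w x h ≤ contrast b T M N v w x e := hls.2 he
  simp only [contrast, contrastPart_eq, hrat] at hmin
  have hΞB := hbd h hh
  rw [logDist] at hΞB
  have i1 := H1 T (level r 1 h) (h 2) M N (1 * v) w x
    (level_pos hr one_pos (hHpos h hh).1 (hHpos h hh).2)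
    (by linarith [abs_nonneg (Real.log (level r 2 h) - Real.log (level r 2 e))]) hw hwM
  have i2 := H2 T (level r 2 h) (h 2) M N (2 * v) w x
    (level_pos hr two_pos (hHpos h hh).1 (hHpos h hh).2)
    (by linarith [abs_nonneg (Real.log (level r 1 h) - Real.log (level r 1 e))]) hw hwM
  simp only [← regr_eq] at i1 i2
  refine (hnorm h hh e he).trans ?_
  rw [mul_assoc]
  refine mul_le_mul_of_nonneg_left ?_ hC0.le
  exact sum_abs_le_of_quadratic hc1 hc2 hC1 hC2 (errorSize_nonneg (by omega) _ _)
    (errorSize_nonneg (by omega) _ _) i1 i2 hmin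

end Estimator

section Rate

/-- The rate `1 / √(M³ ∧ N^{3/2})`. -/
def rate (M N : ℕ) : ℝ := 1 / Real.sqrt (min ((M : ℝ) ^ 3) ((N : ℝ) ^ (3 / 2 : ℝ)))

lemma rate_pos {M N : ℕ} (hM : 0 < M) (hN : 0 < N) : 0 < rate M N := by
  have h1 : (0 : ℝ) < M := by exact_mod_cast hM
  have h2 : (0 : ℝ) < N := by exact_mod_cast hN
  have h3 : 0 < min ((M : ℝ) ^ 3) ((N : ℝ) ^ (3 / 2 : ℝ)) :=
    lt_min (by positivity) (by positivity)
  rw [rate]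
  positivity

lemma cube_le_rate_sq {M N : ℕ} (hM : 0 < M) (hN : 0 < N) {c d : ℝ} (hc : 0 ≤ c) (hd : 0 ≤ d)
    (h : d * M ≤ c * max 1 ((M : ℝ) / Real.sqrt N)) : d ^ 3 ≤ c ^ 3 * rate M N ^ 2 := by
  have h1 : (0 : ℝ) < M := by exact_mod_cast hM
  have h2 : (0 : ℝ) < N := by exact_mod_cast hN
  have hs : 0 < Real.sqrt N := Real.sqrt_pos.2 h2
  have e : Real.sqrt N ^ 3 = (N : ℝ) ^ (3 / 2 : ℝ) := by
    rw [Real.sqrt_eq_rpow, ← Real.rpow_natCast, ← Real.rpow_mul h2.le]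
    norm_num
  have h3 : 0 < min ((M : ℝ) ^ 3) ((N : ℝ) ^ (3 / 2 : ℝ)) :=
    lt_min (by positivity) (by positivity)
  rw [rate, one_div_pow, Real.sq_sqrt h3.le, mul_one_div]
  rcases le_total 1 ((M : ℝ) / Real.sqrt N) with hm | hm
  · rw [max_eq_right hm] at h
    have h4 : d ≤ c / Real.sqrt N := by
      rw [le_div_iff₀ hs]
      refine le_of_mul_le_mul_right ?_ (div_pos h1 hs)
      refine le_of_eq_of_le ?_ h
      field_simp
    calc d ^ 3 ≤ (c / Real.sqrt N) ^ 3 := pow_le_pow_left₀ hd h4 3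
      _ = c ^ 3 / (N : ℝ) ^ (3 / 2 : ℝ) := by rw [div_pow, e]
      _ ≤ _ := div_le_div_of_nonneg_left (by positivity) h3 (min_le_right _ _)
  · rw [max_eq_left hm, mul_one] at h
    have h4 : d ≤ c / M := by rwa [le_div_iff₀ h1]
    calc d ^ 3 ≤ (c / M) ^ 3 := pow_le_pow_left₀ hd h4 3
      _ = c ^ 3 / (M : ℝ) ^ 3 := by rw [div_pow]
      _ ≤ _ := div_le_div_of_nonneg_left (by positivity) h3 (min_le_left _ _)

/-- What the growth conditions on `v` and `w` give along the filter. -/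
lemma exists_eventually_regime {b T : ℝ} (hb : 0 < b) (hb' : b < 1 / 2) (hT : 0 < T)
    {ι : Type*} {l : Filter ι} {M N v w : ι → ℕ} (hM : Tendsto M l atTop) (hN : Tendsto N l atTop)
    (hv : (fun n => (v n : ℝ)) =Θ[l] fun n => max 1 ((N n : ℝ) / (M n : ℝ) ^ 2))
    (hw : (fun n => (w n : ℝ)) =Θ[l] fun n => max 1 ((M n : ℝ) / Real.sqrt (N n))) :
    ∃ c > 0, ∀ᶠ n in l, 0 < v n ∧ 0 < w n ∧ 2 * w n ≤ M n ∧ 4 * v n ≤ N n ∧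
      2 * v n * meshT T (N n) ≤ 1 ∧ (w n * meshX b (M n)) ^ 3 ≤ c * rate (M n) (N n) ^ 2 := by
  obtain ⟨c1, hc1, h1⟩ := hv.1.exists_pos
  obtain ⟨c2, hc2, h2⟩ := hv.2.exists_pos
  obtain ⟨c3, hc3, h3⟩ := hw.1.exists_pos
  obtain ⟨c4, hc4, h4⟩ := hw.2.exists_pos
  have hMr : Tendsto (fun n => (M n : ℝ)) l atTop := tendsto_natCast_atTop_atTop.comp hM
  have hNr : Tendsto (fun n => (N n : ℝ)) l atTop := tendsto_natCast_atTop_atTop.comp hN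
  set γ := min (1 / 4) (1 / (2 * T)) with hγ
  have hγ0 : 0 < γ := lt_min (by norm_num) (by positivity)
  refine ⟨c3 ^ 3, by positivity, ?_⟩
  filter_upwards [h1.bound, h2.bound, h3.bound, h4.bound, hMr.eventually_ge_atTop (2 * c3 + 1),
    hMr.eventually_ge_atTop (c1 / γ), hNr.eventually_ge_atTop (c1 / γ + 1),
    hNr.eventually_ge_atTop ((2 * c3) ^ 2)] with n b1 b2 b3 b4 m1 m2 k1 k2
  have hm0 : (0 : ℝ) < M n := by linarith
  have hk0 : (0 : ℝ) < N n := by linarith [div_pos hc1 hγ0]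
  have hm1 : (1 : ℝ) ≤ M n := by linarith
  have hs : 0 < Real.sqrt (N n) := Real.sqrt_pos.2 hk0
  have n1 : (1 : ℝ) ≤ max 1 ((N n : ℝ) / (M n : ℝ) ^ 2) := le_max_left _ _
  have n2 : (1 : ℝ) ≤ max 1 ((M n : ℝ) / Real.sqrt (N n)) := le_max_left _ _
  rw [Real.norm_of_nonneg (by positivity), Real.norm_of_nonneg (by linarith)] at b1 b2 b3 b4
  have hv0 : (0 : ℝ) < v n := by
    by_contra h
    have := mul_nonpos_of_nonneg_of_nonpos hc2.le (not_lt.1 h)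
    linarith
  have hw0 : (0 : ℝ) < w n := by
    by_contra h
    have := mul_nonpos_of_nonneg_of_nonpos hc4.le (not_lt.1 h)
    linarith
  have hwM : (w n : ℝ) ≤ M n / 2 := by
    refine b3.trans ?_
    rw [mul_max_of_nonneg _ _ hc3.le]
    refine max_le (by linarith) ?_
    have : 2 * c3 ≤ Real.sqrt (N n) := Real.le_sqrt_of_sq_le k2
    rw [mul_div_assoc', div_le_iff₀ hs]
    have := mul_le_mul_of_nonneg_left this hm0.le
    linarith
  have hvN : (v n : ℝ) ≤ γ * N n := by
    refine b1.trans ?_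
    rw [mul_max_of_nonneg _ _ hc1.le]
    rw [div_le_iff₀ hγ0] at m2
    have k1' : c1 / γ ≤ N n := by linarith
    rw [div_le_iff₀ hγ0] at k1'
    refine max_le (by linarith) ?_
    rw [mul_div_assoc', div_le_iff₀ (by positivity)]
    have e1 : (M n : ℝ) * γ ≤ (M n : ℝ) ^ 2 * γ :=
      mul_le_mul_of_nonneg_right (by nlinarith) hγ0.le
    have := mul_le_mul_of_nonneg_right (m2.trans e1) hk0.le
    linarith
  have hγ1 : γ * N n ≤ 1 / 4 * N n := mul_le_mul_of_nonneg_right (min_le_left _ _) hk0.le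
  have hγ2 : γ * N n ≤ 1 / (2 * T) * N n := mul_le_mul_of_nonneg_right (min_le_right _ _) hk0.le
  refine ⟨by exact_mod_cast hv0, by exact_mod_cast hw0, ?_, ?_, ?_, ?_⟩
  · have : (2 : ℝ) * w n ≤ M n := by linarith
    exact_mod_cast this
  · have : (4 : ℝ) * v n ≤ N n := by linarith
    exact_mod_cast this
  · rw [meshT, mul_div_assoc', div_le_one hk0]
    have h5 : (v n : ℝ) * (2 * T) ≤ 1 / (2 * T) * N n * (2 * T) :=
      mul_le_mul_of_nonneg_right (hvN.trans hγ2) (by positivity)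
    have h6 : 1 / (2 * T) * N n * (2 * T) = N n := by field_simp
    linarith
  · have hmesh : 0 ≤ meshX b (M n) := div_nonneg (by linarith) hm0.le
    refine cube_le_rate_sq (by exact_mod_cast hm0) (by exact_mod_cast hk0) hc3.le
      (by positivity) (le_trans ?_ b3)
    rw [meshX, mul_assoc, div_mul_cancel₀ _ hm0.ne']
    exact mul_le_of_le_one_right hw0.le (by linarith)

variable {Ω : Type*} [MeasurableSpace Ω] {P : Measure Ω} [IsProbabilityMeasure P]

/-- Young's inequality turns second moment bounds on the partial sums into an integrable
majorant of `errorSize`. -/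
lemma exists_errorSize_majorant {b T : ℝ} {M N V w : ℕ} {x : Ω → ℝ → ℝ → ℝ} {f : ℝ → ℝ} {q θ : ℝ}
    (hθ : 0 < θ) (hw : w ≤ M)
    (hS : ∀ m ≤ M + 1 - w, Integrable (fun ω => partialError b T M N V w (x ω) f m ^ 2) P ∧
      ∫ ω, partialError b T M N V w (x ω) f m ^ 2 ∂P ≤ q) :
    ∃ Q : Ω → ℝ, Integrable Q P ∧ (∀ ω, errorSize b T M N V w (x ω) f ≤ Q ω) ∧
      ∫ ω, Q ω ∂P ≤ q / θ + θ := by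
  set n := M + 1 - w with hn
  have hnr : (n : ℝ) = (M : ℝ) - w + 1 := by rw [hn, Nat.cast_sub (by omega)]; push_cast; ring
  have hn0 : (0 : ℝ) < n := by exact_mod_cast (by omega : 0 < n)
  set Y : ℕ → Ω → ℝ := fun m ω => (partialError b T M N V w (x ω) f m ^ 2 / θ + θ) / 2 with hY
  have hYi : ∀ m ≤ n, Integrable (Y m) P := fun m hm =>
    (((hS m hm).1.div_const θ).add (integrable_const θ)).div_const 2
  have hYv : ∀ m ≤ n, ∫ ω, Y m ω ∂P ≤ (q / θ + θ) / 2 := by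
    intro m hm
    simp only [hY]
    rw [integral_div, integral_add ((hS m hm).1.div_const θ) (integrable_const θ), integral_div,
      integral_const, probReal_univ, one_smul]
    have := div_le_div_of_nonneg_right (hS m hm).2 hθ.le
    linarith
  have hYle : ∀ m ω, |partialError b T M N V w (x ω) f m| ≤ Y m ω := by
    intro m ω
    simp only [hY]
    set s := partialError b T M N V w (x ω) f m
    have h1 : s ^ 2 / θ + θ - 2 * |s| = (|s| - θ) ^ 2 / θ := by
      rw [← sq_abs s]; field_simp; ring
    have h2 : 0 ≤ (|s| - θ) ^ 2 / θ := by positivity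
    linarith
  have hsum : Integrable (fun ω => ∑ j ∈ Finset.range n, Y (j + 1) ω) P :=
    integrable_finsetSum _ fun j hj => hYi _ (Finset.mem_range.1 hj)
  refine ⟨fun ω => Y n ω + 1 / n * ∑ j ∈ Finset.range n, Y (j + 1) ω,
    (hYi n le_rfl).add (hsum.const_mul _), fun ω => ?_, ?_⟩
  · rw [errorSize, ← hn, ← hnr]
    exact add_le_add (hYle n ω) (mul_le_mul_of_nonneg_left
      (Finset.sum_le_sum fun j _ => hYle _ ω) (by positivity))
  · rw [integral_add (hYi n le_rfl) (hsum.const_mul _), integral_const_mul,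
      integral_finsetSum _ fun j hj => hYi _ (Finset.mem_range.1 hj)]
    have h1 : ∑ j ∈ Finset.range n, ∫ ω, Y (j + 1) ω ∂P ≤ n * ((q / θ + θ) / 2) := by
      refine (Finset.sum_le_card_nsmul _ _ _ fun j hj => hYv (j + 1) (Finset.mem_range.1 hj)).trans
        (le_of_eq ?_)
      rw [Finset.card_range, nsmul_eq_mul]
    have h2 : 1 / (n : ℝ) * ∑ j ∈ Finset.range n, ∫ ω, Y (j + 1) ω ∂P ≤ (q / θ + θ) / 2 := by
      rw [one_div, ← div_eq_inv_mul, div_le_iff₀ hn0]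
      linarith
    linarith [hYv n le_rfl]

variable {p : Coeffs} {β : ℕ → ℝ≥0 → Ω → ℝ} {u : ℕ → ℝ → Ω → ℝ} {X : ℝ → ℝ → Ω → ℝ}

/-- The statistic controlling the estimator is of the order of the rate, in mean. -/
lemma IsStationarySolution.exists_errorSize_mean_bound (hp : p.Admissible)
    (hX : IsStationarySolution P p β u X) {b T : ℝ} (hb : 0 < b) (hb' : b < 1 / 2) (hT : 0 < T)
    {r : ℝ} (hr : 0 < r) {c : ℝ} (hc : 0 < c) :
    ∃ C > 0, ∀ M N v w ν : ℕ, 0 < v → 0 < w → 2 * w ≤ M → 4 * v ≤ N → 2 * v * meshT T N ≤ 1 →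
      ratio b T M N v w = r → (w * meshX b M) ^ 3 ≤ c * rate M N ^ 2 → 0 < ν → ν ≤ 2 →
      ∃ Q : Ω → ℝ, Integrable Q P ∧
        (∀ ω, errorSize b T M N (ν * v) w (fun t x => X t x ω) (regr r ν p.eta) ≤ Q ω) ∧
        ∫ ω, Q ω ∂P ≤ C * rate M N := by
  obtain ⟨C, hC, hbd⟩ := hX.exists_second_moment_bound hp hb hb' hT
  set A := C * (1 + (1 + 2 / r ^ 2) ^ 2) with hA
  have hA0 : 0 < A := by positivity
  refine ⟨A * c + 1, by positivity, ?_⟩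
  intro M N v w ν hv hw hwM hvN hvT hrat hd3 hν hν2
  have hM0 : 0 < M := by omega
  have hN0 : 0 < N := by omega
  have hMr : (0 : ℝ) < M := by exact_mod_cast hM0
  have hNr : (0 : ℝ) < N := by exact_mod_cast hN0
  have hwr : (0 : ℝ) < w := by exact_mod_cast hw
  have hvr : (0 : ℝ) < v := by exact_mod_cast hv
  have hνr : (0 : ℝ) < ν := by exact_mod_cast hν
  have hν2r : (ν : ℝ) ≤ 2 := by exact_mod_cast hν2
  have hτ : 0 < meshT T N := div_pos hT hNr
  have hδ : 0 < meshX b M := div_pos (by linarith) hMr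
  have hθ := rate_pos hM0 hN0
  set θ := rate M N
  set τ := meshT T N with hτd
  set d := (w : ℝ) * meshX b M with hd
  have hd0 : 0 < d := by positivity
  have hd1 : d ≤ 1 := by
    have hwM' : 2 * (w : ℝ) ≤ M := by exact_mod_cast hwM
    rw [hd, meshX, mul_div_assoc', div_le_one hMr]
    have := mul_le_of_le_one_right hwr.le (by linarith : 1 - 2 * b ≤ 1)
    linarith
  have hs0 : 0 < Real.sqrt (v * τ) := Real.sqrt_pos.2 (by positivity)
  have hrat' : d / Real.sqrt (v * τ) = r := hrat
  have hvτ : v * τ = d ^ 2 / r ^ 2 := by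
    rw [← hrat', div_pow, Real.sq_sqrt (by positivity)]
    field_simp
  have hVτ : ((ν * v : ℕ) : ℝ) * τ = ν * (v * τ) := by push_cast; ring
  have hratν : d / Real.sqrt (((ν * v : ℕ) : ℝ) * τ) = r / Real.sqrt ν := by
    rw [hVτ, Real.sqrt_mul hνr.le, ← hrat', div_div, mul_comm]
  have hVle : ((ν * v : ℕ) : ℝ) * τ ≤ 2 * (v * τ) := by
    rw [hVτ]; exact mul_le_mul_of_nonneg_right hν2r (by positivity)
  have hνv : ν * v ≤ 2 * v := Nat.mul_le_mul_right v hν2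
  have hmom : ∀ m ≤ M + 1 - w,
      Integrable (fun ω => partialError b T M N (ν * v) w (fun t x => X t x ω)
        (regr r ν p.eta) m ^ 2) P ∧
      ∫ ω, partialError b T M N (ν * v) w (fun t x => X t x ω) (regr r ν p.eta) m ^ 2 ∂P
        ≤ A * c * θ ^ 2 := by
    intro m hm
    obtain ⟨h1, h2⟩ := hbd M N (ν * v) w m (by positivity) hw hwM (by omega)
      (hVle.trans (by linarith)) hm (regr r ν p.eta) (fun z => by
        rw [← hτd, ← hd, hratν]; rfl)
    refine ⟨h1, h2.trans ?_⟩
    rw [← hτd, ← hd]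
    have e1 : d ^ 2 + ((ν * v : ℕ) : ℝ) * τ ≤ (1 + 2 / r ^ 2) * d ^ 2 := by
      refine (add_le_add le_rfl hVle).trans (le_of_eq ?_)
      rw [hvτ]; ring
    have e2 : (d ^ 2 + ((ν * v : ℕ) : ℝ) * τ) ^ 2 ≤ (1 + 2 / r ^ 2) ^ 2 * d ^ 3 := by
      refine (pow_le_pow_left₀ (by positivity) e1 2).trans ?_
      rw [mul_pow]
      refine mul_le_mul_of_nonneg_left ?_ (by positivity)
      rw [← pow_mul]
      exact pow_le_pow_of_le_one hd0.le hd1 (by norm_num)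
    calc _ ≤ C * (d ^ 3 + (1 + 2 / r ^ 2) ^ 2 * d ^ 3) := by gcongr
      _ = A * d ^ 3 := by rw [hA]; ring
      _ ≤ A * (c * θ ^ 2) := mul_le_mul_of_nonneg_left hd3 hA0.le
      _ = _ := by ring
  obtain ⟨Q, hQ1, hQ2, hQ3⟩ := exists_errorSize_majorant hθ (by omega) hmom
  refine ⟨Q, hQ1, hQ2, hQ3.trans (le_of_eq ?_)⟩
  field_simp

end Rate

end SPDE
end

theorem mainTheorem5 {Ω : Type*} [MeasurableSpace Ω] (P : Measure Ω) [IsProbabilityMeasure P]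
    (p : SPDE.Coeffs) (hp : p.Admissible)
    (β : ℕ → ℝ≥0 → Ω → ℝ) (u : ℕ → ℝ → Ω → ℝ) (X : ℝ → ℝ → Ω → ℝ)
    (hX : SPDE.IsStationarySolution P p β u X)
    (b T : ℝ) (hb : 0 < b) (hb' : b < 1 / 2) (hT : 0 < T)
    (H : Set (EuclideanSpace ℝ (Fin 3))) (hH : IsCompact H)
    (hHpos : ∀ h ∈ H, 0 < h 0 ∧ 0 < h 1) (hη : p.eta ∈ interior H)
    {ι : Type*} (l : Filter ι) [l.IsCountablyGenerated]
    (M N v w : ι → ℕ) (hM : Tendsto M l atTop) (hN : Tendsto N l atTop)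
    (hv : (fun n => (v n : ℝ)) =Θ[l] fun n => max 1 ((N n : ℝ) / (M n : ℝ) ^ 2))
    (hw : (fun n => (w n : ℝ)) =Θ[l] fun n => max 1 ((M n : ℝ) / Real.sqrt (N n)))
    (r : ℝ) (hr : ∀ᶠ n in l, SPDE.ratio b T (M n) (N n) (v n) (w n) = r)
    (ηhat : ι → Ω → EuclideanSpace ℝ (Fin 3))
    (hηhat : ∀ n, ∀ᵐ ω ∂P, SPDE.IsLeastSquares b T (M n) (N n) (v n) (w n) H
      (fun t x => X t x ω) (ηhat n ω)) :
    SPDE.IsBigOP P l (fun n ω => ‖ηhat n ω - p.eta‖)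
      (fun n => 1 / Real.sqrt (min ((M n : ℝ) ^ 3) ((N n : ℝ) ^ (3 / 2 : ℝ)))) := by
  rcases l.eq_or_neBot with rfl | hl
  · intro ε _
    exact ⟨1, one_pos, by simp [limsup_bot]⟩
  obtain ⟨c, hc, hreg⟩ := SPDE.exists_eventually_regime hb hb' hT hM hN hv hw
  have hr0 : 0 < r := by
    obtain ⟨n, hn, h1, h2, h3, h4, -, -⟩ := (hr.and hreg).exists
    have hMr : (0 : ℝ) < M n := by exact_mod_cast (by omega : 0 < M n)
    have hNr : (0 : ℝ) < N n := by exact_mod_cast (by omega : 0 < N n)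
    have hwr : (0 : ℝ) < w n := by exact_mod_cast h2
    have hvr : (0 : ℝ) < v n := by exact_mod_cast h1
    have hb2 : 0 < 1 - 2 * b := by linarith
    rw [← hn, SPDE.ratio, SPDE.meshX, SPDE.meshT]
    positivity
  obtain ⟨C, hC, hls⟩ := SPDE.exists_leastSquares_bound hH hHpos hr0 (interior_subset hη) hb hb'
  obtain ⟨A, hA, hmean⟩ := hX.exists_errorSize_mean_bound hp hb hb' hT hr0 hc
  intro ε hε
  refine ⟨2 * C * A / ε, by positivity, limsup_le_of_le (by isBoundedDefault) ?_⟩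
  filter_upwards [hr, hreg] with n hrn ⟨h1, h2, h3, h4, h5, h6⟩
  obtain ⟨Q₁, i1, j1, k1⟩ := hmean (M n) (N n) (v n) (w n) 1 h1 h2 h3 h4 h5 hrn h6 one_pos
    one_le_two
  obtain ⟨Q₂, i2, j2, k2⟩ := hmean (M n) (N n) (v n) (w n) 2 h1 h2 h3 h4 h5 hrn h6 two_pos le_rfl
  have hθ : 0 < SPDE.rate (M n) (N n) := SPDE.rate_pos (by omega) (by omega)
  change P {ω | 2 * C * A / ε * SPDE.rate (M n) (N n) ≤ |‖ηhat n ω - p.eta‖|} ≤ _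
  set θ := SPDE.rate (M n) (N n)
  have hQ0 : ∀ ω, 0 ≤ C * (Q₁ ω + Q₂ ω) := fun ω => mul_nonneg hC.le (add_nonneg
    ((SPDE.errorSize_nonneg (by omega) _ _).trans (j1 ω))
    ((SPDE.errorSize_nonneg (by omega) _ _).trans (j2 ω)))
  have hQi : Integrable (fun ω => C * (Q₁ ω + Q₂ ω)) P := (i1.add i2).const_mul C
  have hsub : P {ω | 2 * C * A / ε * θ ≤ |‖ηhat n ω - p.eta‖|}
      ≤ P {ω | 2 * C * A / ε * θ ≤ C * (Q₁ ω + Q₂ ω)} := by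
    refine measure_mono_ae ?_
    filter_upwards [hηhat n] with ω hω hmem
    have hmem' : 2 * C * A / ε * θ ≤ |‖ηhat n ω - p.eta‖| := hmem
    rw [abs_of_nonneg (norm_nonneg _)] at hmem'
    refine (hmem'.trans (hls T _ _ _ _ _ _ h2 h3 hrn hω)).trans ?_
    exact mul_le_mul_of_nonneg_left (add_le_add (j1 ω) (j2 ω)) hC.le
  refine hsub.trans ?_
  have hmk := mul_meas_ge_le_integral_of_nonneg (ae_of_all P hQ0) hQi (2 * C * A / ε * θ)
  have hI : ∫ ω, C * (Q₁ ω + Q₂ ω) ∂P ≤ 2 * C * A * θ := by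
    rw [integral_const_mul, integral_add i1 i2]
    have := mul_le_mul_of_nonneg_left (add_le_add k1 k2) hC.le
    linarith
  rw [← ofReal_measureReal]
  refine ENNReal.ofReal_le_ofReal ?_
  have hpos : 0 < 2 * C * A / ε * θ := by positivity
  refine le_of_mul_le_mul_left ((hmk.trans hI).trans (le_of_eq ?_)) hpos
  field_simp
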